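/- **Setting.** One observes $Z(t)=\int_0^t f(x)\,dx+n^{-1/2}B(t)$, $0\le t\le 1$, with $B$ a standard Brownian motion. For $\alpha>0$, $M>0$ let $k$ be the greatest integer strictly less than $\alpha$ and $$F(\alpha,M)=\{f:[0,1]\to\mathbb R:\ f \text{ is } k \text{ times differentiable and } |f^{(k)}(x)-f^{(k)}(y)|\le M|x-y|^{\alpha-k},\ 0\le x<y\le1\}.$$ The risk of $\hat f$ near $x_0$ is $R(\hat f,f;x_0,c)=\frac1{2c}E_f\int_{x_0-c}^{x_0+c}(\hat f(x)-f(x))^2dx$ for $c>0$, and $R(\hat f,f;x_0,0)=E_f(\hat f(x_0)-f(x_0))^2$. Let $\{\phi_{j_0,k}:1\le k\le 2^{j_0}\}\cup\{\psi_{j,k}: j\ge j_0,\ 1\le k\le 2^j\}$ be a compactly supported, boundary-corrected orthonormal wavelet basis of $L^2[0,1]$. That is: in the interior $\phi_{j_0,k}(t)=2^{j_0/2}\phi(2^{j_0}t-k)$ and $\psi_{j,k}(t)=2^{j/2}\psi(2^jt-k)$, where $\phi,\psi$ have compact support, $\phi$ is continuous and $\int\phi=1$; a fixed number of the first (last) functions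 at each level are $2^{j/2}$ times the dilates by $2^j$ of fixed compactly supported edge functions on $[0,\infty)$ (on $(-\infty,0]$), based at the endpoint $0$ (at $1$); all these basis functions are supported in $[0,1]$. The edge functions of $\phi$ are continuous up to the edge. The wavelet is $r$-regular: $\psi$ and its edge functions have $r$ vanishing moments and $r$ continuous derivatives (up to the edge). Let $\tilde y_{j_0,k}=\int_0^1\phi_{j_0,k}\,dZ$ and $y_{j,k}=\int_0^1\psi_{j,k}\,dZ$ be the empirical coefficients. Let $\lambda_*=4.50524\ldots$ be the root larger than $1$ of $\lambda-\log\lambda-1=2$, and let $L=L_n$ be $\log n$ rounded to an integer (up or down). At each level $j$ let $(jb)=\{k\le 2^j:(b-1)L+1\le k\le bL\}$ and $S_{(jb)}^2=\sum_{k\in(jb)}y_{j,k}^2$. Given $x_0$ and $c_n$, let $J$ be the smallest integer with $2^J\ge n$. If $c_n>0$ let $J_*$, $J^*$ be the smallest integers $\ge 0$ with $2^{J_*}\ge c_n^{-1}$, $2^{J^*}\ge c_n^{-1}\log n$; replace $J_*$ by $j_0$ if $J_*<j_0$; let $H^*$ be the set of $(j,k)$ with $J_*\le j<J^*$ and $\mathrm{supp}(\psi_{j,k})\cap[x_0-c_n,x_0+c_n]\ne\emptyset$,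 and $S_v^2=\sum_{(j,k)\in H^*}y_{j,k}^2$. Define $$\hat f_n(x)=\sum_{k=1}^{2^{j_0}}\tilde y_{j_0,k}\phi_{j_0,k}(x)+\sum_{j\ge j_0}\sum_{k=1}^{2^j}\hat\theta_{j,k}\psi_{j,k}(x),$$ where $\hat\theta_{j,k}=0$ for $j\ge J$, and for $j_0\le j<J$: * if $c_n>\frac{\log n}{n}$ (hybrid estimator), $$\hat\theta_{j,k}=\begin{cases}\mathrm{sgn}(y_{j,k})\big(|y_{j,k}|-\sqrt{2n^{-1}\log n}\big)_+,& j<J^*,\ (j,k)\notin H^*,\\ \big(1-\lambda_*\,\mathrm{Card}(H^*)\,n^{-1}/S_v^2\big)_+\,y_{j,k},&(j,k)\in H^*,\\ \big(1-\lambda_*Ln^{-1}/S_{(jb)}^2\big)_+\,y_{j,k},& j\ge J^*,\ k\in(jb);\end{cases}$$ * if $c_n\le\frac{\log n}{n}$ (BlockJS estimator), $\hat\theta_{j,k}=\big(1-\lambda_*Ln^{-1}/S_{(jb)}^2\big)_+\,y_{j,k}$ for $k\in(jb)$. **Theorem 3.** Suppose $0<\alpha<r$, $M>0$, $0<x_0<1$,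 $c_n=d_nn^{-1/(1+2\alpha)}$ with $d_n\ge0$, and $[x_0-c_n,x_0+c_n]\subset[0,1]$ for all large $n$. Then the estimator $\hat f_n$, whose construction does not use $\alpha$ or $M$ (only $x_0$, $c_n$, $n$ and the basis), satisfies: (i) If $\limsup_n d_n(\log n)^{-1/(1+2\alpha)}<\infty$, then $\limsup_n\big(\tfrac n{\log n}\big)^{2\alpha/(1+2\alpha)}\sup_{f\in F(\alpha,M)}R(\hat f_n,f;x_0,c_n)<\infty.$ (ii) If $\liminf_n d_n(\log n)^{-1/(1+2\alpha)}=\infty$ and $\limsup_n d_n(\log n)^{-1}=0$, then $\limsup_n n^{2\alpha/(1+2\alpha)}\tfrac{d_n}{\log n}\sup_{f\in F(\alpha,M)}R(\hat f_n,f;x_0,c_n)<\infty.$ (iii) If $\liminf_n d_n(\log n)^{-1}>0$, then $\limsup_n n^{2\alpha/(1+2\alpha)}\sup_{f\in F(\alpha,M)}R(\hat f_n,f;x_0,c_n)<\infty.$ -/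

import Mathlib

open MeasureTheory ProbabilityTheory Filter Set
open scoped NNReal ENNReal Topology

noncomputable section

namespace ShrinkNbhd

/-! ### Hölder classes, the white noise model and the local risk -/

/-- The Hölder class `F(α, M)` on `[0, 1]`: `k = ⌈α⌉ - 1` is the greatest integer strictly less
than `α`, and the `k`-th derivative is `(α - k)`-Hölder with constant `M`.
Only the values of `f` on `[0, 1]` matter. -/
def holderClass (α M : ℝ) : Set (ℝ → ℝ) :=
  {f | ContDiffOn ℝ ((⌈α⌉₊ - 1 : ℕ) : WithTop ℕ∞) f (Icc 0 1) ∧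
    ∀ x y : ℝ, 0 ≤ x → x < y → y ≤ 1 →
      |iteratedDerivWithin (⌈α⌉₊ - 1) f (Icc 0 1) x -
          iteratedDerivWithin (⌈α⌉₊ - 1) f (Icc 0 1) y| ≤
        M * |x - y| ^ (α - ((⌈α⌉₊ - 1 : ℕ) : ℝ))}

/-- The observed process `Z(t) = ∫₀ᵗ f(x) dx + n^{-1/2} B(t)` (used for `0 ≤ t ≤ 1` only). -/
def observation {Ω : Type*} (B : ℝ≥0 → Ω → ℝ) (n : ℕ) (f : ℝ → ℝ) (t : ℝ≥0) (ω : Ω) : ℝ :=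
  (∫ x in (0 : ℝ)..(t : ℝ), f x) + 1 / √(n : ℝ) * B t ω

/-- The Riemann sum `∑_{i < m} g(i/m) (Z((i+1)/m) - Z(i/m))`. -/
def riemannSum {Ω : Type*} (g : ℝ → ℝ) (Z : ℝ≥0 → Ω → ℝ) (m : ℕ) (ω : Ω) : ℝ :=
  ∑ i ∈ Finset.range m, g ((i : ℝ) / m) *
    (Z (((i : ℝ≥0) + 1) / (m : ℝ≥0)) ω - Z ((i : ℝ≥0) / (m : ℝ≥0)) ω)

/-- `Y` is (a version of) the stochastic integral `∫₀¹ g dZ`: the mean square limit of the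
Riemann sums. -/
def IsStochIntegral {Ω : Type*} [MeasurableSpace Ω] (P : Measure Ω)
    (g : ℝ → ℝ) (Z : ℝ≥0 → Ω → ℝ) (Y : Ω → ℝ) : Prop :=
  Measurable Y ∧
    Tendsto (fun m : ℕ => ∫⁻ ω, ENNReal.ofReal ((riemannSum g Z m ω - Y ω) ^ 2) ∂P)
      atTop (𝓝 0)

open Classical in
/-- The stochastic integral `∫₀¹ g dZ` (for `g` continuous on `[0, 1]`, `Z` as observed);
it is determined up to a `P`-null set. -/
def stochIntegral {Ω : Type*} [MeasurableSpace Ω] (P : Measure Ω)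
    (g : ℝ → ℝ) (Z : ℝ≥0 → Ω → ℝ) : Ω → ℝ :=
  if h : ∃ Y, IsStochIntegral P g Z Y then h.choose else fun _ => 0

open Classical in
/-- The local risk `R(f̂, f; x₀, c) = (2c)⁻¹ E ∫_{x₀-c}^{x₀+c} (f̂(x) - f(x))² dx` for `c > 0`;
for `c = 0` it is the mean squared error `E (f̂(x₀) - f(x₀))²` at the point `x₀`. -/
def risk {Ω : Type*} [MeasurableSpace Ω] (P : Measure Ω) (fhat : Ω → ℝ → ℝ) (f : ℝ → ℝ)
    (x₀ c : ℝ) : ℝ≥0∞ :=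
  if c = 0 then ∫⁻ ω, ENNReal.ofReal ((fhat ω x₀ - f x₀) ^ 2) ∂P
  else ENNReal.ofReal (1 / (2 * c)) *
    ∫⁻ ω, (∫⁻ x in Icc (x₀ - c) (x₀ + c), ENNReal.ofReal ((fhat ω x - f x) ^ 2)) ∂P

/-! ### Boundary-corrected wavelet bases of `L²[0, 1]` -/

/-- A function on the line (for the interior), `nL` functions on `[0, ∞)` for the left edge and
`nR` functions on `(-∞, 0]` for the right edge (numbered from `1`, extended by zero). -/
structure EdgeFamily where
  mother : ℝ → ℝ
  left : ℕ → ℝ → ℝ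
  right : ℕ → ℝ → ℝ
  nL : ℕ
  nR : ℕ

namespace EdgeFamily

/-- The `k`-th function at level `j`, `1 ≤ k ≤ 2^j`: it is `2^{j/2} g(2^j t - k)` in the interior;
the first `nL` and the last `nR` functions are dilates of the left edge functions, based at `0`,
and of the right edge functions, based at `1`. -/
def fn (G : EdgeFamily) (j k : ℕ) (t : ℝ) : ℝ :=
  if k ≤ G.nL then √(2 ^ j : ℝ) * G.left k (2 ^ j * t)
  else if k + G.nR ≤ 2 ^ j then √(2 ^ j : ℝ) * G.mother (2 ^ j * t - k)
  else √(2 ^ j : ℝ) * G.right (2 ^ j + 1 - k) (2 ^ j * (t - 1))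

/-- All functions are compactly supported, and from level `j₀` on the functions `fn j k`,
`1 ≤ k ≤ 2^j`, are supported in `[0, 1]`. -/
structure Fits (G : EdgeFamily) (j₀ : ℕ) : Prop where
  card : G.nL + G.nR ≤ 2 ^ j₀
  mother : tsupport G.mother ⊆ Icc (-((G.nL : ℝ) + 1)) (G.nR : ℝ)
  left : ∀ k ∈ Finset.Icc 1 G.nL, tsupport (G.left k) ⊆ Icc 0 (2 ^ j₀)
  right : ∀ k ∈ Finset.Icc 1 G.nR, tsupport (G.right k) ⊆ Icc (-(2 ^ j₀)) 0

/-- `r` continuous derivatives (up to the edge, for the edge functions). -/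
structure Smooth (G : EdgeFamily) (r : ℕ) : Prop where
  mother : ContDiff ℝ (r : WithTop ℕ∞) G.mother
  left : ∀ k ∈ Finset.Icc 1 G.nL, ContDiffOn ℝ (r : WithTop ℕ∞) (G.left k) (Ici 0)
  right : ∀ k ∈ Finset.Icc 1 G.nR, ContDiffOn ℝ (r : WithTop ℕ∞) (G.right k) (Iic 0)

/-- `r` vanishing moments. -/
structure VanishingMoments (G : EdgeFamily) (r : ℕ) : Prop where
  mother : ∀ i < r, ∫ t, t ^ i * G.mother t = 0
  left : ∀ k ∈ Finset.Icc 1 G.nL, ∀ i < r, ∫ t in Ici (0 : ℝ), t ^ i * G.left k t = 0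
  right : ∀ k ∈ Finset.Icc 1 G.nR, ∀ i < r, ∫ t in Iic (0 : ℝ), t ^ i * G.right k t = 0

end EdgeFamily

/-- A compactly supported, boundary-corrected orthonormal wavelet basis of `L²[0, 1]` with
`r`-regular wavelets: the functions `φ_{j₀,k}`, `1 ≤ k ≤ 2^{j₀}`, and `ψ_{j,k}`, `j ≥ j₀`,
`1 ≤ k ≤ 2^j`. -/
structure WaveletBasis (r : ℕ) where
  φ : EdgeFamily
  ψ : EdgeFamily
  j₀ : ℕ
  φ_fits : φ.Fits j₀
  φ_continuous : φ.Smooth 0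
  φ_integral : ∫ t, φ.mother t = 1
  ψ_fits : ψ.Fits j₀
  ψ_smooth : ψ.Smooth r
  ψ_moments : ψ.VanishingMoments r
  orthonormal_φ : ∀ k ∈ Finset.Icc 1 (2 ^ j₀), ∀ k' ∈ Finset.Icc 1 (2 ^ j₀),
    ∫ t in Icc (0 : ℝ) 1, φ.fn j₀ k t * φ.fn j₀ k' t = if k = k' then 1 else 0
  orthogonal_φψ : ∀ k ∈ Finset.Icc 1 (2 ^ j₀), ∀ j ≥ j₀, ∀ k' ∈ Finset.Icc 1 (2 ^ j),
    ∫ t in Icc (0 : ℝ) 1, φ.fn j₀ k t * ψ.fn j k' t = 0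
  orthonormal_ψ : ∀ j ≥ j₀, ∀ k ∈ Finset.Icc 1 (2 ^ j),
    ∀ j' ≥ j₀, ∀ k' ∈ Finset.Icc 1 (2 ^ j'),
    ∫ t in Icc (0 : ℝ) 1, ψ.fn j k t * ψ.fn j' k' t = if j = j' ∧ k = k' then 1 else 0
  complete : ∀ f : ℝ → ℝ, MemLp f 2 (volume.restrict (Icc (0 : ℝ) 1)) →
    (∀ k ∈ Finset.Icc 1 (2 ^ j₀), ∫ t in Icc (0 : ℝ) 1, f t * φ.fn j₀ k t = 0) →
    (∀ j ≥ j₀, ∀ k ∈ Finset.Icc 1 (2 ^ j), ∫ t in Icc (0 : ℝ) 1, f t * ψ.fn j k t = 0) →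
    f =ᵐ[volume.restrict (Icc (0 : ℝ) 1)] 0

/-! ### The estimators, as functions of the empirical wavelet coefficients

`y j k` is the empirical coefficient of `ψ_{j,k}`, `n` the sample size, `L` the length of the
horizontal blocks, `lam` the thresholding constant. -/

/-- The smallest integer `J ≥ 0` with `2^J ≥ x`. -/
def level (x : ℝ) : ℕ := sInf {J : ℕ | x ≤ 2 ^ J}

/-- The James–Stein factor `(1 - lam m n⁻¹ / S²)₊` of a block of length `m` with sum of
squares `S2`. -/
def jsFactor (n : ℕ) (lam : ℝ) (m : ℕ) (S2 : ℝ) : ℝ :=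
  max (1 - lam * (m : ℝ) * (n : ℝ)⁻¹ / S2) 0

/-- The indices `k'` at level `j` in the block `{(b-1)L+1, …, bL}` that contains `k`. -/
def blockOf (L j k : ℕ) : Finset ℕ :=
  (Finset.Icc 1 (2 ^ j)).filter fun k' => (k' - 1) / L = (k - 1) / L

/-- James–Stein shrinkage in the horizontal blocks. -/
def blockShrink (n L : ℕ) (lam : ℝ) (y : ℕ → ℕ → ℝ) (j k : ℕ) : ℝ :=
  jsFactor n lam L (∑ k' ∈ blockOf L j k, y j k' ^ 2) * y j k

/-- The coefficients of the BlockJS estimator. -/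
def blockJSCoeff (n L : ℕ) (lam : ℝ) (y : ℕ → ℕ → ℝ) (j k : ℕ) : ℝ :=
  if j < level n then blockShrink n L lam y j k else 0

/-- Soft thresholding at the level `√(2 n⁻¹ log n)`. -/
def softThreshold (n : ℕ) (y : ℝ) : ℝ :=
  Real.sign y * max (|y| - √(2 * (n : ℝ)⁻¹ * Real.log n)) 0

open Classical in
/-- The vertical block: the indices `(j, k)` with `max(J_*, j₀) ≤ j < J^*` for which the support of
`ψ_{j,k}` meets `[x₀ - c, x₀ + c]`. -/
def verticalBlock {r : ℕ} (W : WaveletBasis r) (x₀ c : ℝ) (n : ℕ) : Finset (Σ _ : ℕ, ℕ) :=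
  ((Finset.Ico (max (level c⁻¹) W.j₀) (level (c⁻¹ * Real.log n))).sigma
      fun j => Finset.Icc 1 (2 ^ j)).filter
    fun p => (tsupport (W.ψ.fn p.1 p.2) ∩ Icc (x₀ - c) (x₀ + c)).Nonempty

open Classical in
/-- The coefficients of the hybrid estimator. -/
def hybridCoeff {r : ℕ} (W : WaveletBasis r) (x₀ c : ℝ) (n L : ℕ) (lam : ℝ)
    (y : ℕ → ℕ → ℝ) (j k : ℕ) : ℝ :=
  if level n ≤ j then 0
  else if (⟨j, k⟩ : Σ _ : ℕ, ℕ) ∈ verticalBlock W x₀ c n then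
    jsFactor n lam (verticalBlock W x₀ c n).card
      (∑ p ∈ verticalBlock W x₀ c n, y p.1 p.2 ^ 2) * y j k
  else if j < level (c⁻¹ * Real.log n) then softThreshold n (y j k)
  else blockShrink n L lam y j k

open Classical in
/-- The coefficients of the adaptive estimator for the neighborhood `[x₀ - c, x₀ + c]`: hybrid if
`c > log n / n`, BlockJS otherwise. -/
def adaptiveCoeff {r : ℕ} (W : WaveletBasis r) (x₀ c : ℝ) (n L : ℕ) (lam : ℝ)
    (y : ℕ → ℕ → ℝ) : ℕ → ℕ → ℝ :=
  if Real.log n / n < c then hybridCoeff W x₀ c n L lam y else blockJSCoeff n L lam y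

/-- The wavelet series with coarse coefficients `ξ` and detail coefficients `θ`. -/
def waveletSeries {r : ℕ} (W : WaveletBasis r) (ξ : ℕ → ℝ) (θ : ℕ → ℕ → ℝ) (x : ℝ) : ℝ :=
  ∑ k ∈ Finset.Icc 1 (2 ^ W.j₀), ξ k * W.φ.fn W.j₀ k x +
    ∑' i : ℕ, ∑ k ∈ Finset.Icc 1 (2 ^ (W.j₀ + i)), θ (W.j₀ + i) k * W.ψ.fn (W.j₀ + i) k x

/-- The adaptive estimator based on the observed process `Z`: the empirical coefficients are
`∫₀¹ φ_{j₀,k} dZ` and `∫₀¹ ψ_{j,k} dZ`. -/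
def adaptiveEstimator {Ω : Type*} [MeasurableSpace Ω] (P : Measure Ω) {r : ℕ}
    (W : WaveletBasis r) (x₀ c : ℝ) (n L : ℕ) (lam : ℝ) (Z : ℝ≥0 → Ω → ℝ) (ω : Ω) : ℝ → ℝ :=
  waveletSeries W (fun k => stochIntegral P (W.φ.fn W.j₀ k) Z ω)
    (adaptiveCoeff W x₀ c n L lam fun j k => stochIntegral P (W.ψ.fn j k) Z ω)

end ShrinkNbhd

end

/-! The empirical coefficients are the true wavelet coefficients plus independent N(0, 1/n) errors.
Brownian motion and the indicators of (0, t] have the same Gram matrix, so the Wiener integral is an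
isometry from L²(0, 1) and sends an orthonormal family to independent standard normals
(`map_wienerLp`). All that is used of the normal law later is the exact value of E z_p² exp(s ∑
z_q²), recorded in `StdNormalMoments`.

On the signal side, vanishing moments and local polynomial approximation give |θ_{j,k}| ≤ C
2^{-j(α+1/2)} uniformly over the Hölder class (`WaveletBasis.exists_abs_coeff_le`). The series
converges at every point, and cutting it at a level with 2^J ≥ n costs only n^{-α}.

The thresholding rules satisfy oracle inequalities. A Chernoff bound shows that m pure noise
coordinates exceed the James–Stein threshold with probability at most exp(-m(λ - log λ - 1)/2) =
exp(-m). Lowering the exponent to κm with κ < 1 leaves room for some signal in the block, and κ =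
2α/(1+2α) = `rate α` is enough for the theorem. A block thus has risk of order min(∑ θ², m/n) plus
an exponentially small term (`exists_lintegral_sum_jsFactor_le`). A single coefficient, in a block
or soft thresholded, has risk of order min(T, log n/n) plus such a term, where T bounds the squared
coefficients (`exists_lintegral_jsFactor_le`, `exists_lintegral_softThreshold_le`).

The errors are assembled in `exists_risk_le`. At levels with c 2^j ≤ 1 boundedly many wavelets meet
the neighborhood, each of size 2^{j/2}, and Minkowski's inequality gives (∑ 2^{j/2} s_j)², where s_j
is the root mean square error. At finer levels orthonormality gives c⁻¹ times the sum of the mean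
square errors. With s_j = min(τ, 2^{-j(α+1/2)}) the sum ∑ 2^{j/2} s_j is geometric on both sides of
its crossover and has order τ^{rate}. Individual coefficients have τ² = log n/n; levels holding many
blocks have τ² = 1/n, which removes the logarithm. The vertical block bridges the levels in between:
it has about log n coefficients and costs c⁻¹ min(c^{1+2α}, log n/n).

For c up to a multiple of (log n/n)^{1/(1+2α)} the total is (log n/n)^{rate}
(`exists_risk_le_of_small`). For c > log n/n it is also at most log n/(nc) + n^{-rate}
(`exists_risk_le_of_large`). Since log n/(nc) = (log n/d) n^{-rate}, these two terms balance at d =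
log n, which separates the last two regimes. -/

noncomputable section

namespace ShrinkNbhd

section

/-! ### The Wiener integral -/

/-- The coefficients of the Riemann sum of `g` as a combination of point evaluations. -/
def riemannCoeff (g : ℝ → ℝ) (m : ℕ) : ℝ≥0 →₀ ℝ :=
  ∑ i ∈ Finset.range m, g ((i : ℝ) / m) •
    (Finsupp.single (((i : ℝ≥0) + 1) / (m : ℝ≥0)) (1 : ℝ) -
      Finsupp.single ((i : ℝ≥0) / (m : ℝ≥0)) 1)

lemma linearCombination_riemannCoeff {E : Type*} [AddCommGroup E] [Module ℝ E] (b : ℝ≥0 → E)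
    (g : ℝ → ℝ) (m : ℕ) :
    Finsupp.linearCombination ℝ b (riemannCoeff g m) =
      ∑ i ∈ Finset.range m, g ((i : ℝ) / m) •
        (b (((i : ℝ≥0) + 1) / (m : ℝ≥0)) - b ((i : ℝ≥0) / (m : ℝ≥0))) := by
  simp [riemannCoeff, map_sum]

/-- By bilinearity, the Gram matrix of a family determines the geometry of its span. This carries
convergence of step functions in L²(0, 1) over to convergence of Gaussian variables in L²(P) without
constructing an isometry between the spaces. -/
lemma inner_linearCombination_congr {T E F : Type*} [NormedAddCommGroup E] [InnerProductSpace ℝ E]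
    [NormedAddCommGroup F] [InnerProductSpace ℝ F] {b : T → E} {c : T → F}
    (h : ∀ s t, inner ℝ (b s) (b t) = inner ℝ (c s) (c t)) (l l' : T →₀ ℝ) :
    inner ℝ (Finsupp.linearCombination ℝ b l) (Finsupp.linearCombination ℝ b l') =
      inner ℝ (Finsupp.linearCombination ℝ c l) (Finsupp.linearCombination ℝ c l') := by
  simp only [Finsupp.linearCombination_apply, Finsupp.sum, sum_inner, inner_sum,
    real_inner_smul_left, real_inner_smul_right, h]

lemma norm_linearCombination_congr {T E F : Type*} [NormedAddCommGroup E] [InnerProductSpace ℝ E]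
    [NormedAddCommGroup F] [InnerProductSpace ℝ F] {b : T → E} {c : T → F}
    (h : ∀ s t, inner ℝ (b s) (b t) = inner ℝ (c s) (c t)) (l : T →₀ ℝ) :
    ‖Finsupp.linearCombination ℝ b l‖ = ‖Finsupp.linearCombination ℝ c l‖ := by
  rw [← sq_eq_sq₀ (norm_nonneg _) (norm_nonneg _), ← real_inner_self_eq_norm_sq,
    ← real_inner_self_eq_norm_sq, inner_linearCombination_congr h]

/-- Lebesgue measure on the unit interval. -/
abbrev unitMeasure : Measure ℝ := volume.restrict (Ioc (0 : ℝ) 1)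

/-- The indicator function of `(0, t]` in `L²(0, 1)`. -/
def unitStep (t : ℝ≥0) : Lp ℝ 2 unitMeasure :=
  indicatorConstLp 2 (measurableSet_Ioc : MeasurableSet (Ioc (0 : ℝ) t)) (measure_ne_top _ _) 1

/-- Both times are capped at 1 because the measure lives on (0, 1]; the value is the covariance of
Brownian motion stopped at time 1. -/
lemma inner_unitStep (s t : ℝ≥0) :
    inner ℝ (unitStep s) (unitStep t) = ((min (min s 1) (min t 1) : ℝ≥0) : ℝ) := by
  rw [unitStep, unitStep, L2.inner_indicatorConstLp_indicatorConstLp]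
  simp only [measureReal_def, RCLike.inner_apply]
  rw [Measure.restrict_apply (measurableSet_Ioc.inter measurableSet_Ioc)]
  rw [Ioc_inter_Ioc, Ioc_inter_Ioc, Real.volume_Ioc]
  simp
  rw [min_min_min_comm]
  simp only [min_self]
  have h : (min (min (s : ℝ≥0∞) t) 1) = ((min (min s t) 1 : ℝ≥0) : ℝ≥0∞) := by simp
  rw [h, ENNReal.coe_toReal]
  simp

variable {Ω : Type*} [MeasurableSpace Ω] {P : Measure Ω} {B : ℝ≥0 → Ω → ℝ}

lemma _root_.ProbabilityTheory.IsPreBrownianReal.memLp_two (hB : IsPreBrownianReal B P) (t : ℝ≥0) :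
    MemLp (B t) 2 P := (hB.isGaussianProcess.hasGaussianLaw_eval t).memLp_two

/-- Brownian motion stopped at time `1`, as a path in `L²`. -/
def stoppedLp (hB : IsPreBrownianReal B P) (t : ℝ≥0) : Lp ℝ 2 P :=
  (hB.memLp_two (min t 1)).toLp (B (min t 1))

/-- Wiener's isometry on generators: the covariance min(s, t) is the length of (0, s] ∩ (0, t]. -/
lemma inner_stoppedLp (hB : IsPreBrownianReal B P) (s t : ℝ≥0) :
    inner ℝ (stoppedLp hB s) (stoppedLp hB t) = inner ℝ (unitStep s) (unitStep t) := by
  have := hB.isGaussianProcess.isProbabilityMeasure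
  rw [inner_unitStep, ← hB.covariance_eval, covariance_eq_sub (hB.memLp_two _) (hB.memLp_two _)]
  simp only [hB.integral_eval, mul_zero, sub_zero]
  rw [L2.inner_def]
  refine integral_congr_ae ?_
  filter_upwards [(hB.memLp_two (min s 1)).coeFn_toLp, (hB.memLp_two (min t 1)).coeFn_toLp]
    with ω h1 h2
  simp [stoppedLp, h1, h2, mul_comm]


/-- `g` as an element of `L²(0, 1)`. -/
lemma memLp_unitMeasure {g : ℝ → ℝ} (hg : ContinuousOn g (Icc 0 1)) : MemLp g 2 unitMeasure := by
  have h : MemLp g 2 (volume.restrict (Icc (0 : ℝ) 1)) := by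
    obtain ⟨C, hC⟩ := isCompact_Icc.exists_bound_of_continuousOn hg
    refine MemLp.of_bound (hg.aestronglyMeasurable measurableSet_Icc) C ?_
    exact (ae_restrict_iff' measurableSet_Icc).2 (ae_of_all _ hC)
  exact h.mono_measure (Measure.restrict_mono Ioc_subset_Icc_self le_rfl)

lemma coeFn_linearCombination_unitStep (g : ℝ → ℝ) (m : ℕ) :
    (Finsupp.linearCombination ℝ unitStep (riemannCoeff g m) : Lp ℝ 2 unitMeasure) =ᵐ[unitMeasure]
      fun x => ∑ i ∈ Finset.range m, g ((i : ℝ) / m) *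
        (Ioc ((i : ℝ) / m) (((i : ℝ) + 1) / m)).indicator 1 x := by
  rw [linearCombination_riemannCoeff]
  refine (Lp.coeFn_finsetSum _ _).trans ?_
  have : ∀ i ∈ Finset.range m, ∀ᵐ x ∂unitMeasure, (g ((i : ℝ) / m) •
        (unitStep (((i : ℝ≥0) + 1) / (m : ℝ≥0)) - unitStep ((i : ℝ≥0) / (m : ℝ≥0))) :
          Lp ℝ 2 unitMeasure) x = g ((i : ℝ) / m) *
        (Ioc ((i : ℝ) / m) (((i : ℝ) + 1) / m)).indicator 1 x := by
    intro i hi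
    have hs : ∀ t : ℝ≥0, (unitStep t : ℝ → ℝ) =ᵐ[unitMeasure] (Ioc (0 : ℝ) t).indicator fun _ => 1 :=
      fun t => indicatorConstLp_coeFn
    filter_upwards [Lp.coeFn_smul (g ((i : ℝ) / m))
      (unitStep (((i : ℝ≥0) + 1) / (m : ℝ≥0)) - unitStep ((i : ℝ≥0) / (m : ℝ≥0))),
      Lp.coeFn_sub (unitStep (((i : ℝ≥0) + 1) / (m : ℝ≥0))) (unitStep ((i : ℝ≥0) / (m : ℝ≥0))),
      hs (((i : ℝ≥0) + 1) / (m : ℝ≥0)), hs ((i : ℝ≥0) / (m : ℝ≥0))] with x h1 h2 h3 h4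
    rw [h1, Pi.smul_apply, h2, Pi.sub_apply, h3, h4, smul_eq_mul]
    congr 1
    push_cast
    have h0 : (0 : ℝ) ≤ (i : ℝ) / m := by positivity
    have h5 : (i : ℝ) / m ≤ ((i : ℝ) + 1) / m := by gcongr; linarith
    simp only [indicator_apply, mem_Ioc, Pi.one_apply]
    clear h1 h2 h3 h4 hs
    generalize (i : ℝ) / m = a at *
    generalize ((i : ℝ) + 1) / m = b at *
    split_ifs <;> first | (norm_num; done) | (exfalso; grind)
  filter_upwards [(Finset.eventually_all _).2 this] with x hx
  rw [Finset.sum_apply]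
  exact Finset.sum_congr rfl hx

/-- Uniform continuity on [0, 1] makes the step function with m cells uniformly close to g, and the
total mass is 1, so the L² distance is no larger. -/
lemma tendsto_linearCombination_unitStep {g : ℝ → ℝ} (hg : ContinuousOn g (Icc 0 1)) :
    Tendsto (fun m => Finsupp.linearCombination ℝ unitStep (riemannCoeff g m)) atTop
      (𝓝 ((memLp_unitMeasure hg).toLp g)) := by
  rw [Metric.tendsto_atTop]
  intro ε hε
  obtain ⟨δ, hδ, h⟩ := Metric.uniformContinuousOn_iff.1
    (isCompact_Icc.uniformContinuousOn_of_continuous hg) (ε / 2) (half_pos hε)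
  obtain ⟨N, hN⟩ := exists_nat_one_div_lt hδ
  refine ⟨N + 1, fun m hm => ?_⟩
  have hm0 : (0 : ℝ) < m := by exact_mod_cast (show 0 < m by omega)
  rw [dist_eq_norm]
  refine lt_of_le_of_lt ?_ (half_lt_self hε)
  have hb := Lp.norm_le_of_ae_bound (f := Finsupp.linearCombination ℝ unitStep (riemannCoeff g m) -
    (memLp_unitMeasure hg).toLp g) (half_pos hε).le ?_
  · have h1 : measureUnivNNReal unitMeasure = 1 := by simp [measureUnivNNReal]
    simpa [h1] using hb
  filter_upwards [Lp.coeFn_sub (Finsupp.linearCombination ℝ unitStep (riemannCoeff g m))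
    ((memLp_unitMeasure hg).toLp g), coeFn_linearCombination_unitStep g m,
    (memLp_unitMeasure hg).coeFn_toLp, ae_restrict_mem measurableSet_Ioc] with x h1 h2 h3 hx
  rw [h1, Pi.sub_apply, h2, h3]
  obtain ⟨hx0, hx1⟩ := hx
  -- The cells are open on the left, so the cell of x is found with a ceiling minus one and not with
  -- a floor; x > 0 makes the truncated subtraction exact.
  set i₀ := ⌈(m : ℝ) * x⌉₊ - 1 with hi₀
  have hc : 0 < ⌈(m : ℝ) * x⌉₊ := Nat.ceil_pos.2 (by positivity)
  have hi₀' : (i₀ : ℝ) = ⌈(m : ℝ) * x⌉₊ - 1 := by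
    rw [hi₀]; push_cast [Nat.cast_sub (Nat.one_le_iff_ne_zero.2 hc.ne')]; ring
  have hlow : (i₀ : ℝ) < m * x := by
    have := Nat.ceil_lt_add_one (show 0 ≤ (m : ℝ) * x by positivity); linarith
  have hup : (m : ℝ) * x ≤ i₀ + 1 := by have := Nat.le_ceil ((m : ℝ) * x); linarith
  have hmx : (m : ℝ) * x ≤ m := by nlinarith
  have hi₀m : i₀ < m := by exact_mod_cast hlow.trans_le hmx
  rw [Finset.sum_eq_single i₀]
  · have hmem : x ∈ Ioc ((i₀ : ℝ) / m) (((i₀ : ℝ) + 1) / m) :=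
      ⟨by rw [div_lt_iff₀ hm0]; linarith, by rw [le_div_iff₀ hm0]; linarith⟩
    rw [indicator_of_mem hmem, Pi.one_apply, mul_one, Real.norm_eq_abs, ← Real.dist_eq]
    refine (h _ ⟨by positivity, ?_⟩ _ ⟨hx0.le, hx1⟩ ?_).le
    · exact (hmem.1.trans_le hx1).le
    · rw [Real.dist_eq, abs_sub_comm, abs_of_pos (by linarith [hmem.1])]
      have h6 : 1 / (m : ℝ) ≤ 1 / ((N : ℝ) + 1) := by
        apply one_div_le_one_div_of_le (by positivity)
        exact_mod_cast hm
      have := hmem.2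
      rw [add_div] at this
      linarith
  · intro i _ hne
    rw [indicator_of_notMem, mul_zero]
    rintro ⟨h7, h8⟩
    rw [div_lt_iff₀ hm0] at h7
    rw [le_div_iff₀ hm0] at h8
    apply hne
    have h9 : (i : ℝ) < i₀ + 1 := by linarith
    have h10 : (i₀ : ℝ) < i + 1 := by linarith
    norm_cast at h9 h10
    omega
  · intro h7
    exact absurd (Finset.mem_range.2 hi₀m) h7

/-- The isometry transports the Cauchy property from L²(0, 1), where the limit is known;
completeness of L²(P) supplies the limit there. -/
lemma exists_tendsto_linearCombination_stoppedLp (hB : IsPreBrownianReal B P) {g : ℝ → ℝ}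
    (hg : ContinuousOn g (Icc 0 1)) :
    ∃ w : Lp ℝ 2 P, Tendsto (fun m => Finsupp.linearCombination ℝ (stoppedLp hB)
      (riemannCoeff g m)) atTop (𝓝 w) := by
  refine cauchySeq_tendsto_of_complete ?_
  have h := (tendsto_linearCombination_unitStep hg).cauchySeq
  rw [Metric.cauchySeq_iff] at h ⊢
  intro ε hε
  obtain ⟨N, hN⟩ := h ε hε
  refine ⟨N, fun m hm m' hm' => ?_⟩
  have := hN m hm m' hm'
  rw [dist_eq_norm, ← map_sub] at this ⊢
  rwa [norm_linearCombination_congr (inner_stoppedLp hB)]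

/-- The Wiener integral of a function continuous on `[0, 1]`. -/
def wienerLp (hB : IsPreBrownianReal B P) {g : ℝ → ℝ} (hg : ContinuousOn g (Icc 0 1)) :
    Lp ℝ 2 P := (exists_tendsto_linearCombination_stoppedLp hB hg).choose

lemma tendsto_wienerLp (hB : IsPreBrownianReal B P) {g : ℝ → ℝ} (hg : ContinuousOn g (Icc 0 1)) :
    Tendsto (fun m => Finsupp.linearCombination ℝ (stoppedLp hB) (riemannCoeff g m)) atTop
      (𝓝 (wienerLp hB hg)) := (exists_tendsto_linearCombination_stoppedLp hB hg).choose_spec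

end

section

variable {Ω : Type*} [MeasurableSpace Ω] {P : Measure Ω} {B : ℝ≥0 → Ω → ℝ}

/-! ### The stochastic integral against the observed process -/

lemma lintegral_ofReal_sq_Lp (u : Lp ℝ 2 P) :
    ∫⁻ ω, ENNReal.ofReal (u ω ^ 2) ∂P = ENNReal.ofReal (‖u‖ ^ 2) := by
  rw [← real_inner_self_eq_norm_sq, L2.inner_def, ← ofReal_integral_eq_lintegral_ofReal]
  · simp [pow_two]
  · exact (memLp_two_iff_integrable_sq (Lp.aestronglyMeasurable u)).1 (Lp.memLp u)
  · exact ae_of_all _ fun ω => sq_nonneg _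

/-- Stopping at time 1 is invisible here, since a Riemann sum evaluates the process only at points
of [0, 1]. -/
lemma riemannSum_ae_eq (hB : IsPreBrownianReal B P) (g : ℝ → ℝ) (m : ℕ) :
    riemannSum g B m =ᵐ[P] Finsupp.linearCombination ℝ (stoppedLp hB) (riemannCoeff g m) := by
  rw [linearCombination_riemannCoeff]
  refine EventuallyEq.symm ((Lp.coeFn_finsetSum _ _).trans ?_)
  have hs : ∀ t : ℝ≥0, t ≤ 1 → (stoppedLp hB t : Ω → ℝ) =ᵐ[P] B t := by
    intro t ht
    have := (hB.memLp_two (min t 1)).coeFn_toLp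
    simp only [min_eq_left ht] at this
    simpa only [stoppedLp, min_eq_left ht] using this
  have : ∀ i ∈ Finset.range m, ∀ᵐ ω ∂P, (g ((i : ℝ) / m) •
        (stoppedLp hB (((i : ℝ≥0) + 1) / (m : ℝ≥0)) - stoppedLp hB ((i : ℝ≥0) / (m : ℝ≥0))) :
          Lp ℝ 2 P) ω = g ((i : ℝ) / m) *
        (B (((i : ℝ≥0) + 1) / (m : ℝ≥0)) ω - B ((i : ℝ≥0) / (m : ℝ≥0)) ω) := by
    intro i hi
    have him : (i : ℝ≥0) + 1 ≤ m := by exact_mod_cast Finset.mem_range.1 hi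
    have h1 : ((i : ℝ≥0) + 1) / (m : ℝ≥0) ≤ 1 := div_le_one_of_le₀ him (by positivity)
    have h0 : (i : ℝ≥0) / (m : ℝ≥0) ≤ 1 :=
      div_le_one_of_le₀ (le_trans (by simp) him) (by positivity)
    filter_upwards [Lp.coeFn_smul (g ((i : ℝ) / m))
      (stoppedLp hB (((i : ℝ≥0) + 1) / (m : ℝ≥0)) - stoppedLp hB ((i : ℝ≥0) / (m : ℝ≥0))),
      Lp.coeFn_sub (stoppedLp hB (((i : ℝ≥0) + 1) / (m : ℝ≥0)))
        (stoppedLp hB ((i : ℝ≥0) / (m : ℝ≥0))), hs _ h1, hs _ h0] with x e1 e2 e3 e4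
    rw [e1, Pi.smul_apply, e2, Pi.sub_apply, e3, e4, smul_eq_mul]
  filter_upwards [(Finset.eventually_all _).2 this] with ω hω
  rw [Finset.sum_apply, riemannSum]
  exact Finset.sum_congr rfl hω

/-- The Riemann sum of the drift is the inner product of f with the step function of g, so
continuity of the inner product gives the limit. The one-point space `Unit` only lets `riemannSum`
accept a deterministic path. -/
lemma tendsto_riemannSum_integral {f g : ℝ → ℝ} (hf : ContinuousOn f (Icc 0 1))
    (hg : ContinuousOn g (Icc 0 1)) :
    Tendsto (fun m : ℕ => riemannSum g (fun t (_ : Unit) => ∫ x in (0 : ℝ)..(t : ℝ), f x) m ())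
      atTop (𝓝 (∫ x in Icc (0 : ℝ) 1, f x * g x)) := by
  have hF := memLp_unitMeasure hf
  have hG := memLp_unitMeasure hg
  have h1 : ∫ x in Icc (0 : ℝ) 1, f x * g x = inner ℝ (hG.toLp g) (hF.toLp f) := by
    rw [integral_Icc_eq_integral_Ioc, L2.inner_def]
    refine integral_congr_ae ?_
    filter_upwards [hF.coeFn_toLp, hG.coeFn_toLp] with x e1 e2
    simp [e1, e2]
  have h2 : ∀ t : ℝ≥0, t ≤ 1 → inner ℝ (unitStep t) (hF.toLp f) = ∫ x in (0 : ℝ)..(t : ℝ), f x := by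
    intro t ht
    rw [unitStep, L2.inner_indicatorConstLp_one, intervalIntegral.integral_of_le (NNReal.coe_nonneg t),
      Measure.restrict_restrict measurableSet_Ioc,
      inter_eq_left.2 (Ioc_subset_Ioc_right (by exact_mod_cast ht))]
    refine integral_congr_ae ?_
    exact ae_restrict_of_ae_restrict_of_subset (Ioc_subset_Ioc_right (by exact_mod_cast ht))
      hF.coeFn_toLp
  rw [h1]
  have h3 := Filter.Tendsto.inner (𝕜 := ℝ) (tendsto_linearCombination_unitStep hg)
    (tendsto_const_nhds (x := hF.toLp f))
  refine h3.congr fun m => ?_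
  rw [linearCombination_riemannCoeff, sum_inner, riemannSum]
  refine Finset.sum_congr rfl fun i hi => ?_
  have him : (i : ℝ≥0) + 1 ≤ m := by exact_mod_cast Finset.mem_range.1 hi
  rw [real_inner_smul_left, inner_sub_left, h2 _ (div_le_one_of_le₀ him (by positivity)),
    h2 _ (div_le_one_of_le₀ (le_trans (by simp) him) (by positivity))]

lemma riemannSum_observation {Ω : Type*} {B : ℝ≥0 → Ω → ℝ} (g f : ℝ → ℝ) (n m : ℕ) (ω : Ω) :
    riemannSum g (observation B n f) m ω =
      riemannSum g (fun t (_ : Unit) => ∫ x in (0 : ℝ)..(t : ℝ), f x) m () +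
        1 / √(n : ℝ) * riemannSum g B m ω := by
  simp only [riemannSum, observation, Finset.mul_sum, ← Finset.sum_add_distrib]
  exact Finset.sum_congr rfl fun i _ => by ring

lemma ofReal_add_sq_le (a b : ℝ) :
    ENNReal.ofReal ((a + b) ^ 2) ≤ 2 * ENNReal.ofReal (a ^ 2) + 2 * ENNReal.ofReal (b ^ 2) := by
  rw [show (2 : ℝ≥0∞) = ENNReal.ofReal 2 by simp, ← ENNReal.ofReal_mul (by norm_num),
    ← ENNReal.ofReal_mul (by norm_num), ← ENNReal.ofReal_add (by positivity) (by positivity)]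
  exact ENNReal.ofReal_le_ofReal (by nlinarith [sq_nonneg (a - b)])

/-- The error splits into a drift part, which is a number, and a noise part, which is an L²
distance. `Y` is prescribed only almost everywhere, so that the result applies both to a measurable
modification and to the formula itself. -/
lemma tendsto_lintegral_riemannSum_observation (hB : IsPreBrownianReal B P) {f g : ℝ → ℝ} (n : ℕ)
    (hf : ContinuousOn f (Icc 0 1)) (hg : ContinuousOn g (Icc 0 1)) {Y : Ω → ℝ}
    (hY : Y =ᵐ[P] fun ω => (∫ x in Icc (0 : ℝ) 1, f x * g x) + 1 / √(n : ℝ) * wienerLp hB hg ω) :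
    Tendsto (fun m : ℕ => ∫⁻ ω,
      ENNReal.ofReal ((riemannSum g (observation B n f) m ω - Y ω) ^ 2) ∂P) atTop (𝓝 0) := by
  have := hB.isGaussianProcess.isProbabilityMeasure
  set θ := ∫ x in Icc (0 : ℝ) 1, f x * g x
  set R := fun m : ℕ => riemannSum g (fun t (_ : Unit) => ∫ x in (0 : ℝ)..(t : ℝ), f x) m ()
  set w := fun m : ℕ => Finsupp.linearCombination ℝ (stoppedLp hB) (riemannCoeff g m)
  set W := wienerLp hB hg
  have hbound : ∀ m, ∫⁻ ω, ENNReal.ofReal ((riemannSum g (observation B n f) m ω - Y ω) ^ 2) ∂P ≤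
      2 * ENNReal.ofReal ((R m - θ) ^ 2) +
        2 * ENNReal.ofReal ((1 / √(n : ℝ)) ^ 2 * ‖w m - W‖ ^ 2) := by
    intro m
    calc _ ≤ ∫⁻ ω, (2 * ENNReal.ofReal ((R m - θ) ^ 2) +
          2 * (ENNReal.ofReal ((1 / √(n : ℝ)) ^ 2) * ENNReal.ofReal ((w m - W : Lp ℝ 2 P) ω ^ 2)))
            ∂P := by
          refine lintegral_mono_ae ?_
          filter_upwards [hY, riemannSum_ae_eq hB g m, Lp.coeFn_sub (w m) W] with ω h1 h2 h3
          rw [h3, h1, riemannSum_observation, h2, ← ENNReal.ofReal_mul (by positivity), ← mul_pow]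
          refine le_trans (le_of_eq ?_) (ofReal_add_sq_le _ _)
          congr 2
          simp only [Pi.sub_apply]
          ring
      _ = _ := by
          rw [lintegral_add_left (by fun_prop), lintegral_const, measure_univ, mul_one,
            lintegral_const_mul' _ _ (by simp), lintegral_const_mul' _ _ (by simp),
            lintegral_ofReal_sq_Lp, ← ENNReal.ofReal_mul (by positivity)]
  refine tendsto_of_tendsto_of_tendsto_of_le_of_le tendsto_const_nhds ?_ (fun _ => zero_le) hbound
  have hR : Tendsto (fun m => (R m - θ) ^ 2) atTop (𝓝 0) := by
    have h := ((tendsto_riemannSum_integral hf hg).sub_const θ).pow 2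
    rwa [sub_self, zero_pow two_ne_zero] at h
  have hw : Tendsto (fun m => (1 / √(n : ℝ)) ^ 2 * ‖w m - W‖ ^ 2) atTop (𝓝 0) := by
    have h1 : Tendsto (fun m => w m - W) atTop (𝓝 0) := by
      have h := (tendsto_wienerLp hB hg).sub_const W
      rwa [sub_self] at h
    have h := (h1.norm.pow 2).const_mul ((1 / √(n : ℝ)) ^ 2)
    rwa [norm_zero, zero_pow two_ne_zero, mul_zero] at h
  have h1 := ENNReal.Tendsto.const_mul (a := 2) (ENNReal.tendsto_ofReal hR) (Or.inr (by simp))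
  have h2 := ENNReal.Tendsto.const_mul (a := 2) (ENNReal.tendsto_ofReal hw) (Or.inr (by simp))
  simpa using h1.add h2

lemma exists_isStochIntegral (hB : IsPreBrownianReal B P) {f g : ℝ → ℝ} (n : ℕ)
    (hf : ContinuousOn f (Icc 0 1)) (hg : ContinuousOn g (Icc 0 1)) :
    ∃ Y, IsStochIntegral P g (observation B n f) Y := by
  have hm : AEStronglyMeasurable (fun ω => (∫ x in Icc (0 : ℝ) 1, f x * g x) +
      1 / √(n : ℝ) * wienerLp hB hg ω) P :=
    ((Lp.aestronglyMeasurable (wienerLp hB hg)).const_mul _).const_add _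
  exact ⟨hm.mk, hm.stronglyMeasurable_mk.measurable,
    tendsto_lintegral_riemannSum_observation hB n hf hg hm.ae_eq_mk.symm⟩

lemma isStochIntegral_stochIntegral (hB : IsPreBrownianReal B P) {f g : ℝ → ℝ} (n : ℕ)
    (hf : ContinuousOn f (Icc 0 1)) (hg : ContinuousOn g (Icc 0 1)) :
    IsStochIntegral P g (observation B n f) (stochIntegral P g (observation B n f)) := by
  have h := exists_isStochIntegral hB n hf hg
  rw [stochIntegral, dif_pos h]
  exact h.choose_spec

lemma aemeasurable_riemannSum_observation (hB : IsPreBrownianReal B P) (g f : ℝ → ℝ) (n m : ℕ) :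
    AEMeasurable (riemannSum g (observation B n f) m) P := by
  have h : AEMeasurable (fun ω => riemannSum g B m ω) P := by
    unfold riemannSum
    have := hB.aemeasurable
    fun_prop
  have h2 : riemannSum g (observation B n f) m = _ :=
    funext fun ω => riemannSum_observation (B := B) g f n m ω
  rw [h2]
  fun_prop

/-- Two mean square limits of the same Riemann sums agree almost surely, so the arbitrary choice
inside `stochIntegral` is harmless. -/
lemma stochIntegral_ae_eq (hB : IsPreBrownianReal B P) {f g : ℝ → ℝ} (n : ℕ)
    (hf : ContinuousOn f (Icc 0 1)) (hg : ContinuousOn g (Icc 0 1)) :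
    stochIntegral P g (observation B n f) =ᵐ[P]
      fun ω => (∫ x in Icc (0 : ℝ) 1, f x * g x) + 1 / √(n : ℝ) * wienerLp hB hg ω := by
  set Y := stochIntegral P g (observation B n f)
  set Y' := fun ω => (∫ x in Icc (0 : ℝ) 1, f x * g x) + 1 / √(n : ℝ) * wienerLp hB hg ω
  obtain ⟨hYm, hY⟩ := isStochIntegral_stochIntegral hB n hf hg
  have hY'm : AEMeasurable Y' P :=
    (((Lp.aestronglyMeasurable (wienerLp hB hg)).const_mul _).const_add _).aemeasurable
  have hY' := tendsto_lintegral_riemannSum_observation hB n hf hg (Y := Y') ae_eq_rfl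
  have hzero : ∫⁻ ω, ENNReal.ofReal ((Y ω - Y' ω) ^ 2) ∂P = 0 := by
    refine le_antisymm ?_ zero_le
    have h1 := (ENNReal.Tendsto.const_mul (a := 2) hY (Or.inr (by simp))).add
      (ENNReal.Tendsto.const_mul (a := 2) hY' (Or.inr (by simp)))
    simp only [mul_zero, add_zero] at h1
    refine ge_of_tendsto' h1 fun m => ?_
    have hR := aemeasurable_riemannSum_observation hB g f n m
    rw [← lintegral_const_mul'' _ (by fun_prop), ← lintegral_const_mul'' _ (by fun_prop),
      ← lintegral_add_left' (by fun_prop)]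
    refine lintegral_mono fun ω => ?_
    refine le_trans (le_of_eq ?_) (le_trans (ofReal_add_sq_le
      (-(riemannSum g (observation B n f) m ω - Y ω))
      (riemannSum g (observation B n f) m ω - Y' ω)) (le_of_eq (by rw [neg_sq])))
    congr 2
    ring
  rw [lintegral_eq_zero_iff' (by fun_prop)] at hzero
  filter_upwards [hzero] with ω hω
  have : (Y ω - Y' ω) ^ 2 ≤ 0 := by simpa using hω
  nlinarith [sq_nonneg (Y ω - Y' ω), pow_eq_zero_iff (two_ne_zero) |>.1 (le_antisymm this (sq_nonneg _))]

lemma measurable_stochIntegral (g : ℝ → ℝ) (Z : ℝ≥0 → Ω → ℝ) :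
    Measurable (stochIntegral P g Z) := by
  rw [stochIntegral]
  split_ifs with h
  · exact h.choose_spec.1
  · exact measurable_const

/-! ### The law of the Wiener integrals -/

/-- A finite combination of values of a Gaussian process is Gaussian. It is centred with variance
equal to its squared norm, so its characteristic function at 1 is explicit. -/
lemma integral_cexp_linearCombination (hB : IsPreBrownianReal B P) (l : ℝ≥0 →₀ ℝ) :
    ∫ ω, Complex.exp ((Finsupp.linearCombination ℝ (stoppedLp hB) l : Lp ℝ 2 P) ω * Complex.I) ∂P =
      Complex.exp (-(‖Finsupp.linearCombination ℝ (stoppedLp hB) l‖ ^ 2 : ℝ) / 2) := by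
  have := hB.isGaussianProcess.isProbabilityMeasure
  set u := Finsupp.linearCombination ℝ (stoppedLp hB) l with hu
  have hae : (fun ω => ∑ t ∈ l.support, l t • B (min t 1) ω) =ᵐ[P] u := by
    rw [hu, Finsupp.linearCombination_apply, Finsupp.sum]
    refine EventuallyEq.symm ((Lp.coeFn_finsetSum _ _).trans ?_)
    have : ∀ t ∈ l.support, ∀ᵐ ω ∂P, (l t • stoppedLp hB t : Lp ℝ 2 P) ω = l t • B (min t 1) ω := by
      intro t _
      filter_upwards [Lp.coeFn_smul (l t) (stoppedLp hB t), (hB.memLp_two (min t 1)).coeFn_toLp]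
        with ω h1 h2
      rw [h1, Pi.smul_apply, stoppedLp, h2]
    filter_upwards [(Finset.eventually_all _).2 this] with ω hω
    rw [Finset.sum_apply]
    exact Finset.sum_congr rfl hω
  have hG : IsGaussianProcess (fun t ω => l t • B (min t 1) ω) P :=
    (hB.isGaussianProcess.comp_right fun t => min t 1).smul l
  have hgauss : HasGaussianLaw u P := (hG.hasGaussianLaw_fun_sum (I := l.support)).congr hae
  have hmean : ∫ ω, u ω ∂P = 0 := by
    rw [← integral_congr_ae hae, integral_finsetSum]
    · refine Finset.sum_eq_zero fun t _ => ?_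
      rw [integral_smul, hB.integral_eval, smul_zero]
    · exact fun t _ => (hB.integrable_eval _).smul (l t)
  have hvar : Var[u; P] = ‖u‖ ^ 2 := by
    rw [variance_eq_sub (Lp.memLp u), hmean, ← real_inner_self_eq_norm_sq, L2.inner_def]
    simp [pow_two]
  have h1 := charFun_apply_real (μ := P.map u) 1
  -- The image law is replaced by the Gaussian one to evaluate `charFun`, then restored so that the
  -- remaining integral can be pulled back to Ω.
  rw [hgauss.map_eq_gaussianReal, hmean, hvar, charFun_gaussianReal,
    ← hvar, ← hmean, ← hgauss.map_eq_gaussianReal, hvar,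
    integral_map hgauss.aemeasurable (by fun_prop)] at h1
  simp only [Complex.ofReal_one, one_mul] at h1
  rw [← h1, hmean]
  simp [Real.toNNReal_of_nonneg (sq_nonneg ‖u‖), neg_div]

end

section

variable {Ω : Type*} [MeasurableSpace Ω] {P : Measure Ω} {B : ℝ≥0 → Ω → ℝ}

/-- The integrands have modulus 1, so dominated convergence applies along an almost everywhere
convergent subsequence. A subsequence suffices, because it is compared with a sequence whose full
limit is known. -/
lemma exists_subseq_tendsto_integral_cexp [IsFiniteMeasure P] {u : ℕ → Lp ℝ 2 P} {w : Lp ℝ 2 P}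
    (h : Tendsto u atTop (𝓝 w)) :
    ∃ φ : ℕ → ℕ, StrictMono φ ∧ Tendsto (fun m => ∫ ω, Complex.exp (u (φ m) ω * Complex.I) ∂P)
      atTop (𝓝 (∫ ω, Complex.exp (w ω * Complex.I) ∂P)) := by
  obtain ⟨φ, hφ, hae⟩ := (tendstoInMeasure_of_tendsto_Lp h).exists_seq_tendsto_ae
  refine ⟨φ, hφ, tendsto_integral_of_dominated_convergence (fun _ => 1) (fun m => ?_)
    (integrable_const _) (fun m => ae_of_all _ fun ω => ?_) ?_⟩
  · have := Lp.aestronglyMeasurable (u (φ m))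
    have hc : Continuous fun x : ℝ => Complex.exp (x * Complex.I) := by fun_prop
    exact hc.comp_aestronglyMeasurable this
  · rw [Complex.norm_exp_ofReal_mul_I]
  · filter_upwards [hae] with ω hω
    have hc : Continuous fun x : ℝ => Complex.exp (x * Complex.I) := by fun_prop
    exact (hc.tendsto _).comp hω

/-- For combinations of point evaluations the norm may be computed in L²(0, 1) instead of L²(P);
both sides then pass to the limit. -/
lemma integral_cexp_sum_wienerLp (hB : IsPreBrownianReal B P) {ι : Type*} [Fintype ι]
    {g : ι → ℝ → ℝ} (hg : ∀ i, ContinuousOn (g i) (Icc 0 1)) (t : ι → ℝ) :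
    ∫ ω, Complex.exp ((∑ i, t i • wienerLp hB (hg i) : Lp ℝ 2 P) ω * Complex.I) ∂P =
      Complex.exp (-(‖∑ i, t i • (memLp_unitMeasure (hg i)).toLp (g i)‖ ^ 2 : ℝ) / 2) := by
  have := hB.isGaussianProcess.isProbabilityMeasure
  set l := fun m => ∑ i, t i • riemannCoeff (g i) m
  have hb : Tendsto (fun m => Finsupp.linearCombination ℝ (stoppedLp hB) (l m)) atTop
      (𝓝 (∑ i, t i • wienerLp hB (hg i))) := by
    simp only [l, map_sum, map_smul]
    exact tendsto_finsetSum _ fun i _ => (tendsto_wienerLp hB (hg i)).const_smul (t i)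
  have hc : Tendsto (fun m => Finsupp.linearCombination ℝ unitStep (l m)) atTop
      (𝓝 (∑ i, t i • (memLp_unitMeasure (hg i)).toLp (g i))) := by
    simp only [l, map_sum, map_smul]
    exact tendsto_finsetSum _ fun i _ => (tendsto_linearCombination_unitStep (hg i)).const_smul (t i)
  obtain ⟨φ, hφ, h1⟩ := exists_subseq_tendsto_integral_cexp hb
  simp only [integral_cexp_linearCombination, norm_linearCombination_congr (inner_stoppedLp hB)]
    at h1
  refine tendsto_nhds_unique h1 ?_
  have hcont : Continuous fun x : Lp ℝ 2 unitMeasure => Complex.exp (-(‖x‖ ^ 2 : ℝ) / 2) := by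
    fun_prop
  exact (hcont.tendsto _).comp (hc.comp hφ.tendsto_atTop)

/-- Wiener integrals of an orthonormal family are independent standard normal variables. -/
lemma map_wienerLp (hB : IsPreBrownianReal B P) {ι : Type*} [Fintype ι] [DecidableEq ι]
    {g : ι → ℝ → ℝ} (hg : ∀ i, ContinuousOn (g i) (Icc 0 1))
    (horth : ∀ i j, ∫ x in Icc (0 : ℝ) 1, g i x * g j x = if i = j then 1 else 0)
    {z : ι → Ω → ℝ} (hz : ∀ i, AEMeasurable (z i) P) (hzW : ∀ i, z i =ᵐ[P] wienerLp hB (hg i)) :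
    P.map (fun ω i => z i ω) = Measure.pi fun _ : ι => gaussianReal 0 1 := by
  have := hB.isGaussianProcess.isProbabilityMeasure
  have hz' : AEMeasurable (fun ω i => z i ω) P := aemeasurable_pi_lambda _ hz
  -- In Euclidean space the product of standard Gaussians is `stdGaussian`, and a law is determined
  -- by its characteristic function.
  apply (MeasurableEquiv.toLp 2 (ι → ℝ)).map_measurableEquiv_injective
  have := Measure.isProbabilityMeasure_map hz'
  rw [MeasurableEquiv.coe_toLp, map_pi_eq_stdGaussian]
  have : IsProbabilityMeasure ((P.map fun ω i => z i ω).map (WithLp.toLp 2)) :=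
    Measure.isProbabilityMeasure_map (by fun_prop)
  apply Measure.ext_of_charFun
  ext t
  have horthLp : Orthonormal ℝ fun i => (memLp_unitMeasure (hg i)).toLp (g i) := by
    rw [orthonormal_iff_ite]
    intro i j
    rw [← horth i j, L2.inner_def, integral_Icc_eq_integral_Ioc]
    refine integral_congr_ae ?_
    filter_upwards [(memLp_unitMeasure (hg i)).coeFn_toLp, (memLp_unitMeasure (hg j)).coeFn_toLp]
      with x e1 e2
    simp [e1, e2, mul_comm]
  have hnorm : ‖∑ i, t i • (memLp_unitMeasure (hg i)).toLp (g i)‖ ^ 2 = ‖t‖ ^ 2 := by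
    rw [← real_inner_self_eq_norm_sq, horthLp.inner_sum, EuclideanSpace.real_norm_sq_eq]
    simp [pow_two]
  rw [charFun_stdGaussian, charFun_apply, integral_map (by fun_prop) (by fun_prop),
    integral_map hz' (by fun_prop)]
  have h1 := integral_cexp_sum_wienerLp hB hg t
  rw [hnorm] at h1
  simp only [Complex.ofReal_pow] at h1
  rw [← h1]
  refine integral_congr_ae ?_
  have h2 : ∀ᵐ ω ∂P, ∀ i, (t i • wienerLp hB (hg i) : Lp ℝ 2 P) ω = t i * z i ω := by
    rw [ae_all_iff]
    intro i
    filter_upwards [Lp.coeFn_smul (t i) (wienerLp hB (hg i)), hzW i] with ω e1 e2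
    rw [e1, e2, Pi.smul_apply, smul_eq_mul]
  filter_upwards [h2, Lp.coeFn_finsetSum Finset.univ fun i => t i • wienerLp hB (hg i)] with ω e1 e2
  rw [e2, Finset.sum_apply]
  simp [e1, PiLp.inner_apply]

/-! ### Exponential moments of squares of Gaussian variables -/

/-- Exponential tilting: -x²/2 + (1 - v⁻¹)x²/2 = -x²/(2v), so the weighted N(0, 1) density is √v
times that of N(0, v). This evaluates the Chernoff moments exactly. -/
lemma gaussianPDFReal_mul_exp_sq {v : ℝ≥0} (hv : 0 < v) (x : ℝ) :
    gaussianPDFReal 0 1 x * Real.exp ((1 - (v : ℝ)⁻¹) / 2 * x ^ 2) = √v * gaussianPDFReal 0 v x := by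
  have hv' : (0 : ℝ) < v := by exact_mod_cast hv
  simp only [gaussianPDFReal, NNReal.coe_one, mul_one, sub_zero]
  rw [mul_assoc, ← Real.exp_add, Real.sqrt_mul (by positivity : (0 : ℝ) ≤ 2 * Real.pi) v, mul_inv]
  have : √(v : ℝ) ≠ 0 := (Real.sqrt_pos.2 hv').ne'
  field_simp
  congr 1
  ring

lemma lintegral_exp_sq_gaussianReal {v : ℝ≥0} (hv : 0 < v) (h : ℝ → ℝ) (hh : Measurable h) :
    ∫⁻ x, ENNReal.ofReal (h x ^ 2 * Real.exp ((1 - (v : ℝ)⁻¹) / 2 * x ^ 2)) ∂gaussianReal 0 1 =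
      ENNReal.ofReal √v * ∫⁻ x, ENNReal.ofReal (h x ^ 2) ∂gaussianReal 0 v := by
  rw [gaussianReal_of_var_ne_zero _ one_ne_zero, gaussianReal_of_var_ne_zero _ hv.ne',
    lintegral_withDensity_eq_lintegral_mul _ (measurable_gaussianPDF _ _) (by fun_prop),
    lintegral_withDensity_eq_lintegral_mul _ (measurable_gaussianPDF _ _) (by fun_prop),
    ← lintegral_const_mul _ ((measurable_gaussianPDF _ _).mul (by fun_prop))]
  refine lintegral_congr fun x => ?_
  simp only [Pi.mul_apply, gaussianPDF]
  rw [← ENNReal.ofReal_mul (gaussianPDFReal_nonneg _ _ _),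
    ← ENNReal.ofReal_mul (gaussianPDFReal_nonneg _ _ _), ← ENNReal.ofReal_mul (by positivity)]
  congr 1
  have := gaussianPDFReal_mul_exp_sq hv x
  linear_combination (h x ^ 2) * this

lemma lintegral_sq_gaussianReal (v : ℝ≥0) :
    ∫⁻ x, ENNReal.ofReal (x ^ 2) ∂gaussianReal 0 v = ENNReal.ofReal v := by
  have h := variance_fun_id_gaussianReal (μ := 0) (v := v)
  rw [variance_eq_integral (by fun_prop), integral_id_gaussianReal] at h
  simp only [sub_zero] at h
  rw [← h, ofReal_integral_eq_lintegral_ofReal _ (ae_of_all _ fun x => sq_nonneg x)]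
  exact (memLp_id_gaussianReal' 2 (by simp)).integrable_sq

/-- The variables `z p` have the law of independent standard normal variables, as far as the
moments `E z_p² exp(s ∑ z_q²)` are concerned. -/
def StdNormalMoments {κ : Type*} (P : Measure Ω) (z : κ → Ω → ℝ) (I : Set κ) : Prop :=
  (∀ p, Measurable (z p)) ∧ ∀ v : ℝ, 0 < v → ∀ S : Finset κ, (S : Set κ) ⊆ I → ∀ p ∈ S,
    ∫⁻ ω, ENNReal.ofReal (z p ω ^ 2 * Real.exp ((1 - v⁻¹) / 2 * ∑ q ∈ S, z q ω ^ 2)) ∂P =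
      ENNReal.ofReal (v * √v ^ S.card)

lemma lintegral_pi_prod {ι : Type*} [Fintype ι] (γ : Measure ℝ) [IsProbabilityMeasure γ]
    {F : ι → ℝ → ℝ≥0∞} (hF : ∀ q, Measurable (F q)) :
    ∫⁻ x, ∏ q, F q (x q) ∂(Measure.pi fun _ : ι => γ) = ∏ q, ∫⁻ x, F q x ∂γ := by
  have hind : iIndepFun (fun q (x : ι → ℝ) => F q (x q)) (Measure.pi fun _ : ι => γ) :=
    iIndepFun_pi (X := F) fun q => (hF q).aemeasurable
  rw [lintegral_prod_eq_prod_lintegral_of_indepFun Finset.univ _ hind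
    fun q => (hF q).comp (measurable_pi_apply q)]
  refine Finset.prod_congr rfl fun q _ => ?_
  exact (measurePreserving_eval (fun _ : ι => γ) q).lintegral_comp (hF q)

/-- By independence the integral factors. Every coordinate contributes √v, and the coordinate p,
which carries the square, an additional v. -/
lemma lintegral_pi_gaussian_exp_sq {ι : Type*} [Fintype ι] [DecidableEq ι] {v : ℝ≥0} (hv : 0 < v)
    (p : ι) :
    ∫⁻ x, ENNReal.ofReal (x p ^ 2 * Real.exp ((1 - (v : ℝ)⁻¹) / 2 * ∑ q, x q ^ 2))
      ∂(Measure.pi fun _ : ι => gaussianReal 0 1) =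
      ENNReal.ofReal (v * √v ^ Fintype.card ι) := by
  set s := (1 - (v : ℝ)⁻¹) / 2 with hs
  set h : ι → ℝ → ℝ := fun q x => if q = p then x else 1 with hdef
  have hh : ∀ q, Measurable (h q) := by
    intro q
    change Measurable fun x => if q = p then x else 1
    split_ifs
    exacts [measurable_id, measurable_const]
  set F : ι → ℝ → ℝ≥0∞ := fun q x => ENNReal.ofReal (h q x ^ 2 * Real.exp (s * x ^ 2)) with hFdef
  have hF : ∀ q, Measurable (F q) := fun q => by have := hh q; fun_prop
  have h1 : ∀ x : ι → ℝ, ENNReal.ofReal (x p ^ 2 * Real.exp (s * ∑ q, x q ^ 2)) =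
      ∏ q, F q (x q) := by
    intro x
    rw [← ENNReal.ofReal_prod_of_nonneg fun q _ => by positivity, Finset.prod_mul_distrib,
      ← Real.exp_sum, ← Finset.mul_sum]
    congr 2
    rw [Finset.prod_eq_single p]
    · simp [hdef]
    · intro q _ hq
      simp [hdef, hq]
    · simp
  have h3 : ∀ q, ∫⁻ x, F q x ∂(gaussianReal 0 1) =
      ENNReal.ofReal √v * if q = p then ENNReal.ofReal v else 1 := by
    intro q
    refine (lintegral_exp_sq_gaussianReal hv _ (hh q)).trans ?_
    congr 1
    by_cases hq : q = p
    · simp only [hdef, hq, if_true, lintegral_sq_gaussianReal]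
    · simp [hdef, hq]
  refine (lintegral_congr h1).trans ((lintegral_pi_prod _ hF).trans ?_)
  simp_rw [h3]
  rw [Finset.prod_mul_distrib, Finset.prod_const, Finset.card_univ, Finset.prod_eq_single p]
  · rw [if_pos rfl, ← ENNReal.ofReal_pow (by positivity), ← ENNReal.ofReal_mul (by positivity),
      mul_comm]
  · intro q _ hq
    rw [if_neg hq]
  · simp

/-- The moments of a finite subfamily depend only on its joint law, which is the product Gaussian by
`map_wienerLp`. -/
lemma stdNormalMoments_of_ae_eq_wienerLp (hB : IsPreBrownianReal B P) {κ : Type*} [DecidableEq κ]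
    {g : κ → ℝ → ℝ} {I : Set κ} (hg : ∀ p ∈ I, ContinuousOn (g p) (Icc 0 1))
    (horth : ∀ p ∈ I, ∀ q ∈ I, ∫ x in Icc (0 : ℝ) 1, g p x * g q x = if p = q then 1 else 0)
    {z : κ → Ω → ℝ} (hz : ∀ p, Measurable (z p))
    (hzW : ∀ p (hp : p ∈ I), z p =ᵐ[P] wienerLp hB (hg p hp)) :
    StdNormalMoments P z I := by
  refine ⟨hz, fun v hv S hS p hp => ?_⟩
  lift v to ℝ≥0 using hv.le
  have hv' : 0 < v := by exact_mod_cast hv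
  have hmap := map_wienerLp hB (ι := S) (g := fun q => g q) (fun q => hg q (hS q.2))
    (fun q q' => by
      rw [horth q (hS q.2) q' (hS q'.2)]
      simp only [Subtype.ext_iff])
    (z := fun q => z q) (fun q => (hz q).aemeasurable) (fun q => hzW q (hS q.2))
  have h := lintegral_pi_gaussian_exp_sq hv' (⟨p, hp⟩ : S)
  rw [← hmap, lintegral_map (by fun_prop) (measurable_pi_lambda _ fun q : S => hz q)] at h
  rw [Fintype.card_coe] at h
  rw [← h]
  refine lintegral_congr fun ω => ?_
  rw [Finset.sum_coe_sort S fun q => z q ω ^ 2]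

end

section

/-! ### James–Stein and soft thresholding rules: pointwise inequalities -/

lemma jsFactor_nonneg (n : ℕ) (lam : ℝ) (m : ℕ) (S2 : ℝ) : 0 ≤ jsFactor n lam m S2 := le_max_right _ _

lemma jsFactor_le_one (n : ℕ) {lam : ℝ} (hlam : 0 ≤ lam) (m : ℕ) {S2 : ℝ} (hS : 0 ≤ S2) :
    jsFactor n lam m S2 ≤ 1 := by
  refine max_le ?_ zero_le_one
  have : 0 ≤ lam * (m : ℝ) * (n : ℝ)⁻¹ / S2 := by positivity
  linarith

/-- The rule moves the block by a vector of squared length S² ≤ T if the block is killed, and T²/S²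
≤ T otherwise, where T is the threshold. -/
lemma one_sub_jsFactor_sq_mul_le (n : ℕ) {lam : ℝ} (hlam : 0 ≤ lam) (m : ℕ) {S2 : ℝ} (hS : 0 ≤ S2) :
    (1 - jsFactor n lam m S2) ^ 2 * S2 ≤ lam * m / n := by
  have hT : 0 ≤ lam * (m : ℝ) * (n : ℝ)⁻¹ := by positivity
  rw [div_eq_mul_inv]
  rcases hS.eq_or_lt with rfl | hS
  · simpa using hT
  set T := lam * (m : ℝ) * (n : ℝ)⁻¹ with hTdef
  unfold jsFactor
  rw [← hTdef]
  rcases le_total (1 - T / S2) 0 with h | h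
  · rw [max_eq_right h]
    have : 1 ≤ T / S2 := by linarith
    rw [le_div_iff₀ hS] at this
    linarith
  · rw [max_eq_left h]
    have h1 : T / S2 ≤ 1 := by linarith
    have h2 : T / S2 * S2 = T := div_mul_cancel₀ _ hS.ne'
    calc (1 - (1 - T / S2)) ^ 2 * S2 = T / S2 * (T / S2 * S2) := by ring
      _ = T / S2 * T := by rw [h2]
      _ ≤ 1 * T := by gcongr
      _ = T := one_mul _

lemma lt_of_jsFactor_mul_ne_zero {n : ℕ} {lam : ℝ} {m : ℕ} {S2 y : ℝ} (hS : y ^ 2 ≤ S2)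
    (h : jsFactor n lam m S2 * y ≠ 0) : lam * m / n < S2 := by
  have hy : y ≠ 0 := right_ne_zero_of_mul h
  have hS0 : 0 < S2 := lt_of_lt_of_le (by positivity) hS
  have hF := left_ne_zero_of_mul h
  by_contra hlt
  apply hF
  unfold jsFactor
  rw [div_eq_mul_inv] at hlt
  refine max_eq_right ?_
  have : 1 ≤ lam * (m : ℝ) * (n : ℝ)⁻¹ / S2 := by
    rw [le_div_iff₀ hS0]; linarith
  linarith

/-- The square is convex and Fy lies between 0 and y, so the error is at most a mixture of the
errors at y and at 0. -/
lemma sq_mul_sub_le {F y θ : ℝ} (h0 : 0 ≤ F) (h1 : F ≤ 1) :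
    (F * y - θ) ^ 2 ≤ 2 * θ ^ 2 + 2 * (y - θ) ^ 2 := by
  have h : (F * y - θ) ^ 2 ≤ F * (y - θ) ^ 2 + (1 - F) * θ ^ 2 := by
    nlinarith [mul_nonneg (mul_nonneg h0 (sub_nonneg.2 h1)) (sq_nonneg y)]
  nlinarith [sq_nonneg θ, sq_nonneg (y - θ)]

variable {κ : Type*}

lemma sum_jsFactor_sq_le (n : ℕ) {lam : ℝ} (hlam : 0 ≤ lam) (m : ℕ) (S : Finset κ) (y θ : κ → ℝ) :
    ∑ p ∈ S, (jsFactor n lam m (∑ q ∈ S, y q ^ 2) * y p - θ p) ^ 2 ≤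
      2 * (lam * m / n) + 2 * ∑ p ∈ S, (y p - θ p) ^ 2 := by
  set F := jsFactor n lam m (∑ q ∈ S, y q ^ 2)
  have h := one_sub_jsFactor_sq_mul_le n hlam m (S2 := ∑ q ∈ S, y q ^ 2)
    (Finset.sum_nonneg fun _ _ => sq_nonneg _)
  calc ∑ p ∈ S, (F * y p - θ p) ^ 2
      ≤ ∑ p ∈ S, (2 * ((1 - F) ^ 2 * y p ^ 2) + 2 * (y p - θ p) ^ 2) := by
        refine Finset.sum_le_sum fun p _ => ?_
        nlinarith [sq_nonneg ((1 - F) * y p + (y p - θ p))]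
    _ = 2 * ((1 - F) ^ 2 * ∑ q ∈ S, y q ^ 2) + 2 * ∑ p ∈ S, (y p - θ p) ^ 2 := by
        rw [Finset.sum_add_distrib, Finset.mul_sum, Finset.mul_sum, Finset.mul_sum]
    _ ≤ _ := by gcongr

/-- The triangle inequality for y = (y - θ) + θ in squared form. With the Young weights 1 + ε/a and
1 + a/ε nothing is lost when the two norms are a√r and ε√r. -/
lemma le_sum_sq_of_lt {S : Finset κ} {y θ : κ → ℝ} {a ε r : ℝ} (ha : 0 < a) (hε : 0 < ε)
    (hθ : ∑ q ∈ S, θ q ^ 2 ≤ ε ^ 2 * r) (hy : (a + ε) ^ 2 * r < ∑ q ∈ S, y q ^ 2) :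
    a ^ 2 * r ≤ ∑ q ∈ S, (y q - θ q) ^ 2 := by
  have h : ∑ q ∈ S, y q ^ 2 ≤
      (1 + ε / a) * ∑ q ∈ S, (y q - θ q) ^ 2 + (1 + a / ε) * ∑ q ∈ S, θ q ^ 2 := by
    rw [Finset.mul_sum, Finset.mul_sum, ← Finset.sum_add_distrib]
    refine Finset.sum_le_sum fun q _ => ?_
    have h1 : (1 + ε / a) * (y q - θ q) ^ 2 + (1 + a / ε) * θ q ^ 2 - y q ^ 2 =
        (ε * (y q - θ q) - a * θ q) ^ 2 / (a * ε) := by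
      field_simp
      ring
    have h2 : 0 ≤ (ε * (y q - θ q) - a * θ q) ^ 2 / (a * ε) := by positivity
    linarith
  have h3 : (1 + a / ε) * ∑ q ∈ S, θ q ^ 2 ≤ (1 + a / ε) * (ε ^ 2 * r) := by gcongr
  have h4 : (1 + a / ε) * (ε ^ 2 * r) = (a + ε) ^ 2 * r - (1 + ε / a) * (a ^ 2 * r) := by
    field_simp
    ring
  have h5 : (1 + ε / a) * (a ^ 2 * r) < (1 + ε / a) * ∑ q ∈ S, (y q - θ q) ^ 2 := by linarith
  exact (lt_of_mul_lt_mul_left h5 (by positivity)).le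

/-- For a block with little signal, the James–Stein rule can only be in error by more than the
signal if the noise in the block is large. -/
lemma jsFactor_sq_le_of_small {n : ℕ} (hn : 0 < n) {lam : ℝ} (m : ℕ) {S : Finset κ}
    {θ z : κ → ℝ} {a ε s : ℝ} (ha : 0 < a) (hε : 0 < ε) (hlam : (a + ε) ^ 2 = lam) (hs : 0 ≤ s)
    (hθ : ∑ q ∈ S, θ q ^ 2 ≤ ε ^ 2 * (m / n)) {p : κ} (hp : p ∈ S) :
    (jsFactor n lam m (∑ q ∈ S, (θ q + 1 / √(n : ℝ) * z q) ^ 2) * (θ p + 1 / √(n : ℝ) * z p) -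
      θ p) ^ 2 ≤ 2 * θ p ^ 2 +
        2 / n * (Real.exp (-(s * (a ^ 2 * m))) * (z p ^ 2 * Real.exp (s * ∑ q ∈ S, z q ^ 2))) := by
  have hn' : (0 : ℝ) < n := by exact_mod_cast hn
  set y : κ → ℝ := fun q => θ q + 1 / √(n : ℝ) * z q with hy
  have hz : ∀ q, (y q - θ q) ^ 2 = 1 / n * z q ^ 2 := by
    intro q
    simp only [hy, add_sub_cancel_left, mul_pow, div_pow, one_pow, Real.sq_sqrt hn'.le]
  have hlam0 : 0 ≤ lam := hlam ▸ sq_nonneg _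
  have hSy : y p ^ 2 ≤ ∑ q ∈ S, y q ^ 2 :=
    Finset.single_le_sum (f := fun q => y q ^ 2) (fun _ _ => sq_nonneg _) hp
  by_cases h : jsFactor n lam m (∑ q ∈ S, y q ^ 2) * y p = 0
  · change (jsFactor n lam m (∑ q ∈ S, y q ^ 2) * y p - θ p) ^ 2 ≤ _
    rw [h, zero_sub, neg_sq]
    have : 0 ≤ 2 / (n : ℝ) * (Real.exp (-(s * (a ^ 2 * m))) *
      (z p ^ 2 * Real.exp (s * ∑ q ∈ S, z q ^ 2))) := by positivity
    nlinarith [sq_nonneg (θ p)]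
  · have h1 := lt_of_jsFactor_mul_ne_zero hSy h
    rw [← hlam, mul_div_assoc] at h1
    have h2 := le_sum_sq_of_lt ha hε hθ h1
    simp only [hz, ← Finset.mul_sum] at h2
    have h3 : a ^ 2 * m ≤ ∑ q ∈ S, z q ^ 2 := by
      have : 1 / (n : ℝ) * (a ^ 2 * m) ≤ 1 / n * ∑ q ∈ S, z q ^ 2 := by
        refine le_trans (le_of_eq ?_) h2
        ring
      exact le_of_mul_le_mul_left this (by positivity)
    have h4 : 1 ≤ Real.exp (-(s * (a ^ 2 * m))) * Real.exp (s * ∑ q ∈ S, z q ^ 2) := by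
      rw [← Real.exp_add]
      refine Real.one_le_exp ?_
      have := mul_le_mul_of_nonneg_left h3 hs
      linarith
    have h5 := sq_mul_sub_le (y := y p) (θ := θ p) (jsFactor_nonneg n lam m (∑ q ∈ S, y q ^ 2))
      (jsFactor_le_one n hlam0 m ((sq_nonneg _).trans hSy))
    refine h5.trans ?_
    rw [hz]
    have h6 : 2 / (n : ℝ) * z p ^ 2 * 1 ≤ 2 / (n : ℝ) * z p ^ 2 *
        (Real.exp (-(s * (a ^ 2 * m))) * Real.exp (s * ∑ q ∈ S, z q ^ 2)) := by gcongr
    calc _ = 2 * θ p ^ 2 + 2 / (n : ℝ) * z p ^ 2 * 1 := by ring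
      _ ≤ _ := by linarith

lemma abs_softThreshold_sub_le (n : ℕ) (y : ℝ) :
    |softThreshold n y - y| ≤ √(2 * (n : ℝ)⁻¹ * Real.log n) := by
  unfold softThreshold
  set T := √(2 * (n : ℝ)⁻¹ * Real.log n)
  have hT : 0 ≤ T := Real.sqrt_nonneg _
  rcases lt_trichotomy y 0 with h | h | h
  · rw [Real.sign_of_neg h, abs_of_neg h]
    rcases le_total (-y - T) 0 with h' | h'
    · rw [max_eq_right h', abs_le]; constructor <;> linarith
    · rw [max_eq_left h', abs_le]; constructor <;> linarith
  · simp [h, hT]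
  · rw [Real.sign_of_pos h, abs_of_pos h]
    rcases le_total (y - T) 0 with h' | h'
    · rw [max_eq_right h', abs_le]; constructor <;> linarith
    · rw [max_eq_left h', abs_le]; constructor <;> linarith

lemma abs_softThreshold_le (n : ℕ) (y : ℝ) :
    |softThreshold n y| ≤ max (|y| - √(2 * (n : ℝ)⁻¹ * Real.log n)) 0 := by
  unfold softThreshold
  rw [abs_mul, abs_of_nonneg (le_max_right _ _ : 0 ≤ max (|y| - _) 0)]
  refine mul_le_of_le_one_left (le_max_right _ _) ?_
  rcases lt_trichotomy y 0 with h | h | h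
  · simp [Real.sign_of_neg h]
  · simp [h]
  · simp [Real.sign_of_pos h]

lemma softThreshold_sq_le (n : ℕ) (y θ : ℝ) :
    (softThreshold n y - θ) ^ 2 ≤ 2 * (√(2 * (n : ℝ)⁻¹ * Real.log n)) ^ 2 + 2 * (y - θ) ^ 2 := by
  have h := abs_softThreshold_sub_le n y
  have h1 := sq_le_sq' (neg_le_of_abs_le h) (le_of_abs_le h)
  nlinarith [sq_nonneg ((softThreshold n y - y) - (y - θ))]

/-- If the output is nonzero, then |θ + w| exceeds the threshold T while |θ| ≤ (1 - b)T. The noise w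
alone then exceeds bT, and the output is no larger than the noise. The Chernoff factor again pays
for the event. -/
lemma softThreshold_sq_le_of_small {n : ℕ} (hn : 0 < n) {θ z b s : ℝ} (hb0 : 0 ≤ b)
    (hs : 0 ≤ s) (hθ : |θ| ≤ (1 - b) * √(2 * (n : ℝ)⁻¹ * Real.log n)) :
    (softThreshold n (θ + 1 / √(n : ℝ) * z) - θ) ^ 2 ≤ 2 * θ ^ 2 +
        2 / n * (Real.exp (-(s * (b ^ 2 * (2 * Real.log n)))) * (z ^ 2 * Real.exp (s * z ^ 2))) := by
  have hn' : (0 : ℝ) < n := by exact_mod_cast hn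
  have hlog : 0 ≤ Real.log n := Real.log_natCast_nonneg n
  set T := √(2 * (n : ℝ)⁻¹ * Real.log n) with hT
  have hT0 : 0 ≤ T := Real.sqrt_nonneg _
  have hTsq : T ^ 2 = 2 * (n : ℝ)⁻¹ * Real.log n := Real.sq_sqrt (by positivity)
  set w := 1 / √(n : ℝ) * z with hw
  have hwsq : w ^ 2 = 1 / n * z ^ 2 := by
    rw [hw, mul_pow, div_pow, one_pow, Real.sq_sqrt hn'.le]
  set η := softThreshold n (θ + w)
  have h1 : (η - θ) ^ 2 ≤ 2 * θ ^ 2 + 2 * η ^ 2 := by nlinarith [sq_nonneg (η + θ)]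
  refine h1.trans ?_
  have h2 := abs_softThreshold_le n (θ + w)
  have h3 : |θ + w| ≤ |θ| + |w| := abs_add_le _ _
  rcases le_or_gt (|θ + w| - T) 0 with h | h
  · rw [max_eq_right h] at h2
    have : η = 0 := abs_nonpos_iff.1 h2
    rw [this]
    have : 0 ≤ 2 / (n : ℝ) * (Real.exp (-(s * (b ^ 2 * (2 * Real.log n)))) *
      (z ^ 2 * Real.exp (s * z ^ 2))) := by positivity
    linarith
  · rw [max_eq_left h.le] at h2
    have h4 : |η| ≤ |w| := by nlinarith
    have h5 : b * T ≤ |w| := by nlinarith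
    have h6 : η ^ 2 ≤ w ^ 2 := sq_le_sq.2 h4
    have h7 : (b * T) ^ 2 ≤ w ^ 2 := by
      rw [← sq_abs w]; exact pow_le_pow_left₀ (by positivity) h5 2
    have h8 : b ^ 2 * (2 * Real.log n) ≤ z ^ 2 := by
      rw [mul_pow, hTsq, hwsq] at h7
      have : 1 / (n : ℝ) * (b ^ 2 * (2 * Real.log n)) ≤ 1 / n * z ^ 2 := by
        refine le_trans (le_of_eq ?_) h7
        ring
      exact le_of_mul_le_mul_left this (by positivity)
    have h9 : 1 ≤ Real.exp (-(s * (b ^ 2 * (2 * Real.log n)))) * Real.exp (s * z ^ 2) := by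
      rw [← Real.exp_add]
      refine Real.one_le_exp ?_
      have := mul_le_mul_of_nonneg_left h8 hs
      linarith
    have h10 : 2 / (n : ℝ) * z ^ 2 * 1 ≤ 2 / (n : ℝ) * z ^ 2 *
        (Real.exp (-(s * (b ^ 2 * (2 * Real.log n)))) * Real.exp (s * z ^ 2)) := by gcongr
    calc 2 * θ ^ 2 + 2 * η ^ 2 ≤ 2 * θ ^ 2 + 2 / (n : ℝ) * z ^ 2 * 1 := by
          rw [hwsq] at h6
          have : 2 / (n : ℝ) * z ^ 2 * 1 = 2 * (1 / n * z ^ 2) := by ring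
          linarith
      _ ≤ _ := by linarith

end

section

variable {Ω : Type*} [MeasurableSpace Ω] {P : Measure Ω}

/-! ### James–Stein and soft thresholding rules: mean square bounds -/

/-- Only a constant and a constant multiple are split off, so neither `X` nor `g` needs to be
measurable. -/
lemma lintegral_ofReal_le_of_le [IsProbabilityMeasure P] {X g : Ω → ℝ} {c d e : ℝ} (hc : 0 ≤ c) (hd : 0 ≤ d) (he : 0 ≤ e)
    (hX : ∀ ω, X ω ≤ c + d * g ω) (hg0 : ∀ ω, 0 ≤ g ω)
    (hge : ∫⁻ ω, ENNReal.ofReal (g ω) ∂P ≤ ENNReal.ofReal e) :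
    ∫⁻ ω, ENNReal.ofReal (X ω) ∂P ≤ ENNReal.ofReal (c + d * e) := by
  calc ∫⁻ ω, ENNReal.ofReal (X ω) ∂P
      ≤ ∫⁻ ω, (ENNReal.ofReal c + ENNReal.ofReal d * ENNReal.ofReal (g ω)) ∂P := by
        refine lintegral_mono fun ω => ?_
        rw [← ENNReal.ofReal_mul hd, ← ENNReal.ofReal_add hc (mul_nonneg hd (hg0 ω))]
        exact ENNReal.ofReal_le_ofReal (hX ω)
    _ = ENNReal.ofReal c + ENNReal.ofReal d * ∫⁻ ω, ENNReal.ofReal (g ω) ∂P := by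
        rw [lintegral_add_left measurable_const, lintegral_const, measure_univ, mul_one,
          lintegral_const_mul' _ _ ENNReal.ofReal_ne_top]
    _ ≤ ENNReal.ofReal c + ENNReal.ofReal d * ENNReal.ofReal e := by gcongr
    _ = _ := by rw [← ENNReal.ofReal_mul hd, ← ENNReal.ofReal_add hc (mul_nonneg hd he)]

variable {κ : Type*} {z : κ → Ω → ℝ} {I : Set κ}

lemma StdNormalMoments.lintegral_sq (hz : StdNormalMoments P z I) {p : κ} (hp : p ∈ I) :
    ∫⁻ ω, ENNReal.ofReal (z p ω ^ 2) ∂P = 1 := by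
  have h := hz.2 1 one_pos {p} (by simpa using hp) p (by simp)
  simpa using h

lemma StdNormalMoments.lintegral_sum_sq (hz : StdNormalMoments P z I) {S : Finset κ}
    (hS : (S : Set κ) ⊆ I) :
    ∫⁻ ω, ENNReal.ofReal (∑ p ∈ S, z p ω ^ 2) ∂P = ENNReal.ofReal S.card := by
  have h : ∀ ω, ENNReal.ofReal (∑ p ∈ S, z p ω ^ 2) = ∑ p ∈ S, ENNReal.ofReal (z p ω ^ 2) :=
    fun ω => ENNReal.ofReal_sum_of_nonneg fun _ _ => sq_nonneg _
  simp_rw [h]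
  rw [lintegral_finsetSum _ fun p _ => by have := hz.1 p; fun_prop,
    Finset.sum_congr rfl fun p hp => hz.lintegral_sq (hS hp)]
  simp

variable [IsProbabilityMeasure P]

/-- For an arbitrary signal the error is controlled by the threshold plus the noise, both of order
m/n. -/
lemma lintegral_sum_jsFactor_le (hz : StdNormalMoments P z I) {n : ℕ} (hn : 0 < n) {lam : ℝ}
    (hlam : 0 ≤ lam) {m : ℕ} {S : Finset κ} (hS : (S : Set κ) ⊆ I) (hm : S.card ≤ m) (θ : κ → ℝ) :
    ∫⁻ ω, ENNReal.ofReal (∑ p ∈ S,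
      (jsFactor n lam m (∑ q ∈ S, (θ q + 1 / √(n : ℝ) * z q ω) ^ 2) *
        (θ p + 1 / √(n : ℝ) * z p ω) - θ p) ^ 2) ∂P ≤
      ENNReal.ofReal ((2 * lam + 2) * (m / n)) := by
  have hn' : (0 : ℝ) < n := by exact_mod_cast hn
  refine (lintegral_ofReal_le_of_le (c := 2 * (lam * m / n)) (d := 2 / n) (e := S.card)
    (g := fun ω => ∑ p ∈ S, z p ω ^ 2) (by positivity) (by positivity) (by positivity)
    (fun ω => ?_) (fun ω => Finset.sum_nonneg fun _ _ => sq_nonneg _)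
    (hz.lintegral_sum_sq hS).le).trans (ENNReal.ofReal_le_ofReal ?_)
  · refine (sum_jsFactor_sq_le n hlam m S (fun q => θ q + 1 / √(n : ℝ) * z q ω) θ).trans
      (le_of_eq ?_)
    simp only [add_sub_cancel_left, mul_pow, div_pow, one_pow, Real.sq_sqrt hn'.le,
      ← Finset.mul_sum]
    ring
  · have : (S.card : ℝ) ≤ m := by exact_mod_cast hm
    have h2 : 2 / (n : ℝ) * S.card ≤ 2 / n * m := by gcongr
    calc _ ≤ 2 * (lam * m / n) + 2 / (n : ℝ) * m := by linarith
      _ = _ := by ring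

lemma lintegral_jsFactor_le (hz : StdNormalMoments P z I) {n : ℕ} (hn : 0 < n) {lam : ℝ}
    (hlam : 0 ≤ lam) {m : ℕ} {S : Finset κ} (hS : (S : Set κ) ⊆ I) (θ : κ → ℝ)
    {p : κ} (hp : p ∈ S) :
    ∫⁻ ω, ENNReal.ofReal ((jsFactor n lam m (∑ q ∈ S, (θ q + 1 / √(n : ℝ) * z q ω) ^ 2) *
        (θ p + 1 / √(n : ℝ) * z p ω) - θ p) ^ 2) ∂P ≤
      ENNReal.ofReal (2 * θ p ^ 2 + 2 / n) := by
  have hn' : (0 : ℝ) < n := by exact_mod_cast hn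
  refine (lintegral_ofReal_le_of_le (c := 2 * θ p ^ 2) (d := 2 / n) (e := 1)
    (g := fun ω => z p ω ^ 2) (by positivity) (by positivity) (by positivity)
    (fun ω => ?_) (fun ω => sq_nonneg _)
    (by simpa using (hz.lintegral_sq (hS hp)).le)).trans (le_of_eq (by rw [mul_one]))
  refine (sq_mul_sub_le (jsFactor_nonneg _ _ _ _) (jsFactor_le_one n hlam m
    (Finset.sum_nonneg fun _ _ => sq_nonneg _))).trans (le_of_eq ?_)
  simp only [add_sub_cancel_left, mul_pow, div_pow, one_pow, Real.sq_sqrt hn'.le]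
  ring

/-- The threshold constant leaves room for some signal in the block at an arbitrarily small loss in
the exponent. -/
lemma exists_split_threshold {lam κ₀ : ℝ} (hlam_gt : 1 < lam) (hlam : lam - Real.log lam - 1 = 2)
    (hκ : κ₀ < 1) : ∃ a ε : ℝ, 0 < a ∧ 0 < ε ∧ (a + ε) ^ 2 = lam ∧
      κ₀ ≤ (1 - lam⁻¹) / 2 * a ^ 2 - Real.log lam / 2 := by
  have hs : 0 < √lam := Real.sqrt_pos.2 (by linarith)
  have hcont : Continuous fun a : ℝ => (1 - lam⁻¹) / 2 * a ^ 2 - Real.log lam / 2 := by fun_prop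
  -- The defining equation of `lam` enters here: at a = √lam the exponent is (lam - 1 - log lam)/2 =
  -- 1. By continuity it stays above κ₀ for a slightly smaller a, and the gap √lam - a is the room
  -- left for the signal.
  have hval : (1 - lam⁻¹) / 2 * √lam ^ 2 - Real.log lam / 2 = 1 := by
    rw [Real.sq_sqrt (by linarith)]
    have : lam ≠ 0 := by linarith
    field_simp
    linarith
  have h1 : ∀ᶠ a in 𝓝[<] √lam, κ₀ < (1 - lam⁻¹) / 2 * a ^ 2 - Real.log lam / 2 :=
    ((hcont.tendsto _).mono_left nhdsWithin_le_nhds).eventually_const_lt (by rw [hval]; exact hκ)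
  have h2 : ∀ᶠ a in 𝓝[<] √lam, 0 < a ∧ a < √lam := by
    filter_upwards [self_mem_nhdsWithin, nhdsWithin_le_nhds (lt_mem_nhds hs)] with a h3 h4
    exact ⟨h4, h3⟩
  obtain ⟨a, ha1, ha2, ha3⟩ := (h1.and h2).exists
  refine ⟨a, √lam - a, ha2, by linarith, ?_, ha1.le⟩
  rw [add_sub_cancel, Real.sq_sqrt (by linarith)]

/-- The moments are taken at variance v = `lam`, the optimal Chernoff parameter for the level `lam`
· m. The moment √lam^m times exp(-s a² m) is at most exp(-κ₀ m), and the extra factor z_p² only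
costs the constant `lam`. -/
lemma lintegral_jsFactor_le_of_small (hz : StdNormalMoments P z I) {n : ℕ} (hn : 0 < n)
    {lam a ε κ₀ : ℝ} (hlam_gt : 1 < lam) (ha : 0 < a) (hε : 0 < ε) (haε : (a + ε) ^ 2 = lam)
    (hκ : κ₀ ≤ (1 - lam⁻¹) / 2 * a ^ 2 - Real.log lam / 2)
    {m : ℕ} {S : Finset κ} (hS : (S : Set κ) ⊆ I) (hm : S.card ≤ m) {θ : κ → ℝ}
    (hθ : ∑ q ∈ S, θ q ^ 2 ≤ ε ^ 2 * (m / n)) {p : κ} (hp : p ∈ S) :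
    ∫⁻ ω, ENNReal.ofReal ((jsFactor n lam m (∑ q ∈ S, (θ q + 1 / √(n : ℝ) * z q ω) ^ 2) *
        (θ p + 1 / √(n : ℝ) * z p ω) - θ p) ^ 2) ∂P ≤
      ENNReal.ofReal (2 * θ p ^ 2 + 2 * lam * (Real.exp (-(κ₀ * m)) / n)) := by
  have hn' : (0 : ℝ) < n := by exact_mod_cast hn
  have hlam0 : 0 < lam := by linarith
  set s := (1 - lam⁻¹) / 2 with hs
  have hs0 : 0 ≤ s := by
    have : lam⁻¹ ≤ 1 := inv_le_one_of_one_le₀ hlam_gt.le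
    rw [hs]; linarith
  have hE := (hz.2 lam hlam0 S hS p hp).le
  refine (lintegral_ofReal_le_of_le (c := 2 * θ p ^ 2)
    (d := 2 / n * Real.exp (-(s * (a ^ 2 * m)))) (by positivity) (by positivity) (by positivity)
    (fun ω => (jsFactor_sq_le_of_small hn m (z := fun q => z q ω) ha hε haε hs0 hθ hp).trans
      (le_of_eq (by rw [mul_assoc])))
    (fun ω => by positivity) hE).trans (ENNReal.ofReal_le_ofReal ?_)
  have h1 : √lam ^ S.card ≤ √lam ^ m := pow_le_pow_right₀ (Real.one_le_sqrt.2 hlam_gt.le) hm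
  have h2 : √lam ^ m = Real.exp (Real.log lam / 2 * m) := by
    rw [← Real.log_sqrt hlam0.le, mul_comm, Real.exp_nat_mul,
      Real.exp_log (Real.sqrt_pos.2 hlam0)]
  have h3 : Real.exp (-(s * (a ^ 2 * m))) * √lam ^ m ≤ Real.exp (-(κ₀ * m)) := by
    rw [h2, ← Real.exp_add]
    refine Real.exp_le_exp.2 ?_
    have := mul_le_mul_of_nonneg_right hκ (Nat.cast_nonneg (α := ℝ) m)
    linarith
  calc 2 * θ p ^ 2 + 2 / (n : ℝ) * Real.exp (-(s * (a ^ 2 * m))) * (lam * √lam ^ S.card)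
      ≤ 2 * θ p ^ 2 + 2 / (n : ℝ) * Real.exp (-(s * (a ^ 2 * m))) * (lam * √lam ^ m) := by gcongr
    _ = 2 * θ p ^ 2 + 2 / (n : ℝ) * lam * (Real.exp (-(s * (a ^ 2 * m))) * √lam ^ m) := by ring
    _ ≤ 2 * θ p ^ 2 + 2 / (n : ℝ) * lam * Real.exp (-(κ₀ * m)) := by gcongr
    _ = _ := by ring

/-- The oracle inequality for a James–Stein block. -/
lemma exists_lintegral_sum_jsFactor_le {lam κ₀ : ℝ} (hlam_gt : 1 < lam)
    (hlam : lam - Real.log lam - 1 = 2) (hκ : κ₀ < 1) :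
    ∃ C : ℝ, 0 < C ∧ ∀ {Ω : Type*} [MeasurableSpace Ω] {P : Measure Ω} [IsProbabilityMeasure P]
      {κ : Type*} {z : κ → Ω → ℝ} {I : Set κ} (_ : StdNormalMoments P z I) {n : ℕ} (_ : 0 < n)
      {m : ℕ} {S : Finset κ} (_ : (S : Set κ) ⊆ I) (_ : S.card ≤ m) (θ : κ → ℝ),
      ∫⁻ ω, ENNReal.ofReal (∑ p ∈ S,
        (jsFactor n lam m (∑ q ∈ S, (θ q + 1 / √(n : ℝ) * z q ω) ^ 2) *
          (θ p + 1 / √(n : ℝ) * z p ω) - θ p) ^ 2) ∂P ≤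
      ENNReal.ofReal (C * (min (∑ p ∈ S, θ p ^ 2) (m / n) + m / n * Real.exp (-(κ₀ * m)))) := by
  obtain ⟨a, ε, ha, hε, haε, hκ'⟩ := exists_split_threshold hlam_gt hlam hκ
  have hlam0 : 0 < lam := by linarith
  refine ⟨2 + ε ^ 2 + (2 * lam + 2) + (2 * lam + 2) / ε ^ 2 + 2 * lam + 2 * ε ^ 2, by positivity,
    ?_⟩
  intro Ω _ P _ κ z I hz n hn m S hS hm θ
  have hn' : (0 : ℝ) < n := by exact_mod_cast hn
  have hr : 0 ≤ (m : ℝ) / n := by positivity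
  have hΘ : 0 ≤ ∑ p ∈ S, θ p ^ 2 := Finset.sum_nonneg fun _ _ => sq_nonneg _
  set Θ := ∑ p ∈ S, θ p ^ 2 with hΘdef
  have hx : 0 ≤ (m : ℝ) / n * Real.exp (-(κ₀ * m)) := by positivity
  -- Either the signal is small enough for the Chernoff bound, or m/n is at most a multiple of Θ and
  -- the crude bound already has oracle size.
  by_cases hθ : Θ ≤ ε ^ 2 * (m / n)
  · have h1 : ∀ ω, ENNReal.ofReal (∑ p ∈ S,
        (jsFactor n lam m (∑ q ∈ S, (θ q + 1 / √(n : ℝ) * z q ω) ^ 2) *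
          (θ p + 1 / √(n : ℝ) * z p ω) - θ p) ^ 2) =
        ∑ p ∈ S, ENNReal.ofReal ((jsFactor n lam m (∑ q ∈ S, (θ q + 1 / √(n : ℝ) * z q ω) ^ 2) *
          (θ p + 1 / √(n : ℝ) * z p ω) - θ p) ^ 2) :=
      fun ω => ENNReal.ofReal_sum_of_nonneg fun _ _ => sq_nonneg _
    simp_rw [h1]
    have hzm := hz.1
    rw [lintegral_finsetSum _ fun p _ => by
      unfold jsFactor
      fun_prop]
    refine (Finset.sum_le_sum fun p hp => lintegral_jsFactor_le_of_small hz hn hlam_gt ha hε haε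
      hκ' hS hm hθ hp).trans ?_
    rw [← ENNReal.ofReal_sum_of_nonneg fun p _ => by positivity]
    refine ENNReal.ofReal_le_ofReal ?_
    rw [Finset.sum_add_distrib, ← Finset.mul_sum, ← hΘdef, Finset.sum_const, nsmul_eq_mul]
    have h2 : (S.card : ℝ) * (2 * lam * (Real.exp (-(κ₀ * m)) / n)) ≤
        m * (2 * lam * (Real.exp (-(κ₀ * m)) / n)) := by gcongr
    have h3 : (m : ℝ) * (2 * lam * (Real.exp (-(κ₀ * m)) / n)) =
        2 * lam * (m / n * Real.exp (-(κ₀ * m))) := by ring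
    have h4 : 2 * Θ ≤ (2 + 2 * ε ^ 2) * min Θ (m / n) := by
      rcases min_cases Θ ((m : ℝ) / n) with ⟨h, _⟩ | ⟨h, _⟩ <;> rw [h]
      · nlinarith [sq_nonneg ε]
      · nlinarith
    have hmin : 0 ≤ min Θ ((m : ℝ) / n) := le_min hΘ hr
    have h5 : 0 ≤ (2 * lam + 2) / ε ^ 2 := by positivity
    nlinarith [sq_nonneg ε, mul_nonneg h5 hmin, mul_nonneg h5 hx, mul_nonneg (sq_nonneg ε) hmin,
      mul_nonneg (sq_nonneg ε) hx, mul_nonneg hlam0.le hmin, mul_nonneg hlam0.le hx]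
  · push Not at hθ
    refine (lintegral_sum_jsFactor_le hz hn hlam0.le hS hm θ).trans (ENNReal.ofReal_le_ofReal ?_)
    have h4 : (2 * lam + 2) * (m / n) ≤ ((2 * lam + 2) + (2 * lam + 2) / ε ^ 2) *
        min Θ (m / n) := by
      rcases min_cases Θ ((m : ℝ) / n) with ⟨h, _⟩ | ⟨h, _⟩ <;> rw [h]
      · have h6 : (m : ℝ) / n ≤ Θ / ε ^ 2 := by
          rw [le_div_iff₀ (by positivity)]; linarith
        calc (2 * lam + 2) * ((m : ℝ) / n) ≤ (2 * lam + 2) * (Θ / ε ^ 2) := by gcongr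
          _ = (2 * lam + 2) / ε ^ 2 * Θ := by ring
          _ ≤ _ := by
            have : 0 ≤ (2 * lam + 2) * Θ := by positivity
            linarith
      · have : 0 ≤ (2 * lam + 2) / ε ^ 2 * ((m : ℝ) / n) := by positivity
        linarith
    have hmin : 0 ≤ min Θ ((m : ℝ) / n) := le_min hΘ hr
    have h5 : 0 ≤ (2 * lam + 2) / ε ^ 2 := by positivity
    nlinarith [sq_nonneg ε, mul_nonneg h5 hmin, mul_nonneg h5 hx, mul_nonneg (sq_nonneg ε) hmin,
      mul_nonneg (sq_nonneg ε) hx, mul_nonneg hlam0.le hmin, mul_nonneg hlam0.le hx]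

/-- The mean squared error of the James–Stein rule at a single coefficient. -/
lemma exists_lintegral_jsFactor_le {lam κ₀ : ℝ} (hlam_gt : 1 < lam)
    (hlam : lam - Real.log lam - 1 = 2) (hκ : κ₀ < 1) :
    ∃ C : ℝ, 0 < C ∧ ∀ {Ω : Type*} [MeasurableSpace Ω] {P : Measure Ω} [IsProbabilityMeasure P]
      {κ : Type*} {z : κ → Ω → ℝ} {I : Set κ} (_ : StdNormalMoments P z I) {n : ℕ} (_ : 0 < n)
      {m : ℕ} (_ : 1 ≤ m) {S : Finset κ} (_ : (S : Set κ) ⊆ I) (_ : S.card ≤ m) {θ : κ → ℝ} {T : ℝ}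
      (_ : ∀ q ∈ S, θ q ^ 2 ≤ T) {p : κ} (_ : p ∈ S),
      ∫⁻ ω, ENNReal.ofReal ((jsFactor n lam m (∑ q ∈ S, (θ q + 1 / √(n : ℝ) * z q ω) ^ 2) *
          (θ p + 1 / √(n : ℝ) * z p ω) - θ p) ^ 2) ∂P ≤
      ENNReal.ofReal (C * (min T (m / n) + Real.exp (-(κ₀ * m)) / n)) := by
  obtain ⟨a, ε, ha, hε, haε, hκ'⟩ := exists_split_threshold hlam_gt hlam hκ
  have hlam0 : 0 < lam := by linarith
  refine ⟨2 + 2 * ε ^ 2 + 2 / ε ^ 2 + (2 * lam + 2), by positivity, ?_⟩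
  intro Ω _ P _ κ z I hz n hn m hm1 S hS hm θ T hT p hp
  have hn' : (0 : ℝ) < n := by exact_mod_cast hn
  have hm1' : (1 : ℝ) ≤ m := by exact_mod_cast hm1
  have hr : 0 ≤ (m : ℝ) / n := by positivity
  have hrn : 1 / (n : ℝ) ≤ m / n := by gcongr
  have hT0 : 0 ≤ T := (sq_nonneg _).trans (hT p hp)
  have hx : 0 ≤ Real.exp (-(κ₀ * m)) / (n : ℝ) := by positivity
  have hmin : 0 ≤ min T ((m : ℝ) / n) := le_min hT0 hr
  have h5 : 0 ≤ 2 / ε ^ 2 := by positivity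
  -- T bounds each of at most m coefficients, so T ≤ ε²/n makes the whole block small. Otherwise 1/n
  -- is at most a multiple of T, and the bound 2θ² + 2/n is of order T.
  by_cases hθ : T ≤ ε ^ 2 * (1 / n)
  · have hΘ : ∑ q ∈ S, θ q ^ 2 ≤ ε ^ 2 * (m / n) := by
      calc ∑ q ∈ S, θ q ^ 2 ≤ S.card • T := Finset.sum_le_card_nsmul _ _ _ hT
        _ = S.card * T := nsmul_eq_mul _ _
        _ ≤ m * (ε ^ 2 * (1 / n)) := by gcongr
        _ = _ := by ring
    refine (lintegral_jsFactor_le_of_small hz hn hlam_gt ha hε haε hκ' hS hm hΘ hp).trans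
      (ENNReal.ofReal_le_ofReal ?_)
    have h4 : 2 * T ≤ (2 + 2 * ε ^ 2) * min T (m / n) := by
      rcases min_cases T ((m : ℝ) / n) with ⟨h, _⟩ | ⟨h, _⟩ <;> rw [h]
      · nlinarith [sq_nonneg ε]
      · nlinarith [sq_nonneg ε]
    have := hT p hp
    nlinarith [mul_nonneg h5 hmin, mul_nonneg h5 hx, mul_nonneg (sq_nonneg ε) hx,
      mul_nonneg hlam0.le hmin, mul_nonneg hlam0.le hx]
  · push Not at hθ
    have h1 : 1 / (n : ℝ) ≤ T / ε ^ 2 := by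
      rw [le_div_iff₀ (by positivity)]; linarith
    have hrest : ∀ b : ℝ, 0 ≤ b → b ≤ 2 + 2 * ε ^ 2 + 2 / ε ^ 2 + (2 * lam + 2) →
        b * min T (m / n) ≤ (2 + 2 * ε ^ 2 + 2 / ε ^ 2 + (2 * lam + 2)) *
          (min T (m / n) + Real.exp (-(κ₀ * m)) / n) := by
      intro b _ hb
      have : 0 ≤ 2 + 2 * ε ^ 2 + 2 / ε ^ 2 + (2 * lam + 2) := by positivity
      nlinarith [mul_le_mul_of_nonneg_right hb hmin, mul_nonneg this hx]
    rcases min_cases T ((m : ℝ) / n) with ⟨h, _⟩ | ⟨h, _⟩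
    · refine (lintegral_jsFactor_le hz hn hlam0.le hS θ hp).trans (ENNReal.ofReal_le_ofReal
        (le_trans ?_ (hrest (2 + 2 / ε ^ 2) (by positivity) (by nlinarith [sq_nonneg ε]))))
      rw [h]
      have := hT p hp
      calc 2 * θ p ^ 2 + 2 / (n : ℝ) = 2 * θ p ^ 2 + 2 * (1 / (n : ℝ)) := by ring
        _ ≤ 2 * T + 2 * (T / ε ^ 2) := by gcongr
        _ = _ := by ring
    · refine le_trans (lintegral_mono fun ω => ENNReal.ofReal_le_ofReal ?_)
        ((lintegral_sum_jsFactor_le hz hn hlam0.le hS hm θ).trans (ENNReal.ofReal_le_ofReal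
        (le_trans ?_ (hrest (2 * lam + 2) (by positivity) (by nlinarith [sq_nonneg ε])))))
      · exact Finset.single_le_sum (f := fun p => (jsFactor n lam m
          (∑ q ∈ S, (θ q + 1 / √(n : ℝ) * z q ω) ^ 2) *
          (θ p + 1 / √(n : ℝ) * z p ω) - θ p) ^ 2) (fun _ _ => sq_nonneg _) hp
      · rw [h]

/-- The mean squared error of soft thresholding. -/
lemma exists_lintegral_softThreshold_le {κ₀ : ℝ} (hκ0 : 0 < κ₀) (hκ : κ₀ < 1) :
    ∃ C : ℝ, 0 < C ∧ ∀ {Ω : Type*} [MeasurableSpace Ω] {P : Measure Ω} [IsProbabilityMeasure P]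
      {κ : Type*} {z : κ → Ω → ℝ} {I : Set κ} (_ : StdNormalMoments P z I) {n : ℕ}
      (_ : 1 ≤ Real.log n) {p : κ} (_ : p ∈ I) {θ T : ℝ} (_ : θ ^ 2 ≤ T),
      ∫⁻ ω, ENNReal.ofReal ((softThreshold n (θ + 1 / √(n : ℝ) * z p ω) - θ) ^ 2) ∂P ≤
      ENNReal.ofReal (C * (min T (Real.log n / n) + Real.exp (-(κ₀ * Real.log n)) / n)) := by
  -- With tilt 1 - v⁻¹ = u and margin b² = u, the Chernoff exponent is (u/2) · b² · 2 log n = u² log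
  -- n = κ₀ log n.
  set u := √κ₀ with hu
  have hu0 : 0 < u := Real.sqrt_pos.2 hκ0
  have hu1 : u < 1 := by rw [hu, Real.sqrt_lt' one_pos]; linarith
  set b := √u with hb
  have hb0 : 0 < b := Real.sqrt_pos.2 hu0
  have hb1 : b < 1 := by rw [hb, Real.sqrt_lt' one_pos]; linarith
  have hbsq : b ^ 2 = u := Real.sq_sqrt hu0.le
  have husq : u * u = κ₀ := Real.mul_self_sqrt hκ0.le
  set v := (1 - u)⁻¹ with hv
  have hv0 : 0 < v := inv_pos.2 (by linarith)
  have hvinv : 1 - v⁻¹ = u := by rw [hv, inv_inv]; ring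
  have hb' : 0 < 1 - b := by linarith
  refine ⟨6 + 3 / (1 - b) ^ 2 + 2 * (v * √v), by positivity, ?_⟩
  intro Ω _ P _ κ z I hz n hlog p hp θ T hT
  have hn : 0 < n := by
    rcases Nat.eq_zero_or_pos n with rfl | h
    · norm_num at hlog
    · exact h
  have hn' : (0 : ℝ) < n := by exact_mod_cast hn
  have hT0 : 0 ≤ T := (sq_nonneg _).trans hT
  have hr : 0 ≤ Real.log n / (n : ℝ) := by positivity
  have hx : 0 ≤ Real.exp (-(κ₀ * Real.log n)) / (n : ℝ) := by positivity
  have hmin : 0 ≤ min T (Real.log n / (n : ℝ)) := le_min hT0 hr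
  have hτ : √(2 * (n : ℝ)⁻¹ * Real.log n) ^ 2 = 2 * (Real.log n / n) := by
    rw [Real.sq_sqrt (by positivity)]; ring
  have h5 : 0 ≤ 3 / (1 - b) ^ 2 := by positivity
  have h6 : 0 ≤ 2 * (v * √v) := by positivity
  by_cases hθ : |θ| ≤ (1 - b) * √(2 * (n : ℝ)⁻¹ * Real.log n)
  · have hE := (hz.2 v hv0 {p} (by simpa using hp) p (by simp)).le
    simp only [Finset.sum_singleton, Finset.card_singleton, pow_one] at hE
    refine (lintegral_ofReal_le_of_le (c := 2 * θ ^ 2)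
      (d := 2 / n * Real.exp (-((1 - v⁻¹) / 2 * (b ^ 2 * (2 * Real.log n)))))
      (by positivity) (by positivity) (by positivity)
      (fun ω => (softThreshold_sq_le_of_small (s := (1 - v⁻¹) / 2) hn hb0.le
        (by rw [hvinv]; positivity) hθ).trans
        (le_of_eq (by rw [mul_assoc])))
      (fun ω => by positivity) hE).trans (ENNReal.ofReal_le_ofReal ?_)
    have h1 : (1 - v⁻¹) / 2 * (b ^ 2 * (2 * Real.log n)) = κ₀ * Real.log n := by
      rw [hvinv, hbsq, ← husq]; ring
    rw [h1]
    have h2 : θ ^ 2 ≤ 2 * (Real.log n / n) := by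
      rw [← hτ, ← sq_abs θ]
      refine pow_le_pow_left₀ (abs_nonneg _) (hθ.trans ?_) 2
      exact mul_le_of_le_one_left (Real.sqrt_nonneg _) (by linarith)
    have h3 : 2 * θ ^ 2 ≤ 4 * min T (Real.log n / n) := by
      rcases min_cases T (Real.log n / (n : ℝ)) with ⟨h, _⟩ | ⟨h, _⟩ <;> rw [h] <;> linarith
    have h4 : 2 / (n : ℝ) * Real.exp (-(κ₀ * Real.log n)) * (v * √v) =
        2 * (v * √v) * (Real.exp (-(κ₀ * Real.log n)) / n) := by ring
    nlinarith [mul_nonneg h5 hmin, mul_nonneg h5 hx, mul_nonneg h6 hmin]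
  · push Not at hθ
    have h1 : (1 - b) ^ 2 * (2 * (Real.log n / n)) ≤ θ ^ 2 := by
      rw [← hτ, ← mul_pow, ← sq_abs θ]
      exact pow_le_pow_left₀ (by positivity) hθ.le 2
    refine (lintegral_ofReal_le_of_le (c := 2 * (2 * (Real.log n / n))) (d := 2 / n) (e := 1)
      (g := fun ω => z p ω ^ 2) (by positivity) (by positivity) (by positivity)
      (fun ω => ?_) (fun ω => sq_nonneg _)
      (by simpa using (hz.lintegral_sq hp).le)).trans (ENNReal.ofReal_le_ofReal ?_)
    · refine (softThreshold_sq_le n _ _).trans (le_of_eq ?_)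
      rw [hτ]
      simp only [add_sub_cancel_left, mul_pow, div_pow, one_pow, Real.sq_sqrt hn'.le]
      ring
    · have h2 : 2 / (n : ℝ) * 1 ≤ 2 * (Real.log n / n) := by
        rw [mul_one, ← mul_div_assoc]
        gcongr
        linarith
      have h3 : Real.log n / (n : ℝ) ≤ (1 / 2) * (T / (1 - b) ^ 2) := by
        rw [← mul_div_assoc, le_div_iff₀ (by positivity)]
        linarith
      have h4 : 6 * (Real.log n / n) ≤ (6 + 3 / (1 - b) ^ 2) * min T (Real.log n / n) := by
        rcases min_cases T (Real.log n / (n : ℝ)) with ⟨h, _⟩ | ⟨h, _⟩ <;> rw [h]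
        · have : 3 / (1 - b) ^ 2 * T = 3 * (T / (1 - b) ^ 2) := by ring
          nlinarith
        · nlinarith [mul_nonneg h5 hr]
      nlinarith [mul_nonneg h5 hmin, mul_nonneg h5 hx, mul_nonneg h6 hmin, mul_nonneg h6 hx]

end

section

/-! ### Size and support of the basis functions -/

namespace EdgeFamily

variable {G : EdgeFamily} {j₀ : ℕ}

/-- The left end of an interval containing the support of `G.fn j k`. -/
def lo (G : EdgeFamily) (j₀ j k : ℕ) : ℝ :=
  if k ≤ G.nL then 0
  else if k + G.nR ≤ 2 ^ j then ((k : ℝ) - (G.nL + 1)) / 2 ^ j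
  else 1 - 2 ^ j₀ / 2 ^ j

/-- The length of the supports at level `0`. -/
def width (G : EdgeFamily) (j₀ : ℕ) : ℝ := 2 ^ j₀ + G.nL + G.nR + 1

lemma width_pos (G : EdgeFamily) (j₀ : ℕ) : 0 < G.width j₀ := by unfold width; positivity

lemma right_index_mem (G : EdgeFamily) {j k : ℕ} (hk : k ∈ Finset.Icc 1 (2 ^ j))
    (h2 : ¬k + G.nR ≤ 2 ^ j) : 2 ^ j + 1 - k ∈ Finset.Icc 1 G.nR := by
  rw [Finset.mem_Icc] at hk ⊢
  omega

lemma eq_zero_of_notMem_Icc {g : ℝ → ℝ} {u v t : ℝ} (hg : tsupport g ⊆ Icc u v)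
    (ht : t ∉ Icc u v) : g t = 0 := image_eq_zero_of_notMem_tsupport fun h => ht (hg h)

lemma Fits.lo_mem (_ : G.Fits j₀) {j k : ℕ} (hj : j₀ ≤ j) (hk : k ∈ Finset.Icc 1 (2 ^ j)) :
    G.lo j₀ j k ∈ Icc (0 : ℝ) 1 := by
  have hN : (0 : ℝ) < 2 ^ j := by positivity
  have hNN : (2 : ℝ) ^ j₀ ≤ 2 ^ j := pow_le_pow_right₀ (by norm_num) hj
  rw [Finset.mem_Icc] at hk
  unfold lo
  split_ifs with h1 h2
  · simp
  · have h3 : (G.nL : ℝ) + 1 ≤ k := by exact_mod_cast (by omega : G.nL + 1 ≤ k)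
    have h4 : (k : ℝ) ≤ 2 ^ j := by exact_mod_cast hk.2
    exact ⟨div_nonneg (by linarith) hN.le, (div_le_one hN).2 (by
      have : (0 : ℝ) ≤ G.nL := Nat.cast_nonneg _
      linarith)⟩
  · have h3 : (2 : ℝ) ^ j₀ / 2 ^ j ≤ 1 := (div_le_one hN).2 hNN
    have h4 : (0 : ℝ) ≤ 2 ^ j₀ / 2 ^ j := by positivity
    constructor <;> linarith

/-- One width serves all three kinds of functions: it covers nL + nR + 1 for the interior and 2^{j₀}
for the edges. -/
lemma Fits.tsupport_fn_subset (hG : G.Fits j₀) {j k : ℕ} (hk : k ∈ Finset.Icc 1 (2 ^ j)) :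
    tsupport (G.fn j k) ⊆ Icc (G.lo j₀ j k) (G.lo j₀ j k + G.width j₀ / 2 ^ j) := by
  have hN : (0 : ℝ) < 2 ^ j := by positivity
  have hL : (0 : ℝ) ≤ G.nL := Nat.cast_nonneg _
  have hR : (0 : ℝ) ≤ G.nR := Nat.cast_nonneg _
  have h0 : (0 : ℝ) ≤ 2 ^ j₀ := by positivity
  refine closure_minimal (fun t ht => ?_) isClosed_Icc
  by_contra hnot
  apply ht
  have key : ∀ a : ℝ, (2 : ℝ) ^ j * G.lo j₀ j k = a →
      (2 : ℝ) ^ j * t < a ∨ a + G.width j₀ < 2 ^ j * t := by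
    intro a ha
    rw [mem_Icc, not_and_or, not_le, not_le] at hnot
    rcases hnot with h | h
    · left
      rw [← ha]
      exact mul_lt_mul_of_pos_left h hN
    · right
      have := mul_lt_mul_of_pos_left h hN
      rw [mul_add, mul_div_cancel₀ _ hN.ne', ha] at this
      exact this
  unfold width at key
  unfold fn
  by_cases h1 : k ≤ G.nL
  · rw [if_pos h1]
    have h3 := key 0 (by simp [lo, h1])
    rw [eq_zero_of_notMem_Icc (hG.left k (Finset.mem_Icc.2 ⟨(Finset.mem_Icc.1 hk).1, h1⟩)),
      mul_zero]
    rintro ⟨h4, h5⟩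
    rcases h3 with h3 | h3 <;> linarith
  · by_cases h2 : k + G.nR ≤ 2 ^ j
    · rw [if_neg h1, if_pos h2]
      have h3 := key ((k : ℝ) - (G.nL + 1)) (by
        rw [lo, if_neg h1, if_pos h2, mul_div_cancel₀ _ hN.ne'])
      rw [eq_zero_of_notMem_Icc hG.mother, mul_zero]
      rintro ⟨h4, h5⟩
      rcases h3 with h3 | h3 <;> linarith
    · rw [if_neg h1, if_neg h2]
      have h3 := key (2 ^ j - 2 ^ j₀) (by
        rw [lo, if_neg h1, if_neg h2, mul_sub, mul_div_cancel₀ _ hN.ne', mul_one])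
      rw [eq_zero_of_notMem_Icc (hG.right _ (G.right_index_mem hk h2)), mul_zero]
      rintro ⟨h4, h5⟩
      rcases h3 with h3 | h3 <;> linarith

lemma Smooth.continuousOn_fn {r : ℕ} (hs : G.Smooth r) {j k : ℕ} (hk : k ∈ Finset.Icc 1 (2 ^ j)) :
    ContinuousOn (G.fn j k) (Icc 0 1) := by
  have hN : (0 : ℝ) < 2 ^ j := by positivity
  by_cases h1 : k ≤ G.nL
  · have h2 := (hs.left k (Finset.mem_Icc.2 ⟨(Finset.mem_Icc.1 hk).1, h1⟩)).continuousOn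
    have h3 : ContinuousOn (fun t : ℝ => √(2 ^ j : ℝ) * G.left k (2 ^ j * t)) (Icc 0 1) := by
      refine continuousOn_const.mul (h2.comp (by fun_prop) fun t ht => ?_)
      exact mul_nonneg hN.le ht.1
    refine h3.congr fun t _ => ?_
    simp [fn, h1]
  · by_cases h2 : k + G.nR ≤ 2 ^ j
    · have h3 := hs.mother.continuous
      have h4 : Continuous fun t : ℝ => √(2 ^ j : ℝ) * G.mother (2 ^ j * t - k) := by fun_prop
      refine h4.continuousOn.congr fun t _ => ?_
      simp [fn, h1, h2]
    · have h3 := (hs.right _ (G.right_index_mem hk h2)).continuousOn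
      have h4 : ContinuousOn (fun t : ℝ => √(2 ^ j : ℝ) * G.right (2 ^ j + 1 - k) (2 ^ j * (t - 1)))
          (Icc 0 1) := by
        refine continuousOn_const.mul (h3.comp (by fun_prop) fun t ht => ?_)
        exact mul_nonpos_of_nonneg_of_nonpos hN.le (by linarith [ht.2])
      refine h4.congr fun t _ => ?_
      simp [fn, h1, h2]

lemma exists_bound_of_tsupport_subset {g : ℝ → ℝ} {D : Set ℝ} (hD : IsClosed D)
    (hg : ContinuousOn g D) {u v : ℝ} (hs : tsupport g ⊆ Icc u v) :
    ∃ K : ℝ, ∀ t ∈ D, |g t| ≤ K := by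
  have hc : IsCompact (Icc u v ∩ D) := isCompact_Icc.inter_right hD
  obtain ⟨K, hK⟩ := hc.exists_bound_of_continuousOn (hg.mono inter_subset_right)
  refine ⟨max K 0, fun t ht => ?_⟩
  by_cases h : t ∈ Icc u v
  · exact (hK t ⟨h, ht⟩).trans (le_max_left _ _)
  · rw [eq_zero_of_notMem_Icc hs h, abs_zero]
    exact le_max_right _ _

/-- Up to dilation only finitely many functions occur, each continuous with compact support on its
domain. Their separate bounds are simply added. -/
lemma exists_abs_fn_le {r : ℕ} (hG : G.Fits j₀) (hs : G.Smooth r) :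
    ∃ K : ℝ, 0 < K ∧ ∀ j, ∀ k ∈ Finset.Icc 1 (2 ^ j), ∀ t ∈ Icc (0 : ℝ) 1,
      |G.fn j k t| ≤ K * √(2 ^ j : ℝ) := by
  obtain ⟨K₁, hK₁⟩ := exists_bound_of_tsupport_subset isClosed_univ
    hs.mother.continuous.continuousOn hG.mother
  have h2 : ∀ k, ∃ K : ℝ, k ∈ Finset.Icc 1 G.nL → ∀ t ∈ Ici (0 : ℝ), |G.left k t| ≤ K := by
    intro k
    by_cases hk : k ∈ Finset.Icc 1 G.nL
    · obtain ⟨K, hK⟩ := exists_bound_of_tsupport_subset isClosed_Ici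
        (hs.left k hk).continuousOn (hG.left k hk)
      exact ⟨K, fun _ => hK⟩
    · exact ⟨0, fun h => absurd h hk⟩
  have h3 : ∀ k, ∃ K : ℝ, k ∈ Finset.Icc 1 G.nR → ∀ t ∈ Iic (0 : ℝ), |G.right k t| ≤ K := by
    intro k
    by_cases hk : k ∈ Finset.Icc 1 G.nR
    · obtain ⟨K, hK⟩ := exists_bound_of_tsupport_subset isClosed_Iic
        (hs.right k hk).continuousOn (hG.right k hk)
      exact ⟨K, fun _ => hK⟩
    · exact ⟨0, fun h => absurd h hk⟩
  choose KL hKL using h2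
  choose KR hKR using h3
  set SL := ∑ k ∈ Finset.Icc 1 G.nL, |KL k| with hSL
  set SR := ∑ k ∈ Finset.Icc 1 G.nR, |KR k| with hSR
  have hSL0 : 0 ≤ SL := Finset.sum_nonneg fun _ _ => abs_nonneg _
  have hSR0 : 0 ≤ SR := Finset.sum_nonneg fun _ _ => abs_nonneg _
  have hK1 := abs_nonneg K₁
  refine ⟨|K₁| + SL + SR + 1, by linarith, fun j k hk t ht => ?_⟩
  have hN : (0 : ℝ) < 2 ^ j := by positivity
  have hfin : ∀ y : ℝ, |y| ≤ |K₁| + SL + SR + 1 →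
      |√(2 ^ j : ℝ) * y| ≤ (|K₁| + SL + SR + 1) * √(2 ^ j : ℝ) := by
    intro y hy
    rw [abs_mul, abs_of_nonneg (Real.sqrt_nonneg _), mul_comm]
    gcongr
  unfold fn
  by_cases h1 : k ≤ G.nL
  · rw [if_pos h1]
    refine hfin _ ?_
    have hk' : k ∈ Finset.Icc 1 G.nL := Finset.mem_Icc.2 ⟨(Finset.mem_Icc.1 hk).1, h1⟩
    have h4 := hKL k hk' (2 ^ j * t) (mul_nonneg hN.le ht.1)
    have h5 : |KL k| ≤ SL := Finset.single_le_sum (f := fun k => |KL k|)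
      (fun _ _ => abs_nonneg _) hk'
    linarith [le_abs_self (KL k)]
  · by_cases h2 : k + G.nR ≤ 2 ^ j
    · rw [if_neg h1, if_pos h2]
      refine hfin _ ?_
      have := hK₁ (2 ^ j * t - k) (mem_univ _)
      linarith [le_abs_self K₁]
    · rw [if_neg h1, if_neg h2]
      refine hfin _ ?_
      have hk' := G.right_index_mem hk h2
      have h4 := hKR _ hk' (2 ^ j * (t - 1))
        (mul_nonpos_of_nonneg_of_nonpos hN.le (by linarith [ht.2]))
      have h5 : |KR (2 ^ j + 1 - k)| ≤ SR := Finset.single_le_sum (f := fun k => |KR k|)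
        (fun _ _ => abs_nonneg _) hk'
      linarith [le_abs_self (KR (2 ^ j + 1 - k))]

/-! ### Vanishing moments -/

lemma integrableOn_pow_mul {g : ℝ → ℝ} {D : Set ℝ} (hD : IsClosed D)
    (hg : ContinuousOn g D) {u v : ℝ} (hs : tsupport g ⊆ Icc u v) (i : ℕ) :
    IntegrableOn (fun t => t ^ i * g t) D := by
  have hc : IsCompact (Icc u v ∩ D) := isCompact_Icc.inter_right hD
  have h1 : IntegrableOn (fun t => t ^ i * g t) (Icc u v ∩ D) :=
    ContinuousOn.integrableOn_compact hc
      (((continuous_pow i).continuousOn).mul (hg.mono inter_subset_right))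
  refine h1.of_forall_sdiff_eq_zero hD.measurableSet fun t ht => ?_
  rw [eq_zero_of_notMem_Icc hs fun h => ht.2 ⟨h, ht.1⟩, mul_zero]

/-- An affine substitution does not raise the degree of a polynomial, so the moments vanish at every
scale and location. -/
lemma integral_eval_mul_comp_eq_zero {h : ℝ → ℝ} {r : ℕ}
    (hint : ∀ i < r, Integrable fun t => t ^ i * h t) (hzero : ∀ i < r, ∫ t, t ^ i * h t = 0)
    {p : Polynomial ℝ} (hp : p.natDegree < r) {N : ℝ} (hN : N ≠ 0) (a : ℝ) :
    ∫ t, p.eval t * h (N * (t - a)) = 0 := by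
  set q := p.comp (Polynomial.C N⁻¹ * Polynomial.X + Polynomial.C a) with hq
  have hqdeg : q.natDegree < r := by
    refine lt_of_le_of_lt Polynomial.natDegree_comp_le ?_
    refine lt_of_le_of_lt (Nat.mul_le_mul_left _ (Polynomial.natDegree_linear_le)) ?_
    simpa using hp
  have h1 : ∀ t, p.eval t * h (N * (t - a)) = (fun u => q.eval u * h u) (N * (t - a)) := by
    intro t
    simp only [hq, Polynomial.eval_comp, Polynomial.eval_add, Polynomial.eval_mul,
      Polynomial.eval_C, Polynomial.eval_X]
    rw [inv_mul_cancel_left₀ hN, sub_add_cancel]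
  have h2 : ∫ u, q.eval u * h u = 0 := by
    have h3 : ∀ u, q.eval u * h u =
        ∑ i ∈ Finset.range (q.natDegree + 1), q.coeff i * (u ^ i * h u) := by
      intro u
      rw [Polynomial.eval_eq_sum_range, Finset.sum_mul]
      exact Finset.sum_congr rfl fun i _ => by ring
    simp_rw [h3]
    have hlt : ∀ i ∈ Finset.range (q.natDegree + 1), i < r := fun i hi => by
      have := Finset.mem_range.1 hi; omega
    rw [integral_finsetSum _ fun i hi => (hint i (hlt i hi)).const_mul _]
    refine Finset.sum_eq_zero fun i hi => ?_
    rw [integral_const_mul, hzero i (hlt i hi), mul_zero]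
  simp_rw [h1]
  rw [integral_sub_right_eq_self (fun t => (fun u => q.eval u * h u) (N * t)) a,
    Measure.integral_comp_mul_left (fun u => q.eval u * h u) N, h2, smul_zero]

lemma Fits.integral_eval_mul_fn_eq_zero {r : ℕ} (hG : G.Fits j₀) (hs : G.Smooth r)
    (hm : G.VanishingMoments r) {j k : ℕ} (hj : j₀ ≤ j) (hk : k ∈ Finset.Icc 1 (2 ^ j))
    {p : Polynomial ℝ} (hp : p.natDegree < r) :
    ∫ t in Icc (0 : ℝ) 1, p.eval t * G.fn j k t = 0 := by
  have hN : (0 : ℝ) < 2 ^ j := by positivity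
  have hNN : (2 : ℝ) ^ j₀ ≤ 2 ^ j := pow_le_pow_right₀ (by norm_num) hj
  -- All three kinds of functions are dilates of some g on a closed set D, based at a. The last two
  -- hypotheses say that the dilate of g cut off outside D vanishes off [0, 1], so the integral over
  -- [0, 1] is one over the whole line.
  have main : ∀ (g : ℝ → ℝ) (D : Set ℝ) (a u v : ℝ), IsClosed D → ContinuousOn g D →
      tsupport g ⊆ Icc u v → (∀ i < r, ∫ t in D, t ^ i * g t = 0) →
      (∀ t, t ∈ Icc (0 : ℝ) 1 → 2 ^ j * (t - a) ∈ D ∧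
        G.fn j k t = √(2 ^ j : ℝ) * g (2 ^ j * (t - a))) →
      (∀ t, t ∉ Icc (0 : ℝ) 1 → 2 ^ j * (t - a) ∉ D ∨ 2 ^ j * (t - a) ∉ Icc u v) →
      ∫ t in Icc (0 : ℝ) 1, p.eval t * G.fn j k t = 0 := by
    intro g D a u v hD hg hsupp hmom hin hout
    have hind : ∀ i, (fun t => t ^ i * D.indicator g t) = D.indicator fun t => t ^ i * g t := by
      intro i
      ext t
      by_cases ht : t ∈ D <;> simp [ht]
    have h1 := integral_eval_mul_comp_eq_zero (h := D.indicator g) (r := r) (p := p)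
      (fun i _ => by
        rw [hind]
        exact (integrableOn_pow_mul hD hg hsupp i).integrable_indicator hD.measurableSet)
      (fun i hi => by rw [hind, integral_indicator hD.measurableSet, hmom i hi]) hp hN.ne' a
    rw [← integral_indicator measurableSet_Icc]
    have h2 : ∀ t, (Icc (0 : ℝ) 1).indicator (fun t => p.eval t * G.fn j k t) t =
        √(2 ^ j : ℝ) * (p.eval t * D.indicator g (2 ^ j * (t - a))) := by
      intro t
      by_cases ht : t ∈ Icc (0 : ℝ) 1
      · obtain ⟨h3, h4⟩ := hin t ht
        rw [indicator_of_mem ht, indicator_of_mem h3, h4]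
        ring
      · rw [indicator_of_notMem ht]
        rcases hout t ht with h3 | h3
        · rw [indicator_of_notMem h3, mul_zero, mul_zero]
        · have : D.indicator g (2 ^ j * (t - a)) = 0 := by
            classical
            rw [indicator_apply, eq_zero_of_notMem_Icc hsupp h3, ite_self]
          rw [this, mul_zero, mul_zero]
    simp_rw [h2]
    rw [integral_const_mul, h1, mul_zero]
  by_cases h1 : k ≤ G.nL
  · have hk' : k ∈ Finset.Icc 1 G.nL := Finset.mem_Icc.2 ⟨(Finset.mem_Icc.1 hk).1, h1⟩
    refine main (G.left k) (Ici 0) 0 _ _ isClosed_Ici (hs.left k hk').continuousOn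
      (hG.left k hk') (hm.left k hk') (fun t ht => ⟨?_, ?_⟩) fun t ht => ?_
    · rw [sub_zero]; exact mul_nonneg hN.le ht.1
    · simp [fn, h1]
    · rw [sub_zero]
      rw [mem_Icc, not_and_or, not_le, not_le] at ht
      rcases ht with ht | ht
      · left
        exact not_le.2 (mul_neg_of_pos_of_neg hN ht)
      · right
        rintro ⟨_, h3⟩
        nlinarith
  · by_cases h2 : k + G.nR ≤ 2 ^ j
    · have hmul : ∀ t : ℝ, 2 ^ j * (t - k / 2 ^ j) = 2 ^ j * t - k := fun t => by
        rw [mul_sub, mul_div_cancel₀ _ hN.ne']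
      refine main G.mother univ (k / 2 ^ j) _ _ isClosed_univ hs.mother.continuous.continuousOn
        hG.mother (by simpa using hm.mother) (fun t ht => ⟨mem_univ _, ?_⟩) fun t ht => ?_
      · simp [fn, h1, h2, hmul]
      · right
        rw [hmul]
        rintro ⟨h3, h4⟩
        have h5 : (G.nL : ℝ) + 1 ≤ k := by exact_mod_cast (by omega : G.nL + 1 ≤ k)
        have h6 : (k : ℝ) + G.nR ≤ 2 ^ j := by exact_mod_cast h2
        rw [mem_Icc, not_and_or, not_le, not_le] at ht
        rcases ht with ht | ht <;> nlinarith
    · have hk' := G.right_index_mem hk h2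
      refine main (G.right (2 ^ j + 1 - k)) (Iic 0) 1 _ _ isClosed_Iic
        (hs.right _ hk').continuousOn (hG.right _ hk') (hm.right _ hk')
        (fun t ht => ⟨?_, ?_⟩) fun t ht => ?_
      · exact mul_nonpos_of_nonneg_of_nonpos hN.le (by linarith [ht.2])
      · simp [fn, h1, h2]
      · rw [mem_Icc, not_and_or, not_le, not_le] at ht
        rcases ht with ht | ht
        · right
          rintro ⟨h3, _⟩
          nlinarith
        · left
          exact not_le.2 (mul_pos hN (by linarith))

end EdgeFamily

end

section

/-! ### Polynomial approximation in Hölder classes -/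

lemma exists_polynomial_derivative_eq (q : Polynomial ℝ) (a c : ℝ) :
    ∃ p : Polynomial ℝ, p.natDegree ≤ q.natDegree + 1 ∧ p.derivative = q ∧ p.eval a = c := by
  set p₀ := ∑ i ∈ Finset.range (q.natDegree + 1),
    Polynomial.monomial (i + 1) (q.coeff i / (i + 1)) with hp₀
  refine ⟨p₀ + Polynomial.C (c - p₀.eval a), ?_, ?_, ?_⟩
  · rw [Polynomial.natDegree_add_C]
    refine Polynomial.natDegree_sum_le_of_forall_le _ _ fun i hi => ?_
    refine (Polynomial.natDegree_monomial_le _).trans ?_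
    have := Finset.mem_range.1 hi
    omega
  · rw [Polynomial.derivative_add, Polynomial.derivative_C, add_zero, hp₀,
      Polynomial.derivative_sum]
    conv_rhs => rw [q.as_sum_range]
    refine Finset.sum_congr rfl fun i _ => ?_
    rw [Polynomial.derivative_monomial]
    have : ((i : ℝ) + 1) ≠ 0 := by positivity
    simp [div_mul_cancel₀ _ this]
  · simp

/-- Induction on k: integrate the polynomial that approximates f′, with the constant chosen so that
the values at a agree. The mean value inequality between a and x gains one power of |x - a| and
keeps the constant M, so no Taylor coefficients are needed. -/
lemma exists_polynomial_abs_sub_le {β M a : ℝ} (hβ : 0 < β) (hM : 0 ≤ M) (ha : a ∈ Icc (0 : ℝ) 1)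
    (k : ℕ) : ∀ f : ℝ → ℝ, ContDiffOn ℝ k f (Icc 0 1) →
      (∀ x ∈ Icc (0 : ℝ) 1, |iteratedDerivWithin k f (Icc 0 1) x -
        iteratedDerivWithin k f (Icc 0 1) a| ≤ M * |x - a| ^ β) →
      ∃ p : Polynomial ℝ, p.natDegree ≤ k ∧
        ∀ x ∈ Icc (0 : ℝ) 1, |f x - p.eval x| ≤ M * |x - a| ^ (β + k) := by
  induction k with
  | zero =>
    intro f _ hf
    refine ⟨Polynomial.C (f a), by simp, fun x hx => ?_⟩
    simpa using hf x hx
  | succ k ih =>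
    intro f hf hfk
    have hu : UniqueDiffOn ℝ (Icc (0 : ℝ) 1) := uniqueDiffOn_Icc one_pos
    have hd : DifferentiableOn ℝ f (Icc 0 1) := hf.differentiableOn (by simp)
    have hd' : ContDiffOn ℝ k (derivWithin f (Icc 0 1)) (Icc 0 1) :=
      hf.derivWithin hu (by push_cast; exact le_rfl)
    obtain ⟨q, hq, hqb⟩ := ih (derivWithin f (Icc 0 1)) hd' (fun x hx => by
      have := hfk x hx
      rwa [iteratedDerivWithin_succ'] at this)
    obtain ⟨p, hp, hpd, hpa⟩ := exists_polynomial_derivative_eq q a (f a)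
    refine ⟨p, by omega, fun x hx => ?_⟩
    have hsub : uIcc a x ⊆ Icc (0 : ℝ) 1 := Set.uIcc_subset_Icc ha hx
    have hmv := Convex.norm_image_sub_le_of_norm_hasDerivWithin_le
      (f := fun y => f y - p.eval y) (f' := fun y => derivWithin f (Icc 0 1) y - q.eval y)
      (s := uIcc a x) (C := M * |x - a| ^ (β + k)) (x := a) (y := x)
      (fun y hy => by
        have h1 := ((hd y (hsub hy)).hasDerivWithinAt).mono hsub
        have h2 := (p.hasDerivAt y).hasDerivWithinAt (s := uIcc a x)
        rw [hpd] at h2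
        exact h1.sub h2)
      (fun y hy => by
        refine (hqb y (hsub hy)).trans ?_
        have : |y - a| ≤ |x - a| := by
          rcases mem_uIcc.1 hy with h | h
          · rw [abs_of_nonneg (by linarith), abs_of_nonneg (by linarith)]; linarith
          · rw [abs_of_nonpos (by linarith), abs_of_nonpos (by linarith)]; linarith
        gcongr)
      (convex_uIcc _ _) left_mem_uIcc right_mem_uIcc
    simp only [hpa, sub_self, sub_zero, Real.norm_eq_abs] at hmv
    refine hmv.trans (le_of_eq ?_)
    rcases eq_or_ne x a with rfl | hne
    · have : β + ((k : ℝ) + 1) ≠ 0 := by positivity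
      simp [Real.zero_rpow this]
    · rw [mul_assoc]
      congr 1
      nth_rewrite 2 [← Real.rpow_one |x - a|]
      rw [← Real.rpow_add (abs_pos.2 (sub_ne_zero.2 hne))]
      push_cast
      ring_nf

lemma holderClass.continuousOn {α M : ℝ} {f : ℝ → ℝ} (hf : f ∈ holderClass α M) :
    ContinuousOn f (Icc 0 1) := hf.1.continuousOn

/-- The degree is at most k = ⌈α⌉ - 1 < r, so the approximating polynomial is annihilated by the
wavelets. -/
lemma holderClass.exists_polynomial {α M : ℝ} (hα : 0 < α) (hM : 0 ≤ M) {r : ℕ} (hαr : α < r)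
    {f : ℝ → ℝ} (hf : f ∈ holderClass α M) {a : ℝ} (ha : a ∈ Icc (0 : ℝ) 1) :
    ∃ p : Polynomial ℝ, p.natDegree < r ∧
      ∀ x ∈ Icc (0 : ℝ) 1, |f x - p.eval x| ≤ M * |x - a| ^ α := by
  obtain ⟨hc, hh⟩ := hf
  set k := ⌈α⌉₊ - 1 with hk
  have hceil : 0 < ⌈α⌉₊ := Nat.ceil_pos.2 hα
  have hkr : k < r := by
    have : ⌈α⌉₊ ≤ r := Nat.ceil_le.2 hαr.le
    omega
  have hkα : 0 < α - k := by
    have h1 : (k : ℝ) + 1 = ⌈α⌉₊ := by exact_mod_cast (by omega : k + 1 = ⌈α⌉₊)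
    have h2 := Nat.ceil_lt_add_one hα.le
    linarith
  obtain ⟨p, hp, hpb⟩ := exists_polynomial_abs_sub_le hkα hM ha k f hc (fun x hx => by
    rcases lt_trichotomy x a with h | h | h
    · exact hh x a hx.1 h ha.2
    · rw [h]; simp; positivity
    · rw [abs_sub_comm, abs_sub_comm x a]
      exact hh a x ha.1 h hx.2)
  refine ⟨p, lt_of_le_of_lt hp hkr, fun x hx => ?_⟩
  simpa using hpb x hx

/-! ### Wavelet coefficients -/

variable {r : ℕ} (W : WaveletBasis r)

/-- The coarse coefficients of `f`. -/
def WaveletBasis.coarseCoeff (f : ℝ → ℝ) (k : ℕ) : ℝ :=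
  ∫ t in Icc (0 : ℝ) 1, f t * W.φ.fn W.j₀ k t

/-- The wavelet coefficients of `f`. -/
def WaveletBasis.coeff (f : ℝ → ℝ) (j k : ℕ) : ℝ := ∫ t in Icc (0 : ℝ) 1, f t * W.ψ.fn j k t

lemma integrableOn_of_continuousOn {f : ℝ → ℝ} (hf : ContinuousOn f (Icc 0 1)) :
    IntegrableOn f (Icc (0 : ℝ) 1) := hf.integrableOn_compact isCompact_Icc

/-- Vanishing moments allow f to be replaced by f - p, of order 2^{-jα} on the support when p is
centred at its left end. The sup norm 2^{j/2} and the support length 2^{-j} give the rest. -/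
lemma WaveletBasis.exists_abs_coeff_le {α M : ℝ} (hα : 0 < α) (hαr : α < r) (hM : 0 < M) :
    ∃ C : ℝ, 0 < C ∧ ∀ f ∈ holderClass α M, ∀ j ≥ W.j₀, ∀ k ∈ Finset.Icc 1 (2 ^ j),
      |W.coeff f j k| ≤ C * ((2 : ℝ) ^ j) ^ (-(α + 1 / 2)) := by
  obtain ⟨K, hK0, hK⟩ := EdgeFamily.exists_abs_fn_le W.ψ_fits W.ψ_smooth
  set A := W.ψ.width W.j₀ with hA
  have hA0 : 0 < A := EdgeFamily.width_pos _ _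
  refine ⟨M * A ^ α * K * A, by positivity, fun f hf j hj k hk => ?_⟩
  have hN : (0 : ℝ) < 2 ^ j := by positivity
  set a := W.ψ.lo W.j₀ j k with ha
  obtain ⟨p, hp, hpb⟩ := holderClass.exists_polynomial hα hM.le hαr hf
    (W.ψ_fits.lo_mem hj hk)
  have hψc := W.ψ_smooth.continuousOn_fn hk
  have h1 : W.coeff f j k = ∫ t in Icc (0 : ℝ) 1, (f t - p.eval t) * W.ψ.fn j k t := by
    simp_rw [sub_mul]
    rw [integral_sub, W.ψ_fits.integral_eval_mul_fn_eq_zero W.ψ_smooth W.ψ_moments hj hk hp,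
      sub_zero]
    · rfl
    · exact integrableOn_of_continuousOn ((holderClass.continuousOn hf).mul hψc)
    · exact integrableOn_of_continuousOn (p.continuous.continuousOn.mul hψc)
  set D := Icc (0 : ℝ) 1 ∩ Icc a (a + A / 2 ^ j) with hD
  have h2 : ∫ t in Icc (0 : ℝ) 1, (f t - p.eval t) * W.ψ.fn j k t =
      ∫ t in D, (f t - p.eval t) * W.ψ.fn j k t := by
    refine setIntegral_eq_of_subset_of_forall_sdiff_eq_zero measurableSet_Icc inter_subset_left ?_
    intro t ht
    rw [EdgeFamily.eq_zero_of_notMem_Icc (W.ψ_fits.tsupport_fn_subset hk)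
      fun h => ht.2 ⟨ht.1, h⟩, mul_zero]
  have hvol : volume.real D ≤ A / 2 ^ j := by
    calc volume.real D ≤ volume.real (Icc a (a + A / 2 ^ j)) :=
          measureReal_mono inter_subset_right (by simp)
      _ = A / 2 ^ j := by
          rw [Real.volume_real_Icc_of_le (by linarith [div_pos hA0 hN])]
          ring
  have h3 := norm_setIntegral_le_of_norm_le_const (μ := volume) (s := D)
    (f := fun t => (f t - p.eval t) * W.ψ.fn j k t) (C := M * (A / 2 ^ j) ^ α * (K * √(2 ^ j : ℝ)))
    (lt_of_le_of_lt (measure_mono inter_subset_right) (by simp)) (fun t ht => by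
      rw [norm_mul]
      refine mul_le_mul ((hpb t ht.1).trans ?_) (hK j k hk t ht.1) (norm_nonneg _) (by positivity)
      have h4 : |t - a| ≤ A / 2 ^ j := by
        rw [abs_of_nonneg (by linarith [ht.2.1])]; linarith [ht.2.2]
      gcongr)
  rw [← Real.norm_eq_abs, h1, h2]
  refine h3.trans ?_
  calc M * (A / 2 ^ j) ^ α * (K * √(2 ^ j : ℝ)) * volume.real D
      ≤ M * (A / 2 ^ j) ^ α * (K * √(2 ^ j : ℝ)) * (A / 2 ^ j) := by gcongr
    _ = M * A ^ α * K * A * ((2 : ℝ) ^ j) ^ (-(α + 1 / 2)) := by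
      rw [Real.div_rpow hA0.le hN.le, Real.sqrt_eq_rpow]
      have h5 : ((2 : ℝ) ^ j) ^ (-(α + 1 / 2)) =
          ((2 : ℝ) ^ j) ^ (1 / 2 : ℝ) / (((2 : ℝ) ^ j) ^ α * 2 ^ j) := by
        have h6 : ((2 : ℝ) ^ j) ^ α * 2 ^ j = ((2 : ℝ) ^ j) ^ (α + 1) := by
          rw [Real.rpow_add hN, Real.rpow_one]
        rw [h6, ← Real.rpow_sub hN]
        ring_nf
      rw [h5]
      field_simp

end

section

/-! ### Counting basis functions near an interval -/

lemma card_le_of_forall_mem {S : Finset ℕ} {u v : ℝ} (h : ∀ k ∈ S, u ≤ k ∧ (k : ℝ) ≤ v)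
    (huv : u ≤ v + 1) : (S.card : ℝ) ≤ v - u + 1 := by
  rcases S.eq_empty_or_nonempty with rfl | ⟨k₀, hk₀⟩
  · simp; linarith
  have hv : 0 ≤ v := (Nat.cast_nonneg k₀).trans (h k₀ hk₀).2
  have hsub : S ⊆ Finset.Icc ⌈u⌉₊ ⌊v⌋₊ := fun k hk =>
    Finset.mem_Icc.2 ⟨Nat.ceil_le.2 (h k hk).1, Nat.le_floor (h k hk).2⟩
  have hne : ⌈u⌉₊ ≤ ⌊v⌋₊ := (Finset.mem_Icc.1 (hsub hk₀)).1.trans (Finset.mem_Icc.1 (hsub hk₀)).2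
  have h1 : (S.card : ℝ) ≤ ((⌊v⌋₊ + 1 - ⌈u⌉₊ : ℕ) : ℝ) := by
    have := Finset.card_le_card hsub
    rw [Nat.card_Icc] at this
    exact_mod_cast this
  rw [Nat.cast_sub (by omega)] at h1
  have h2 := Nat.floor_le hv
  have h3 := Nat.le_ceil u
  push_cast at h1
  linarith

namespace EdgeFamily

variable {G : EdgeFamily} {j₀ : ℕ}

open Classical in
/-- The indices at level `j` of the functions whose support meets `[x₀ - c, x₀ + c]`. -/
def near (G : EdgeFamily) (x₀ c : ℝ) (j : ℕ) : Finset ℕ :=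
  (Finset.Icc 1 (2 ^ j)).filter fun k => (tsupport (G.fn j k) ∩ Icc (x₀ - c) (x₀ + c)).Nonempty

lemma near_subset (G : EdgeFamily) (x₀ c : ℝ) (j : ℕ) : G.near x₀ c j ⊆ Finset.Icc 1 (2 ^ j) := by
  classical
  exact Finset.filter_subset _ _

lemma fn_eq_zero_of_notMem_near {x₀ c : ℝ} {j k : ℕ} (hk : k ∈ Finset.Icc 1 (2 ^ j))
    (hnear : k ∉ G.near x₀ c j) {x : ℝ} (hx : x ∈ Icc (x₀ - c) (x₀ + c)) : G.fn j k x = 0 := by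
  classical
  by_contra h
  exact hnear (Finset.mem_filter.2 ⟨hk, x, subset_tsupport _ h, hx⟩)

/-- The number of edge functions. -/
def edges (G : EdgeFamily) : ℕ := G.nL + G.nR

lemma Fits.mem_near_interior (hG : G.Fits j₀) {x₀ c : ℝ} {j k : ℕ} (hk : k ∈ G.near x₀ c j)
    (h1 : ¬k ≤ G.nL) (h2 : k + G.nR ≤ 2 ^ j) :
    2 ^ j * (x₀ - c) - G.nR ≤ k ∧ (k : ℝ) ≤ 2 ^ j * (x₀ + c) + G.nL + 1 := by
  classical
  have hN : (0 : ℝ) < 2 ^ j := by positivity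
  obtain ⟨hk1, t, ht, hx⟩ := Finset.mem_filter.1 hk
  have hsub : tsupport (G.fn j k) ⊆ {t | 2 ^ j * t - k ∈ Icc (-((G.nL : ℝ) + 1)) (G.nR : ℝ)} := by
    refine closure_minimal (fun s hs => ?_) (isClosed_Icc.preimage (by fun_prop))
    by_contra hnot
    apply hs
    rw [fn, if_neg h1, if_pos h2, eq_zero_of_notMem_Icc hG.mother hnot, mul_zero]
  obtain ⟨h3, h4⟩ := hsub ht
  have h5 := mul_le_mul_of_nonneg_left hx.1 hN.le
  have h6 := mul_le_mul_of_nonneg_left hx.2 hN.le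
  constructor <;> linarith

open Classical in
-- Only interior functions have positions given by a formula; the edge functions, at most nL + nR,
-- are counted in full. The map `g` is the identity for counting functions and the block number for
-- counting blocks.
lemma card_image_le_of_interior (S : Finset ℕ) {j : ℕ} (hS : S ⊆ Finset.Icc 1 (2 ^ j)) (g : ℕ → ℕ)
    {u v : ℝ} (huv : u ≤ v + 1)
    (h : ∀ k ∈ S, ¬k ≤ G.nL → k + G.nR ≤ 2 ^ j → u ≤ g k ∧ (g k : ℝ) ≤ v) :
    ((S.image g).card : ℝ) ≤ v - u + 1 + G.edges := by
  set S₁ := S.filter fun k => ¬k ≤ G.nL ∧ k + G.nR ≤ 2 ^ j with hS₁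
  have hsub : S ⊆ S₁ ∪ (Finset.Icc 1 G.nL ∪ Finset.Ioc (2 ^ j - G.nR) (2 ^ j)) := by
    intro k hk
    have h1 := Finset.mem_Icc.1 (hS hk)
    simp only [hS₁, Finset.mem_union, Finset.mem_filter, Finset.mem_Icc, Finset.mem_Ioc, hk,
      true_and]
    omega
  have h1 : ((S₁.image g).card : ℝ) ≤ v - u + 1 := by
    refine card_le_of_forall_mem (fun q hq => ?_) huv
    obtain ⟨k, hk, rfl⟩ := Finset.mem_image.1 hq
    obtain ⟨hk1, hk2, hk3⟩ := Finset.mem_filter.1 hk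
    exact h k hk1 hk2 hk3
  have h2 : (S.image g).card ≤ (S₁.image g).card + (G.nL + G.nR) := by
    calc (S.image g).card ≤ _ := Finset.card_le_card (Finset.image_subset_image hsub)
      _ ≤ (S₁.image g).card + _ := by rw [Finset.image_union]; exact Finset.card_union_le _ _
      _ ≤ _ := by
        gcongr
        refine Finset.card_image_le.trans ((Finset.card_union_le _ _).trans ?_)
        rw [Nat.card_Icc, Nat.card_Ioc]
        omega
  have h3 : ((S.image g).card : ℝ) ≤ (S₁.image g).card + (G.nL + G.nR) := by exact_mod_cast h2
  unfold edges
  push_cast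
  linarith

lemma Fits.card_near_le (hG : G.Fits j₀) (x₀ : ℝ) {c : ℝ} (hc : 0 ≤ c) (j : ℕ) :
    ((G.near x₀ c j).card : ℝ) ≤ 2 * c * 2 ^ j + (2 * G.edges + 2) := by
  have hN : (0 : ℝ) < 2 ^ j := by positivity
  have h := card_image_le_of_interior (G := G) (G.near x₀ c j) (near_subset _ _ _ _) id
    (u := 2 ^ j * (x₀ - c) - G.nR) (v := 2 ^ j * (x₀ + c) + G.nL + 1) (by
      have : (0 : ℝ) ≤ G.nL := Nat.cast_nonneg _
      have : (0 : ℝ) ≤ G.nR := Nat.cast_nonneg _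
      nlinarith [mul_nonneg hN.le hc])
    fun k hk h1 h2 => hG.mem_near_interior hk h1 h2
  rw [Finset.image_id] at h
  refine h.trans (le_of_eq ?_)
  unfold edges
  push_cast
  ring

lemma Fits.card_image_near_le (hG : G.Fits j₀) (x₀ : ℝ) {c : ℝ} (hc : 0 ≤ c) (j : ℕ) {L : ℕ}
    (hL : 0 < L) :
    (((G.near x₀ c j).image fun k => (k - 1) / L).card : ℝ) ≤
      2 * c * 2 ^ j / L + (2 * G.edges + 3) := by
  classical
  have hN : (0 : ℝ) < 2 ^ j := by positivity
  have hL' : (0 : ℝ) < L := by exact_mod_cast hL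
  have hL1 : (1 : ℝ) ≤ L := by exact_mod_cast hL
  have hnL : (0 : ℝ) ≤ G.nL := Nat.cast_nonneg _
  have hnR : (0 : ℝ) ≤ G.nR := Nat.cast_nonneg _
  set u := 2 ^ j * (x₀ - c) - G.nR with hu
  set v := 2 ^ j * (x₀ + c) + G.nL + 1 with hv
  have huv : u ≤ v := by nlinarith [mul_nonneg hN.le hc]
  have huvL : (u - 1) / L ≤ (v - 1) / L := by gcongr
  have h := card_image_le_of_interior (G := G) (G.near x₀ c j) (near_subset _ _ _ _)
    (fun k => (k - 1) / L) (u := (u - 1) / L - 1) (v := (v - 1) / L) (by linarith)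
    fun k hk h1 h2 => by
      obtain ⟨h3, h4⟩ := hG.mem_near_interior hk h1 h2
      have hk1 : 1 ≤ k := (Finset.mem_Icc.1 (near_subset _ _ _ _ hk)).1
      have h5 : ((k - 1 : ℕ) : ℝ) = k - 1 := by push_cast [Nat.cast_sub hk1]; ring
      constructor
      · have h6 : k - 1 < ((k - 1) / L + 1) * L := (Nat.div_lt_iff_lt_mul hL).1 (Nat.lt_succ_self _)
        have h7 : ((k - 1 : ℕ) : ℝ) < (((k - 1) / L : ℕ) + 1) * L := by exact_mod_cast h6
        rw [h5] at h7
        have : (u - 1) / L < (((k - 1) / L : ℕ) : ℝ) + 1 := by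
          rw [div_lt_iff₀ hL']; linarith
        linarith
      · refine Nat.cast_div_le.trans ?_
        rw [h5]
        gcongr
  refine h.trans ?_
  have h8 : (v - 1) / L - ((u - 1) / L - 1) + 1 + (G.edges : ℝ) =
      2 * c * 2 ^ j / L + (G.nL + G.nR + 1) / L + 2 + G.edges := by
    rw [hu, hv]
    field_simp
    ring
  have h9 : (G.nL + G.nR + 1 : ℝ) / L ≤ G.nL + G.nR + 1 := div_le_self (by positivity) hL1
  have h10 : (G.edges : ℝ) = G.nL + G.nR := by unfold edges; push_cast; ring
  rw [h8, h10]
  linarith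

end EdgeFamily

variable {r : ℕ} (W : WaveletBasis r)

/-- Integer shifts of a nonzero mother wavelet whose indices lie well inside 2^j [x₀ - c, x₀ + c]
all meet the neighborhood. This makes the vertical block long enough for its exponential term to be
small. -/
lemma WaveletBasis.le_card_near {x₀ c : ℝ} (hI : Icc (x₀ - c) (x₀ + c) ⊆ Icc 0 1) (hc : 0 ≤ c)
    {j : ℕ} (hj : W.j₀ ≤ j) :
    2 * c * 2 ^ j - (2 * W.ψ.edges + 5) ≤ ((W.ψ.near x₀ c j).card : ℝ) := by
  classical
  have hN : (0 : ℝ) < 2 ^ j := by positivity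
  have hx1 := (hI ⟨le_rfl, by linarith⟩ : x₀ - c ∈ Icc (0 : ℝ) 1).1
  have hx2 := (hI ⟨by linarith, le_rfl⟩ : x₀ + c ∈ Icc (0 : ℝ) 1).2
  set N : ℝ := 2 ^ j with hNdef
  set nL := W.ψ.nL with hnL
  set nR := W.ψ.nR with hnR
  have hedge : (W.ψ.edges : ℝ) = nL + nR := by unfold EdgeFamily.edges; push_cast; rfl
  have hnL0 : (0 : ℝ) ≤ nL := Nat.cast_nonneg _
  have hnR0 : (0 : ℝ) ≤ nR := Nat.cast_nonneg _
  have hy1 : 0 ≤ N * (x₀ - c) := mul_nonneg hN.le hx1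
  have hy2 : N * (x₀ + c) ≤ N := by nlinarith
  set lo := ⌈N * (x₀ - c)⌉₊ + nL + nR + 1 with hlo
  have hlo1 : (lo : ℝ) < N * (x₀ - c) + nL + nR + 2 := by
    have := Nat.ceil_lt_add_one hy1
    rw [hlo]; push_cast; linarith
  have hlo2 : N * (x₀ - c) + nL + nR + 1 ≤ lo := by
    have := Nat.le_ceil (N * (x₀ - c))
    rw [hlo]; push_cast; linarith
  by_cases hlarge : N * (x₀ + c) - nL - nR - 1 < lo
  · have h1 : N * (x₀ + c) - nL - nR - 1 - (N * (x₀ - c) + nL + nR + 2) < 0 := by linarith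
    have h2 : 2 * c * N - (2 * (W.ψ.edges : ℝ) + 5) ≤ 0 := by rw [hedge]; linarith
    exact h2.trans (Nat.cast_nonneg _)
  · push Not at hlarge
    set hi := ⌊N * (x₀ + c) - nL - nR - 1⌋₊ with hhi
    have hpos : 0 ≤ N * (x₀ + c) - nL - nR - 1 := (Nat.cast_nonneg _).trans hlarge
    have hhi1 : (hi : ℝ) ≤ N * (x₀ + c) - nL - nR - 1 := Nat.floor_le hpos
    have hhi2 : N * (x₀ + c) - nL - nR - 1 < hi + 1 := Nat.lt_floor_add_one _
    have hlohi : lo ≤ hi := Nat.le_floor hlarge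
    have hint : ∀ k ∈ Finset.Icc lo hi, k ∈ Finset.Icc 1 (2 ^ j) ∧ ¬k ≤ nL ∧ k + nR ≤ 2 ^ j := by
      intro k hk
      obtain ⟨h1, h2⟩ := Finset.mem_Icc.1 hk
      have h3 : (k : ℝ) + nR ≤ N := by
        have : (k : ℝ) ≤ hi := by exact_mod_cast h2
        linarith
      have h4 : k + nR ≤ 2 ^ j := by
        rw [hNdef] at h3; exact_mod_cast h3
      refine ⟨Finset.mem_Icc.2 ⟨by omega, by omega⟩, by omega, h4⟩
    -- the mother wavelet does not vanish identically
    obtain ⟨s, hs⟩ : ∃ s, W.ψ.mother s ≠ 0 := by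
      by_contra hall
      push Not at hall
      obtain ⟨h1, h2, h3⟩ := hint lo (Finset.mem_Icc.2 ⟨le_rfl, hlohi⟩)
      have h4 := W.orthonormal_ψ j hj lo h1 j hj lo h1
      have h5 : ∀ t, W.ψ.fn j lo t = 0 := by
        intro t
        rw [EdgeFamily.fn, if_neg h2, if_pos h3, hall, mul_zero]
      simp [h5] at h4
    have hsmem : s ∈ Icc (-((nL : ℝ) + 1)) (nR : ℝ) := W.ψ_fits.mother (subset_tsupport _ hs)
    have hsub : Finset.Icc lo hi ⊆ W.ψ.near x₀ c j := by
      intro k hk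
      obtain ⟨h1, h2, h3⟩ := hint k hk
      obtain ⟨hk1, hk2⟩ := Finset.mem_Icc.1 hk
      have hk1' : (lo : ℝ) ≤ k := by exact_mod_cast hk1
      have hk2' : (k : ℝ) ≤ hi := by exact_mod_cast hk2
      refine Finset.mem_filter.2 ⟨h1, (s + k) / N, subset_tsupport _ ?_, ?_, ?_⟩
      · have h4 : N * ((s + k) / N) - k = s := by
          rw [mul_div_cancel₀ _ hN.ne']; ring
        rw [Function.mem_support, EdgeFamily.fn, if_neg h2, if_pos h3, ← hNdef, h4]
        exact mul_ne_zero (Real.sqrt_pos.2 hN).ne' hs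
      · rw [le_div_iff₀ hN]
        linarith [hsmem.1]
      · rw [div_le_iff₀ hN]
        linarith [hsmem.2]
    have hcard := Finset.card_le_card hsub
    rw [Nat.card_Icc] at hcard
    have h6 : (hi : ℝ) + 1 - lo ≤ ((W.ψ.near x₀ c j).card : ℝ) := by
      have h7 : ((hi + 1 - lo : ℕ) : ℝ) ≤ ((W.ψ.near x₀ c j).card : ℝ) := by exact_mod_cast hcard
      rw [Nat.cast_sub (by omega)] at h7
      push_cast at h7
      exact h7
    rw [hedge]
    linarith

/-! ### Orthogonality -/

lemma WaveletBasis.integral_sum_sq (S : Finset (Σ _ : ℕ, ℕ))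
    (hS : ∀ p ∈ S, W.j₀ ≤ p.1 ∧ p.2 ∈ Finset.Icc 1 (2 ^ p.1)) (a : (Σ _ : ℕ, ℕ) → ℝ) :
    ∫ t in Icc (0 : ℝ) 1, (∑ p ∈ S, a p * W.ψ.fn p.1 p.2 t) ^ 2 = ∑ p ∈ S, a p ^ 2 := by
  have hc : ∀ p ∈ S, ContinuousOn (W.ψ.fn p.1 p.2) (Icc 0 1) := fun p hp =>
    W.ψ_smooth.continuousOn_fn (hS p hp).2
  have h1 : ∀ t, (∑ p ∈ S, a p * W.ψ.fn p.1 p.2 t) ^ 2 =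
      ∑ p ∈ S, ∑ q ∈ S, a p * a q * (W.ψ.fn p.1 p.2 t * W.ψ.fn q.1 q.2 t) := by
    intro t
    rw [pow_two, Finset.sum_mul_sum]
    exact Finset.sum_congr rfl fun p _ => Finset.sum_congr rfl fun q _ => by ring
  simp_rw [h1]
  have hint : ∀ p ∈ S, ∀ q ∈ S, Integrable (fun t => a p * a q *
      (W.ψ.fn p.1 p.2 t * W.ψ.fn q.1 q.2 t)) (volume.restrict (Icc (0 : ℝ) 1)) :=
    fun p hp q hq => (integrableOn_of_continuousOn ((hc p hp).mul (hc q hq))).const_mul _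
  rw [integral_finsetSum _ fun p hp => integrable_finsetSum _ fun q hq => hint p hp q hq]
  refine Finset.sum_congr rfl fun p hp => ?_
  rw [integral_finsetSum _ fun q hq => hint p hp q hq]
  rw [Finset.sum_eq_single p]
  · rw [integral_const_mul, W.orthonormal_ψ _ (hS p hp).1 _ (hS p hp).2 _ (hS p hp).1 _
      (hS p hp).2]
    simp [pow_two]
  · intro q hq hne
    rw [integral_const_mul, W.orthonormal_ψ _ (hS p hp).1 _ (hS p hp).2 _ (hS q hq).1 _
      (hS q hq).2, if_neg fun h => hne (Sigma.ext h.1.symm (heq_of_eq h.2.symm)), mul_zero]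
  · exact fun h => absurd hp h

lemma WaveletBasis.lintegral_sum_sq_le (S : Finset (Σ _ : ℕ, ℕ))
    (hS : ∀ p ∈ S, W.j₀ ≤ p.1 ∧ p.2 ∈ Finset.Icc 1 (2 ^ p.1)) (a : (Σ _ : ℕ, ℕ) → ℝ)
    {D : Set ℝ} (hD : D ⊆ Icc 0 1) :
    ∫⁻ t in D, ENNReal.ofReal ((∑ p ∈ S, a p * W.ψ.fn p.1 p.2 t) ^ 2) ≤
      ENNReal.ofReal (∑ p ∈ S, a p ^ 2) := by
  refine (lintegral_mono_set hD).trans (le_of_eq ?_)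
  rw [← W.integral_sum_sq S hS a, ofReal_integral_eq_lintegral_ofReal]
  · refine integrableOn_of_continuousOn (ContinuousOn.pow ?_ 2)
    exact continuousOn_finsetSum _ fun p hp =>
      continuousOn_const.mul (W.ψ_smooth.continuousOn_fn (hS p hp).2)
  · exact ae_of_all _ fun t => sq_nonneg _

end

section

/-! ### The wavelet expansion of a Hölder function -/

variable {r : ℕ} (W : WaveletBasis r)

/-- The projection of `f` on the level `j` of the wavelet basis. -/
def WaveletBasis.detail (f : ℝ → ℝ) (j : ℕ) (x : ℝ) : ℝ :=
  ∑ k ∈ Finset.Icc 1 (2 ^ j), W.coeff f j k * W.ψ.fn j k x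

/-- The projection of `f` on the coarse scale. -/
def WaveletBasis.coarse (f : ℝ → ℝ) (x : ℝ) : ℝ :=
  ∑ k ∈ Finset.Icc 1 (2 ^ W.j₀), W.coarseCoeff f k * W.φ.fn W.j₀ k x

lemma WaveletBasis.continuousOn_detail (f : ℝ → ℝ) (j : ℕ) :
    ContinuousOn (W.detail f j) (Icc 0 1) :=
  continuousOn_finsetSum _ fun _ hk => continuousOn_const.mul (W.ψ_smooth.continuousOn_fn hk)

lemma WaveletBasis.continuousOn_coarse (f : ℝ → ℝ) : ContinuousOn (W.coarse f) (Icc 0 1) :=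
  continuousOn_finsetSum _ fun _ hk => continuousOn_const.mul (W.φ_continuous.continuousOn_fn hk)

/-- At a point boundedly many wavelets per level are nonzero (the count at c = 0), and each term is
of order 2^{-j(α+1/2)} · 2^{j/2}. -/
lemma WaveletBasis.exists_abs_detail_le {α M : ℝ} (hα : 0 < α) (hαr : α < r) (hM : 0 < M) :
    ∃ C : ℝ, 0 < C ∧ ∀ f ∈ holderClass α M, ∀ j ≥ W.j₀, ∀ x ∈ Icc (0 : ℝ) 1,
      |W.detail f j x| ≤ C * ((2 : ℝ) ^ j) ^ (-α) := by
  obtain ⟨K, hK0, hK⟩ := EdgeFamily.exists_abs_fn_le W.ψ_fits W.ψ_smooth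
  obtain ⟨C, hC0, hC⟩ := W.exists_abs_coeff_le hα hαr hM
  refine ⟨(2 * W.ψ.edges + 2) * (C * K), by positivity, fun f hf j hj x hx => ?_⟩
  have hN : (0 : ℝ) < 2 ^ j := by positivity
  have hcard := W.ψ_fits.card_near_le x le_rfl j
  have hsub : W.detail f j x = ∑ k ∈ W.ψ.near x 0 j, W.coeff f j k * W.ψ.fn j k x := by
    refine (Finset.sum_subset (EdgeFamily.near_subset _ _ _ _) fun k hk hnk => ?_).symm
    rw [EdgeFamily.fn_eq_zero_of_notMem_near hk hnk (x := x) (by simp), mul_zero]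
  have hpow : ((2 : ℝ) ^ j) ^ (-(α + 1 / 2)) * √(2 ^ j : ℝ) = ((2 : ℝ) ^ j) ^ (-α) := by
    rw [Real.sqrt_eq_rpow, ← Real.rpow_add hN]; ring_nf
  have hterm : ∀ k ∈ W.ψ.near x 0 j, |W.coeff f j k * W.ψ.fn j k x| ≤
      C * K * ((2 : ℝ) ^ j) ^ (-α) := by
    intro k hk
    have hk' := EdgeFamily.near_subset _ _ _ _ hk
    rw [abs_mul, ← hpow]
    calc _ ≤ (C * ((2 : ℝ) ^ j) ^ (-(α + 1 / 2))) * (K * √(2 ^ j : ℝ)) :=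
          mul_le_mul (hC f hf j hj k hk') (hK j k hk' x hx) (abs_nonneg _) (by positivity)
      _ = _ := by ring
  rw [hsub]
  refine (Finset.abs_sum_le_sum_abs _ _).trans ((Finset.sum_le_card_nsmul _ _ _ hterm).trans ?_)
  rw [nsmul_eq_mul]
  have : ((W.ψ.near x 0 j).card : ℝ) ≤ 2 * W.ψ.edges + 2 := by simpa using hcard
  calc _ ≤ (2 * (W.ψ.edges : ℝ) + 2) * (C * K * ((2 : ℝ) ^ j) ^ (-α)) := by gcongr
    _ = _ := by ring

lemma two_pow_rpow_neg (α : ℝ) (j i : ℕ) :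
    ((2 : ℝ) ^ (j + i)) ^ (-α) = ((2 : ℝ) ^ j) ^ (-α) * ((2 : ℝ) ^ (-α)) ^ i := by
  rw [pow_add, Real.mul_rpow (by positivity) (by positivity), ← Real.rpow_natCast (2 : ℝ) i,
    ← Real.rpow_mul (by norm_num), mul_comm (i : ℝ), Real.rpow_mul (by norm_num),
    Real.rpow_natCast]

lemma two_rpow_neg_lt_one {α : ℝ} (hα : 0 < α) : (2 : ℝ) ^ (-α) < 1 :=
  Real.rpow_lt_one_of_one_lt_of_neg (by norm_num) (by linarith)

lemma summable_two_pow_rpow_neg {α : ℝ} (hα : 0 < α) (j : ℕ) :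
    Summable fun i : ℕ => ((2 : ℝ) ^ (j + i)) ^ (-α) := by
  simp_rw [two_pow_rpow_neg]
  exact (summable_geometric_of_lt_one (by positivity) (two_rpow_neg_lt_one hα)).mul_left _

lemma hasSum_integral_mul_of_bound {D : ℕ → ℝ → ℝ} {b : ℕ → ℝ} (hb : Summable b)
    (hD : ∀ i, ContinuousOn (D i) (Icc 0 1)) (hDb : ∀ i, ∀ x ∈ Icc (0 : ℝ) 1, |D i x| ≤ b i)
    {g : ℝ → ℝ} (hg : ContinuousOn g (Icc 0 1)) :
    HasSum (fun i => ∫ x in Icc (0 : ℝ) 1, D i x * g x)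
      (∫ x in Icc (0 : ℝ) 1, (∑' i, D i x) * g x) := by
  obtain ⟨K, hK⟩ := isCompact_Icc.exists_bound_of_continuousOn hg
  have hK0 : 0 ≤ K := (norm_nonneg _).trans (hK 0 (by simp))
  have hb0 : ∀ i, 0 ≤ b i := fun i => (abs_nonneg _).trans (hDb i 0 (by simp))
  have hint : ∀ i, Integrable (fun x => D i x * g x) (volume.restrict (Icc (0 : ℝ) 1)) :=
    fun i => integrableOn_of_continuousOn ((hD i).mul hg)
  have h := hasSum_integral_of_summable_integral_norm hint
    (Summable.of_nonneg_of_le (fun i => integral_nonneg fun x => norm_nonneg _) (fun i => ?_)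
      (hb.mul_right K))
  · simpa only [tsum_mul_right] using h
  · have h1 : ∫ x in Icc (0 : ℝ) 1, ‖D i x * g x‖ ≤ ∫ x in Icc (0 : ℝ) 1, b i * K := by
      refine setIntegral_mono_on (hint i).norm
        (integrableOn_of_continuousOn continuousOn_const) measurableSet_Icc fun x hx => ?_
      rw [norm_mul]
      exact mul_le_mul (hDb i x hx) (hK x hx) (norm_nonneg _) (hb0 i)
    simpa using h1

lemma integral_sum_mul {S : Finset ℕ} (a : ℕ → ℝ) {u : ℕ → ℝ → ℝ} {g : ℝ → ℝ}
    (hu : ∀ q ∈ S, ContinuousOn (u q) (Icc 0 1)) (hg : ContinuousOn g (Icc 0 1)) :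
    ∫ t in Icc (0 : ℝ) 1, (∑ q ∈ S, a q * u q t) * g t =
      ∑ q ∈ S, a q * ∫ t in Icc (0 : ℝ) 1, u q t * g t := by
  have h : ∀ t, (∑ q ∈ S, a q * u q t) * g t = ∑ q ∈ S, a q * (u q t * g t) := fun t => by
    rw [Finset.sum_mul]
    exact Finset.sum_congr rfl fun q _ => mul_assoc _ _ _
  simp_rw [h]
  have hint : ∀ q ∈ S, Integrable (fun t => a q * (u q t * g t))
      (volume.restrict (Icc (0 : ℝ) 1)) := fun q hq =>
    (integrableOn_of_continuousOn ((hu q hq).mul hg)).const_mul _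
  rw [integral_finsetSum _ hint]
  simp_rw [integral_const_mul]

lemma WaveletBasis.integral_coarse_mul_φ (f : ℝ → ℝ) {k : ℕ} (hk : k ∈ Finset.Icc 1 (2 ^ W.j₀)) :
    ∫ t in Icc (0 : ℝ) 1, W.coarse f t * W.φ.fn W.j₀ k t = W.coarseCoeff f k := by
  refine (integral_sum_mul _ (fun q hq => W.φ_continuous.continuousOn_fn hq)
    (W.φ_continuous.continuousOn_fn hk)).trans ?_
  rw [Finset.sum_eq_single k]
  · rw [W.orthonormal_φ k hk k hk, if_pos rfl, mul_one]
  · intro q hq hne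
    rw [W.orthonormal_φ q hq k hk, if_neg hne, mul_zero]
  · exact fun h => absurd hk h

lemma WaveletBasis.integral_coarse_mul_ψ (f : ℝ → ℝ) {j k : ℕ} (hj : W.j₀ ≤ j)
    (hk : k ∈ Finset.Icc 1 (2 ^ j)) :
    ∫ t in Icc (0 : ℝ) 1, W.coarse f t * W.ψ.fn j k t = 0 := by
  refine (integral_sum_mul _ (fun q hq => W.φ_continuous.continuousOn_fn hq)
    (W.ψ_smooth.continuousOn_fn hk)).trans (Finset.sum_eq_zero fun q hq => ?_)
  rw [W.orthogonal_φψ q hq j hj k hk, mul_zero]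

lemma WaveletBasis.integral_detail_mul_φ (f : ℝ → ℝ) {j k : ℕ} (hj : W.j₀ ≤ j)
    (hk : k ∈ Finset.Icc 1 (2 ^ W.j₀)) :
    ∫ t in Icc (0 : ℝ) 1, W.detail f j t * W.φ.fn W.j₀ k t = 0 := by
  refine (integral_sum_mul _ (fun q hq => W.ψ_smooth.continuousOn_fn hq)
    (W.φ_continuous.continuousOn_fn hk)).trans (Finset.sum_eq_zero fun q hq => ?_)
  simp_rw [mul_comm (W.ψ.fn j q _)]
  rw [W.orthogonal_φψ k hk j hj q hq, mul_zero]

lemma WaveletBasis.integral_detail_mul_ψ (f : ℝ → ℝ) {i j k : ℕ} (hi : W.j₀ ≤ i) (hj : W.j₀ ≤ j)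
    (hk : k ∈ Finset.Icc 1 (2 ^ j)) :
    ∫ t in Icc (0 : ℝ) 1, W.detail f i t * W.ψ.fn j k t = if i = j then W.coeff f j k else 0 := by
  refine (integral_sum_mul _ (fun q hq => W.ψ_smooth.continuousOn_fn hq)
    (W.ψ_smooth.continuousOn_fn hk)).trans ?_
  rw [Finset.sum_congr rfl fun q hq => by rw [W.orthonormal_ψ i hi q hq j hj k hk]]
  split_ifs with h
  · subst h
    rw [Finset.sum_eq_single k]
    · simp
    · intro q _ hne
      simp [hne]
    · exact fun h => absurd hk h
  · simp [h]

/-- Hölder functions are the sum of their wavelet series, at every point of `[0, 1]`. -/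
lemma WaveletBasis.hasSum_detail {α M : ℝ} (hα : 0 < α) (hαr : α < r) (hM : 0 < M)
    {f : ℝ → ℝ} (hf : f ∈ holderClass α M) {x : ℝ} (hx : x ∈ Icc (0 : ℝ) 1) :
    HasSum (fun i => W.detail f (W.j₀ + i) x) (f x - W.coarse f x) := by
  obtain ⟨C, hC0, hC⟩ := W.exists_abs_detail_le hα hαr hM
  set b : ℕ → ℝ := fun i => C * ((2 : ℝ) ^ (W.j₀ + i)) ^ (-α) with hbdef
  have hb : Summable b := (summable_two_pow_rpow_neg hα W.j₀).mul_left C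
  have hDb : ∀ i, ∀ x ∈ Icc (0 : ℝ) 1, |W.detail f (W.j₀ + i) x| ≤ b i :=
    fun i x hx => hC f hf _ (by omega) x hx
  have hDc : ∀ i, ContinuousOn (W.detail f (W.j₀ + i)) (Icc 0 1) :=
    fun i => W.continuousOn_detail f _
  have hsum : ∀ x ∈ Icc (0 : ℝ) 1, Summable fun i => W.detail f (W.j₀ + i) x :=
    fun x hx => Summable.of_norm_bounded hb fun i => hDb i x hx
  set S : ℝ → ℝ := fun x => ∑' i, W.detail f (W.j₀ + i) x with hS
  have hSc : ContinuousOn S (Icc 0 1) := continuousOn_tsum hDc hb hDb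
  have hfc := holderClass.continuousOn hf
  have hcc := W.continuousOn_coarse f
  -- The remainder g is orthogonal to the basis, hence zero almost everywhere by completeness, and
  -- by continuity zero everywhere on [0, 1]. The pointwise form is needed for the risk at a single
  -- point.
  set g : ℝ → ℝ := fun x => f x - W.coarse f x - S x with hg
  have hgc : ContinuousOn g (Icc 0 1) := (hfc.sub hcc).sub hSc
  have hint : ∀ h : ℝ → ℝ, ContinuousOn h (Icc 0 1) →
      ∫ t in Icc (0 : ℝ) 1, g t * h t = (∫ t in Icc (0 : ℝ) 1, f t * h t) -
        (∫ t in Icc (0 : ℝ) 1, W.coarse f t * h t) - ∫ t in Icc (0 : ℝ) 1, S t * h t := by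
    intro h hh
    simp_rw [hg, sub_mul]
    rw [integral_sub, integral_sub]
    · exact integrableOn_of_continuousOn (hfc.mul hh)
    · exact integrableOn_of_continuousOn (hcc.mul hh)
    · exact (integrableOn_of_continuousOn (hfc.mul hh)).sub
        (integrableOn_of_continuousOn (hcc.mul hh))
    · exact integrableOn_of_continuousOn (hSc.mul hh)
  have hzero : g =ᵐ[volume.restrict (Icc (0 : ℝ) 1)] 0 := by
    refine W.complete g ?_ (fun k hk => ?_) fun j hj k hk => ?_
    · obtain ⟨K, hK⟩ := isCompact_Icc.exists_bound_of_continuousOn hgc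
      refine MemLp.of_bound (hgc.aestronglyMeasurable measurableSet_Icc) K ?_
      exact (ae_restrict_iff' measurableSet_Icc).2 (ae_of_all _ hK)
    · have hφ := W.φ_continuous.continuousOn_fn hk
      have h1 := hasSum_integral_mul_of_bound hb hDc hDb hφ
      have h2 : ∫ t in Icc (0 : ℝ) 1, S t * W.φ.fn W.j₀ k t = 0 := by
        rw [hS, ← h1.tsum_eq]
        simp [W.integral_detail_mul_φ f (Nat.le_add_right _ _) hk]
      rw [hint _ hφ, h2, W.integral_coarse_mul_φ f hk, WaveletBasis.coarseCoeff, sub_self, sub_zero]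
    · have hψ := W.ψ_smooth.continuousOn_fn hk
      have h1 := hasSum_integral_mul_of_bound hb hDc hDb hψ
      have h2 : ∫ t in Icc (0 : ℝ) 1, S t * W.ψ.fn j k t = W.coeff f j k := by
        rw [hS, ← h1.tsum_eq, tsum_eq_single (j - W.j₀)]
        · rw [W.integral_detail_mul_ψ f (Nat.le_add_right _ _) hj hk, if_pos (by omega)]
        · intro i hi
          rw [W.integral_detail_mul_ψ f (Nat.le_add_right _ _) hj hk, if_neg (by omega)]
      rw [hint _ hψ, h2, W.integral_coarse_mul_ψ f hj hk, WaveletBasis.coeff, sub_zero, sub_self]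
  have heq := Measure.eqOn_Icc_of_ae_eq volume zero_ne_one hzero hgc continuousOn_const hx
  have h3 : f x - W.coarse f x = S x := by
    have : g x = 0 := heq
    simp only [hg] at this
    linarith
  rw [h3]
  exact (hsum x hx).hasSum

lemma WaveletBasis.exists_abs_sub_sum_detail_le {α M : ℝ} (hα : 0 < α) (hαr : α < r) (hM : 0 < M) :
    ∃ C : ℝ, 0 < C ∧ ∀ f ∈ holderClass α M, ∀ x ∈ Icc (0 : ℝ) 1, ∀ m : ℕ,
      |W.coarse f x + ∑ i ∈ Finset.range m, W.detail f (W.j₀ + i) x - f x| ≤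
        C * ((2 : ℝ) ^ (W.j₀ + m)) ^ (-α) := by
  obtain ⟨C, hC0, hC⟩ := W.exists_abs_detail_le hα hαr hM
  have hq := two_rpow_neg_lt_one hα
  have hq0 : (0 : ℝ) < 2 ^ (-α) := by positivity
  refine ⟨C * (1 - (2 : ℝ) ^ (-α))⁻¹, mul_pos hC0 (inv_pos.2 (by linarith)), fun f hf x hx m => ?_⟩
  have h1 := W.hasSum_detail hα hαr hM hf hx
  have h2 : W.coarse f x + ∑ i ∈ Finset.range m, W.detail f (W.j₀ + i) x - f x =
      -∑' i, W.detail f (W.j₀ + (i + m)) x := by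
    have := h1.summable.sum_add_tsum_nat_add m
    rw [h1.tsum_eq] at this
    linarith
  rw [h2, abs_neg]
  have h3 : HasSum (fun i : ℕ => C * ((2 : ℝ) ^ (W.j₀ + m)) ^ (-α) * ((2 : ℝ) ^ (-α)) ^ i)
      (C * ((2 : ℝ) ^ (W.j₀ + m)) ^ (-α) * (1 - (2 : ℝ) ^ (-α))⁻¹) :=
    (hasSum_geometric_of_lt_one hq0.le hq).mul_left _
  have h4 : ‖∑' i, W.detail f (W.j₀ + (i + m)) x‖ ≤
      C * ((2 : ℝ) ^ (W.j₀ + m)) ^ (-α) * (1 - (2 : ℝ) ^ (-α))⁻¹ := by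
    refine tsum_of_norm_bounded h3 fun i => ?_
    refine (hC f hf _ (by omega) x hx).trans (le_of_eq ?_)
    rw [mul_assoc, ← two_pow_rpow_neg]
    ring_nf
  rw [Real.norm_eq_abs] at h4
  refine h4.trans (le_of_eq (by ring))

end

section

/-! ### Dyadic levels -/

lemma exists_le_two_pow (x : ℝ) : ∃ J : ℕ, x ≤ 2 ^ J := by
  obtain ⟨J, hJ⟩ := pow_unbounded_of_one_lt x (one_lt_two : (1 : ℝ) < 2)
  exact ⟨J, hJ.le⟩

lemma le_two_pow_level (x : ℝ) : x ≤ 2 ^ level x :=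
  Nat.sInf_mem (s := {J : ℕ | x ≤ 2 ^ J}) (exists_le_two_pow x)

lemma two_pow_lt_of_lt_level {x : ℝ} {j : ℕ} (h : j < level x) : (2 : ℝ) ^ j < x := by
  by_contra hx
  exact absurd (Nat.sInf_le (s := {J : ℕ | x ≤ 2 ^ J}) (not_lt.1 hx)) (not_le.2 h)

lemma le_two_pow_of_level_le {x : ℝ} {j : ℕ} (h : level x ≤ j) : x ≤ (2 : ℝ) ^ j :=
  (le_two_pow_level x).trans (pow_le_pow_right₀ (by norm_num) h)

lemma level_mono {x y : ℝ} (h : x ≤ y) : level x ≤ level y :=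
  Nat.sInf_le (s := {J : ℕ | x ≤ 2 ^ J}) (h.trans (le_two_pow_level y))

/-- The assumption x ≥ 1 matters: `level` is 0 for every smaller x. -/
lemma two_pow_level_le {x : ℝ} (hx : 1 ≤ x) : (2 : ℝ) ^ level x ≤ 2 * x := by
  rcases Nat.eq_zero_or_pos (level x) with h | h
  · rw [h]; norm_num; linarith
  · have h1 := two_pow_lt_of_lt_level (x := x) (Nat.sub_lt h one_pos)
    have h2 : (2 : ℝ) ^ level x = 2 * 2 ^ (level x - 1) := by
      rw [← pow_succ', Nat.sub_add_cancel h]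
    rw [h2]; linarith

variable {Ω : Type*} [MeasurableSpace Ω] {P : Measure Ω} {B : ℝ≥0 → Ω → ℝ}

/-! ### The empirical coefficients -/

section

variable (P) {r : ℕ} (W : WaveletBasis r) (B : ℝ≥0 → Ω → ℝ) (n : ℕ) (f : ℝ → ℝ)

/-- The empirical wavelet coefficients. -/
def empCoeff (j k : ℕ) : Ω → ℝ := stochIntegral P (W.ψ.fn j k) (observation B n f)

/-- The standardized errors of the empirical wavelet coefficients. -/
def noise (p : Σ _ : ℕ, ℕ) (ω : Ω) : ℝ :=
  √(n : ℝ) * (empCoeff P W B n f p.1 p.2 ω - W.coeff f p.1 p.2)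

/-- The standardized errors of the empirical coarse coefficients. -/
def coarseNoise (k : ℕ) (ω : Ω) : ℝ :=
  √(n : ℝ) * (stochIntegral P (W.φ.fn W.j₀ k) (observation B n f) ω - W.coarseCoeff f k)

end

/-- The indices of the wavelets. -/
def WaveletBasis.index {r : ℕ} (W : WaveletBasis r) : Set (Σ _ : ℕ, ℕ) :=
  {p | W.j₀ ≤ p.1 ∧ p.2 ∈ Finset.Icc 1 (2 ^ p.1)}

variable {r : ℕ} {W : WaveletBasis r}

lemma add_noise {n : ℕ} (hn : 0 < n) (f : ℝ → ℝ) (j k : ℕ) (ω : Ω) :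
    W.coeff f j k + 1 / √(n : ℝ) * noise P W B n f ⟨j, k⟩ ω = empCoeff P W B n f j k ω := by
  have : √(n : ℝ) ≠ 0 := (Real.sqrt_pos.2 (by exact_mod_cast hn)).ne'
  unfold noise
  field_simp
  ring

lemma measurable_empCoeff (n : ℕ) (f : ℝ → ℝ) (j k : ℕ) : Measurable (empCoeff P W B n f j k) :=
  measurable_stochIntegral _ _

lemma stdNormalMoments_noise (hB : IsPreBrownianReal B P) {n : ℕ} (hn : 0 < n) {f : ℝ → ℝ}
    (hf : ContinuousOn f (Icc 0 1)) : StdNormalMoments P (noise P W B n f) W.index := by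
  have hn' : √(n : ℝ) ≠ 0 := (Real.sqrt_pos.2 (by exact_mod_cast hn)).ne'
  refine stdNormalMoments_of_ae_eq_wienerLp hB (g := fun p => W.ψ.fn p.1 p.2)
    (fun p hp => W.ψ_smooth.continuousOn_fn hp.2) (fun p hp q hq => ?_) (fun p => ?_)
    fun p hp => ?_
  · rw [W.orthonormal_ψ _ hp.1 _ hp.2 _ hq.1 _ hq.2]
    congr 1
    rw [Sigma.ext_iff, heq_iff_eq]
  · exact ((measurable_stochIntegral _ _).sub_const _).const_mul _
  · filter_upwards [stochIntegral_ae_eq hB n hf (W.ψ_smooth.continuousOn_fn hp.2)] with ω hω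
    simp only [noise, empCoeff, hω, WaveletBasis.coeff]
    field_simp
    ring

lemma stdNormalMoments_coarseNoise (hB : IsPreBrownianReal B P) {n : ℕ} (hn : 0 < n) {f : ℝ → ℝ}
    (hf : ContinuousOn f (Icc 0 1)) :
    StdNormalMoments P (coarseNoise P W B n f) (Finset.Icc 1 (2 ^ W.j₀)) := by
  have hn' : √(n : ℝ) ≠ 0 := (Real.sqrt_pos.2 (by exact_mod_cast hn)).ne'
  refine stdNormalMoments_of_ae_eq_wienerLp hB (g := fun k => W.φ.fn W.j₀ k)
    (fun k hk => W.φ_continuous.continuousOn_fn hk) (fun p hp q hq => ?_) (fun p => ?_)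
    fun p hp => ?_
  · rw [W.orthonormal_φ _ hp _ hq]
  · exact ((measurable_stochIntegral _ _).sub_const _).const_mul _
  · filter_upwards [stochIntegral_ae_eq hB n hf (W.φ_continuous.continuousOn_fn hp)] with ω hω
    simp only [coarseNoise, hω, WaveletBasis.coarseCoeff]
    field_simp
    ring

/-! ### Measurability of the estimated coefficients -/

lemma measurable_real_sign : Measurable Real.sign := by
  unfold Real.sign
  exact Measurable.ite measurableSet_Iio measurable_const
    (Measurable.ite measurableSet_Ioi measurable_const measurable_const)

lemma measurable_jsFactor (n : ℕ) (lam : ℝ) (m : ℕ) : Measurable (jsFactor n lam m) := by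
  unfold jsFactor
  fun_prop

lemma measurable_softThreshold (n : ℕ) : Measurable (softThreshold n) := by
  unfold softThreshold
  have := measurable_real_sign
  fun_prop

lemma measurable_blockShrink (n L : ℕ) (lam : ℝ) {y : ℕ → ℕ → Ω → ℝ} (hy : ∀ j k, Measurable (y j k))
    (j k : ℕ) : Measurable fun ω => blockShrink n L lam (fun j k => y j k ω) j k := by
  unfold blockShrink
  exact ((measurable_jsFactor n lam L).comp (by fun_prop)).mul (hy j k)

lemma measurable_adaptiveCoeff (W : WaveletBasis r) (x₀ c : ℝ) (n L : ℕ) (lam : ℝ)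
    {y : ℕ → ℕ → Ω → ℝ} (hy : ∀ j k, Measurable (y j k)) (j k : ℕ) :
    Measurable fun ω => adaptiveCoeff W x₀ c n L lam (fun j k => y j k ω) j k := by
  have h1 := measurable_blockShrink n L lam hy j k
  unfold adaptiveCoeff
  split_ifs
  · unfold hybridCoeff
    split_ifs
    · exact measurable_const
    · exact ((measurable_jsFactor n lam _).comp (by fun_prop)).mul (hy j k)
    · exact (measurable_softThreshold n).comp (hy j k)
    · exact h1
  · unfold blockJSCoeff
    split_ifs
    · exact h1
    · exact measurable_const

lemma adaptiveCoeff_eq_zero (W : WaveletBasis r) (x₀ c : ℝ) {n : ℕ} (L : ℕ) (lam : ℝ)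
    (y : ℕ → ℕ → ℝ) {j : ℕ} (k : ℕ) (hj : level n ≤ j) :
    adaptiveCoeff W x₀ c n L lam y j k = 0 := by
  unfold adaptiveCoeff
  split_ifs
  · simp [hybridCoeff, hj]
  · simp [blockJSCoeff, hj]

/-! ### From coefficients to the risk -/

/-- `Q` collects the errors controlled at every point, `V` those controlled only in L². Averaging
over a length 2c turns 4R into (2/c)R. -/
lemma risk_le_of_pos {fhat : Ω → ℝ → ℝ} {f : ℝ → ℝ} {x₀ c : ℝ} (hc : 0 < c) {Q R : Ω → ℝ}
    {V : Ω → ℝ → ℝ} (hQ : Measurable Q) (hQ0 : ∀ ω, 0 ≤ Q ω)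
    (h : ∀ ω, ∀ x ∈ Icc (x₀ - c) (x₀ + c), (fhat ω x - f x) ^ 2 ≤ Q ω + 4 * V ω x ^ 2)
    (hV : ∀ ω, ∫⁻ x in Icc (x₀ - c) (x₀ + c), ENNReal.ofReal (V ω x ^ 2) ≤ ENNReal.ofReal (R ω)) :
    risk P fhat f x₀ c ≤ ∫⁻ ω, ENNReal.ofReal (Q ω) ∂P +
      ENNReal.ofReal (2 / c) * ∫⁻ ω, ENNReal.ofReal (R ω) ∂P := by
  rw [risk, if_neg hc.ne']
  have h1 : ∀ ω, ∫⁻ x in Icc (x₀ - c) (x₀ + c), ENNReal.ofReal ((fhat ω x - f x) ^ 2) ≤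
      ENNReal.ofReal (2 * c) * ENNReal.ofReal (Q ω) + 4 * ENNReal.ofReal (R ω) := by
    intro ω
    calc ∫⁻ x in Icc (x₀ - c) (x₀ + c), ENNReal.ofReal ((fhat ω x - f x) ^ 2)
        ≤ ∫⁻ x in Icc (x₀ - c) (x₀ + c),
            (ENNReal.ofReal (Q ω) + 4 * ENNReal.ofReal (V ω x ^ 2)) := by
          refine setLIntegral_mono' measurableSet_Icc fun x hx => ?_
          rw [show (4 : ℝ≥0∞) = ENNReal.ofReal 4 by simp, ← ENNReal.ofReal_mul (by norm_num),
            ← ENNReal.ofReal_add (hQ0 ω) (by positivity)]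
          exact ENNReal.ofReal_le_ofReal (h ω x hx)
      _ = ENNReal.ofReal (2 * c) * ENNReal.ofReal (Q ω) +
            4 * ∫⁻ x in Icc (x₀ - c) (x₀ + c), ENNReal.ofReal (V ω x ^ 2) := by
          rw [lintegral_add_left measurable_const, lintegral_const_mul' _ _ (by simp),
            setLIntegral_const, Real.volume_Icc, mul_comm]
          congr 3
          ring
      _ ≤ _ := by gcongr; exact hV ω
  calc _ ≤ ENNReal.ofReal (1 / (2 * c)) * ∫⁻ ω, (ENNReal.ofReal (2 * c) * ENNReal.ofReal (Q ω) +
        4 * ENNReal.ofReal (R ω)) ∂P := by gcongr with ω; exact h1 ω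
    _ = _ := by
      rw [lintegral_add_left (by fun_prop), lintegral_const_mul' _ _ ENNReal.ofReal_ne_top,
        lintegral_const_mul' _ _ (by simp), mul_add, ← mul_assoc, ← mul_assoc,
        ← ENNReal.ofReal_mul (by positivity)]
      congr 1
      · rw [div_mul_cancel₀ _ (by positivity), ENNReal.ofReal_one, one_mul]
      · rw [show (4 : ℝ≥0∞) = ENNReal.ofReal 4 by simp, ← ENNReal.ofReal_mul (by positivity)]
        congr 2
        field_simp
        norm_num

lemma risk_le_of_zero {fhat : Ω → ℝ → ℝ} {f : ℝ → ℝ} {x₀ : ℝ} {Q : Ω → ℝ}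
    (h : ∀ ω, (fhat ω x₀ - f x₀) ^ 2 ≤ Q ω) :
    risk P fhat f x₀ 0 ≤ ∫⁻ ω, ENNReal.ofReal (Q ω) ∂P := by
  rw [risk, if_pos rfl]
  exact lintegral_mono fun ω => ENNReal.ofReal_le_ofReal (h ω)

/-- A weighted form of Minkowski's inequality in mean square. -/
lemma lintegral_sum_mul_abs_sq_le {κ : Type*} (S : Finset κ) {w s : κ → ℝ} (hw : ∀ p ∈ S, 0 ≤ w p)
    (hs : ∀ p ∈ S, 0 < s p) {δ : κ → Ω → ℝ} (hδ : ∀ p, Measurable (δ p))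
    (h : ∀ p ∈ S, ∫⁻ ω, ENNReal.ofReal (δ p ω ^ 2) ∂P ≤ ENNReal.ofReal (s p ^ 2)) :
    ∫⁻ ω, ENNReal.ofReal ((∑ p ∈ S, w p * |δ p ω|) ^ 2) ∂P ≤
      ENNReal.ofReal ((∑ p ∈ S, w p * s p) ^ 2) := by
  set T := ∑ p ∈ S, w p * s p with hT
  have hT0 : 0 ≤ T := Finset.sum_nonneg fun p hp => mul_nonneg (hw p hp) (hs p hp).le
  have h1 : ∀ ω, (∑ p ∈ S, w p * |δ p ω|) ^ 2 ≤ ∑ p ∈ S, T * (w p / s p) * δ p ω ^ 2 := by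
    intro ω
    -- Cauchy–Schwarz for w|δ| = √(ws) · √(w/s)|δ|. Weighting by the expected size s of each error
    -- produces (∑ ws)² after integration, with no independence of the errors.
    have h2 := Finset.sum_sq_le_sum_mul_sum_of_sq_le_mul S (r := fun p => w p * |δ p ω|)
      (f := fun p => w p * s p) (g := fun p => w p / s p * δ p ω ^ 2)
      (fun p hp => mul_nonneg (hw p hp) (hs p hp).le)
      (fun p hp => mul_nonneg (div_nonneg (hw p hp) (hs p hp).le) (sq_nonneg _))
      (fun p hp => le_of_eq <| by
        have := (hs p hp).ne'
        rw [mul_pow, sq_abs]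
        field_simp)
    refine h2.trans (le_of_eq ?_)
    rw [Finset.mul_sum]
    exact Finset.sum_congr rfl fun p _ => by ring
  have hcoef : ∀ p ∈ S, 0 ≤ T * (w p / s p) :=
    fun p hp => mul_nonneg hT0 (div_nonneg (hw p hp) (hs p hp).le)
  calc _ ≤ ∫⁻ ω, ∑ p ∈ S, ENNReal.ofReal (T * (w p / s p)) * ENNReal.ofReal (δ p ω ^ 2) ∂P := by
        refine lintegral_mono fun ω => (ENNReal.ofReal_le_ofReal (h1 ω)).trans (le_of_eq ?_)
        rw [ENNReal.ofReal_sum_of_nonneg fun p hp => mul_nonneg (hcoef p hp) (sq_nonneg _)]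
        exact Finset.sum_congr rfl fun p hp => ENNReal.ofReal_mul (hcoef p hp)
    _ = ∑ p ∈ S, ENNReal.ofReal (T * (w p / s p)) * ∫⁻ ω, ENNReal.ofReal (δ p ω ^ 2) ∂P := by
        rw [lintegral_finsetSum _ fun p _ => by have := hδ p; fun_prop]
        exact Finset.sum_congr rfl fun p _ => lintegral_const_mul' _ _ ENNReal.ofReal_ne_top
    _ ≤ ∑ p ∈ S, ENNReal.ofReal (T * (w p / s p)) * ENNReal.ofReal (s p ^ 2) :=
        Finset.sum_le_sum fun p hp => by gcongr; exact h p hp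
    _ = ENNReal.ofReal (∑ p ∈ S, T * (w p / s p) * s p ^ 2) := by
        rw [ENNReal.ofReal_sum_of_nonneg fun p hp => mul_nonneg (hcoef p hp) (sq_nonneg _)]
        exact Finset.sum_congr rfl fun p hp => (ENNReal.ofReal_mul (hcoef p hp)).symm
    _ = _ := by
        congr 1
        rw [pow_two T]
        nth_rewrite 3 [hT]
        rw [Finset.mul_sum]
        refine Finset.sum_congr rfl fun p hp => ?_
        have := (hs p hp).ne'
        field_simp

end

section

variable {Ω : Type*} [MeasurableSpace Ω] {P : Measure Ω} {B : ℝ≥0 → Ω → ℝ}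

/-- The errors of the estimated wavelet coefficients. -/
def coeffError (P : Measure Ω) {r : ℕ} (W : WaveletBasis r) (B : ℝ≥0 → Ω → ℝ) (n : ℕ) (f : ℝ → ℝ)
    (x₀ c : ℝ) (L : ℕ) (lam : ℝ) (p : Σ _ : ℕ, ℕ) (ω : Ω) : ℝ :=
  adaptiveCoeff W x₀ c n L lam (fun j k => empCoeff P W B n f j k ω) p.1 p.2 - W.coeff f p.1 p.2

variable {r : ℕ} {W : WaveletBasis r}

lemma measurable_coeffError (n : ℕ) (f : ℝ → ℝ) (x₀ c : ℝ) (L : ℕ) (lam : ℝ) (p : Σ _ : ℕ, ℕ) :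
    Measurable (coeffError P W B n f x₀ c L lam p) :=
  (measurable_adaptiveCoeff W x₀ c n L lam (measurable_empCoeff n f) p.1 p.2).sub_const _

/-- The indices at the levels `a ≤ j < b` of the wavelets whose support meets
`[x₀ - c, x₀ + c]`. -/
def nearIndex (W : WaveletBasis r) (x₀ c : ℝ) (a b : ℕ) : Finset (Σ _ : ℕ, ℕ) :=
  (Finset.Ico a b).sigma (W.ψ.near x₀ c)

lemma mem_nearIndex {x₀ c : ℝ} {a b : ℕ} {p : Σ _ : ℕ, ℕ} :
    p ∈ nearIndex W x₀ c a b ↔ (a ≤ p.1 ∧ p.1 < b) ∧ p.2 ∈ W.ψ.near x₀ c p.1 := by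
  rw [nearIndex, Finset.mem_sigma, Finset.mem_Ico]

lemma mem_index_of_mem_nearIndex {x₀ c : ℝ} {a b : ℕ} (ha : W.j₀ ≤ a) {p : Σ _ : ℕ, ℕ}
    (hp : p ∈ nearIndex W x₀ c a b) : p ∈ W.index :=
  ⟨ha.trans (mem_nearIndex.1 hp).1.1, EdgeFamily.near_subset _ _ _ _ (mem_nearIndex.1 hp).2⟩

lemma sum_nearIndex (x₀ c : ℝ) (a b : ℕ) (g : (Σ _ : ℕ, ℕ) → ℝ) :
    ∑ p ∈ nearIndex W x₀ c a b, g p =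
      ∑ j ∈ Finset.Ico a b, ∑ k ∈ W.ψ.near x₀ c j, g ⟨j, k⟩ :=
  Finset.sum_sigma _ _ _

/-- The four errors are coarse noise, levels below q, levels from q on, and truncation bias.
Wavelets that miss the neighborhood vanish at x, and the minimum covers a q beyond the last
estimated level. -/
lemma adaptiveEstimator_sub {n : ℕ} (hn : 0 < n) (f : ℝ → ℝ) (x₀ c : ℝ) (L : ℕ) (lam : ℝ) (ω : Ω)
    {q : ℕ} (hq : W.j₀ ≤ q) {x : ℝ} (hx : x ∈ Icc (x₀ - c) (x₀ + c)) :
    adaptiveEstimator P W x₀ c n L lam (observation B n f) ω x - f x =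
      1 / √(n : ℝ) * ∑ k ∈ Finset.Icc 1 (2 ^ W.j₀),
        coarseNoise P W B n f k ω * W.φ.fn W.j₀ k x +
      ∑ p ∈ nearIndex W x₀ c W.j₀ (min q (level n)),
        coeffError P W B n f x₀ c L lam p ω * W.ψ.fn p.1 p.2 x +
      ∑ p ∈ nearIndex W x₀ c q (level n),
        coeffError P W B n f x₀ c L lam p ω * W.ψ.fn p.1 p.2 x +
      (W.coarse f x + ∑ i ∈ Finset.range (level n - W.j₀), W.detail f (W.j₀ + i) x - f x) := by
  have hn' : √(n : ℝ) ≠ 0 := (Real.sqrt_pos.2 (by exact_mod_cast hn)).ne'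
  set est : ℕ → ℕ → ℝ := adaptiveCoeff W x₀ c n L lam fun j k => empCoeff P W B n f j k ω with hest
  set D : ℕ → ℝ := fun j => ∑ k ∈ W.ψ.near x₀ c j,
    coeffError P W B n f x₀ c L lam ⟨j, k⟩ ω * W.ψ.fn j k x with hD
  have hlevel : ∀ j, ∑ k ∈ Finset.Icc 1 (2 ^ j), est j k * W.ψ.fn j k x = D j + W.detail f j x := by
    intro j
    have h1 : D j = ∑ k ∈ Finset.Icc 1 (2 ^ j),
        coeffError P W B n f x₀ c L lam ⟨j, k⟩ ω * W.ψ.fn j k x :=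
      Finset.sum_subset (EdgeFamily.near_subset _ _ _ _) fun k hk hnear => by
        rw [EdgeFamily.fn_eq_zero_of_notMem_near hk hnear hx, mul_zero]
    rw [h1, WaveletBasis.detail, ← Finset.sum_add_distrib]
    refine Finset.sum_congr rfl fun k _ => ?_
    simp only [coeffError, ← hest]
    ring
  have hseries : ∑' i : ℕ, ∑ k ∈ Finset.Icc 1 (2 ^ (W.j₀ + i)),
      est (W.j₀ + i) k * W.ψ.fn (W.j₀ + i) k x =
      ∑ i ∈ Finset.range (level n - W.j₀), (D (W.j₀ + i) + W.detail f (W.j₀ + i) x) := by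
    rw [tsum_eq_sum (s := Finset.range (level n - W.j₀))]
    · exact Finset.sum_congr rfl fun i _ => hlevel _
    · intro i hi
      rw [Finset.mem_range] at hi
      refine Finset.sum_eq_zero fun k _ => ?_
      rw [hest, adaptiveCoeff_eq_zero W x₀ c L lam _ k (by omega), zero_mul]
  have hcoarse : ∑ k ∈ Finset.Icc 1 (2 ^ W.j₀),
      stochIntegral P (W.φ.fn W.j₀ k) (observation B n f) ω * W.φ.fn W.j₀ k x =
      1 / √(n : ℝ) * ∑ k ∈ Finset.Icc 1 (2 ^ W.j₀),
        coarseNoise P W B n f k ω * W.φ.fn W.j₀ k x + W.coarse f x := by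
    rw [WaveletBasis.coarse, Finset.mul_sum, ← Finset.sum_add_distrib]
    refine Finset.sum_congr rfl fun k _ => ?_
    unfold coarseNoise
    field_simp
    ring
  have hsplit : ∑ i ∈ Finset.range (level n - W.j₀), D (W.j₀ + i) =
      ∑ j ∈ Finset.Ico W.j₀ (min q (level n)), D j + ∑ j ∈ Finset.Ico q (level n), D j := by
    rw [← Finset.sum_Ico_eq_sum_range]
    rcases le_total q (level n) with h | h
    · rw [min_eq_left h, Finset.sum_Ico_consecutive _ hq h]
    · rw [min_eq_right h, Finset.Ico_eq_empty_of_le h, Finset.sum_empty, add_zero]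
  rw [sum_nearIndex, sum_nearIndex]
  change ∑ k ∈ Finset.Icc 1 (2 ^ W.j₀),
      stochIntegral P (W.φ.fn W.j₀ k) (observation B n f) ω * W.φ.fn W.j₀ k x +
    ∑' i : ℕ, ∑ k ∈ Finset.Icc 1 (2 ^ (W.j₀ + i)),
      est (W.j₀ + i) k * W.ψ.fn (W.j₀ + i) k x - f x = _ + ∑ j ∈ _, D j + ∑ j ∈ _, D j + _
  rw [hcoarse, hseries, Finset.sum_add_distrib, hsplit]
  ring

lemma four_mul_add_le {a b d x y z : ℝ} (ha : 0 ≤ a) (hb : 0 ≤ b) (hd : 0 ≤ d) (hx : 0 ≤ x)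
    (hy : 0 ≤ y) (hz : 0 ≤ z) :
    4 * a * x + 4 * b * y + 4 * d * z ≤ 4 * (a + b + d) * (x + y + z) := by
  nlinarith [mul_nonneg ha hy, mul_nonneg ha hz, mul_nonneg hb hx, mul_nonneg hb hz,
    mul_nonneg hd hx, mul_nonneg hd hy]

/-- The risk in terms of the errors of the coefficients: the levels below `q` enter through the sum
of the root mean square errors, the others through the sum of the mean square errors. -/
lemma exists_risk_le [IsProbabilityMeasure P] (hB : IsPreBrownianReal B P) (W : WaveletBasis r)
    {α M : ℝ} (hα : 0 < α) (hαr : α < r) (hM : 0 < M) :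
    ∃ C : ℝ, 0 < C ∧ ∀ f ∈ holderClass α M, ∀ {n : ℕ} (_ : 0 < n) {x₀ c : ℝ} (_ : 0 ≤ c)
      (_ : Icc (x₀ - c) (x₀ + c) ⊆ Icc 0 1) {L : ℕ} {lam : ℝ} {q : ℕ} (_ : W.j₀ ≤ q)
      (_ : c = 0 → level n ≤ q) (_ : ∀ j ∈ Finset.Ico W.j₀ q, c * 2 ^ j ≤ 1) {s : ℕ → ℝ}
      (_ : ∀ j, 0 < s j)
      (_ : ∀ p ∈ nearIndex W x₀ c W.j₀ (min q (level n)),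
        ∫⁻ ω, ENNReal.ofReal (coeffError P W B n f x₀ c L lam p ω ^ 2) ∂P ≤
          ENNReal.ofReal (s p.1 ^ 2)) {e : ℝ} (_ : 0 ≤ e)
      (_ : ∫⁻ ω, ENNReal.ofReal (∑ p ∈ nearIndex W x₀ c q (level n),
        coeffError P W B n f x₀ c L lam p ω ^ 2) ∂P ≤ ENNReal.ofReal e),
      risk P (adaptiveEstimator P W x₀ c n L lam (observation B n f)) f x₀ c ≤
        ENNReal.ofReal (C * (1 / n + (∑ j ∈ Finset.Ico W.j₀ (min q (level n)), √(2 ^ j) * s j) ^ 2 +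
          ((n : ℝ) ^ (-α)) ^ 2) + 2 / c * e) := by
  obtain ⟨K, hK0, hK⟩ := EdgeFamily.exists_abs_fn_le W.ψ_fits W.ψ_smooth
  obtain ⟨K', hK'0, hK'⟩ := EdgeFamily.exists_abs_fn_le W.φ_fits W.φ_continuous
  obtain ⟨T, hT0, hT⟩ := W.exists_abs_sub_sum_detail_le hα hαr hM
  set N : ℝ := 2 ^ W.j₀ with hN
  have hN0 : 0 < N := by positivity
  set D : ℝ := 2 * W.ψ.edges + 4 with hD
  have hD0 : 0 < D := by positivity
  refine ⟨4 * ((K' * √N) ^ 2 * N ^ 2 + (K * D) ^ 2 + T ^ 2), by positivity, ?_⟩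
  intro f hf n hn x₀ c hc hI L lam q hq hc0 hcq s hs0 hs e he0 he
  have hfc := holderClass.continuousOn hf
  have hn' : (0 : ℝ) < n := by exact_mod_cast hn
  have hsn : 0 < √(n : ℝ) := Real.sqrt_pos.2 hn'
  set δ := coeffError P W B n f x₀ c L lam with hδ
  set Sc := nearIndex W x₀ c W.j₀ (min q (level n)) with hSc
  set Sf := nearIndex W x₀ c q (level n) with hSf
  set z := coarseNoise P W B n f with hz
  have hzm : ∀ k, Measurable (z k) := fun k =>
    ((measurable_stochIntegral _ _).sub_const _).const_mul _
  have hδm : ∀ p, Measurable (δ p) := measurable_coeffError n f x₀ c L lam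
  set X : Ω → ℝ := fun ω => (∑ k ∈ Finset.Icc 1 (2 ^ W.j₀), 1 * |z k ω|) ^ 2 with hX
  set Y : Ω → ℝ := fun ω => (∑ p ∈ Sc, √(2 ^ p.1) * |δ p ω|) ^ 2 with hY
  set t : ℝ := T * (n : ℝ) ^ (-α) with ht
  have ht0 : 0 ≤ t := by positivity
  set Q : Ω → ℝ := fun ω => 4 * (K' * √N) ^ 2 / n * X ω + 4 * K ^ 2 * Y ω + 4 * t ^ 2 with hQ
  set V : Ω → ℝ → ℝ := fun ω x => ∑ p ∈ Sf, δ p ω * W.ψ.fn p.1 p.2 x with hV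
  have hX0 : ∀ ω, 0 ≤ X ω := fun ω => sq_nonneg _
  have hY0 : ∀ ω, 0 ≤ Y ω := fun ω => sq_nonneg _
  have hXm : Measurable X := by
    refine (Finset.measurable_sum _ fun k _ => ?_).pow_const 2
    have := hzm k
    fun_prop
  have hYm : Measurable Y := by
    refine (Finset.measurable_sum _ fun p _ => ?_).pow_const 2
    have := hδm p
    fun_prop
  have hQm : Measurable Q := by fun_prop
  have hQ0 : ∀ ω, 0 ≤ Q ω := fun ω => by
    have := hX0 ω
    have := hY0 ω
    positivity
  have hpt : ∀ ω, ∀ x ∈ Icc (x₀ - c) (x₀ + c),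
      (adaptiveEstimator P W x₀ c n L lam (observation B n f) ω x - f x) ^ 2 ≤
        Q ω + 4 * V ω x ^ 2 := by
    intro ω x hx
    have hx01 := hI hx
    rw [adaptiveEstimator_sub hn f x₀ c L lam ω hq hx]
    have h1 : |1 / √(n : ℝ) * ∑ k ∈ Finset.Icc 1 (2 ^ W.j₀), z k ω * W.φ.fn W.j₀ k x| ≤
        1 / √(n : ℝ) * (K' * √N * ∑ k ∈ Finset.Icc 1 (2 ^ W.j₀), 1 * |z k ω|) := by
      rw [abs_mul, abs_of_nonneg (by positivity : 0 ≤ 1 / √(n : ℝ)), Finset.mul_sum]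
      gcongr
      refine (Finset.abs_sum_le_sum_abs _ _).trans (Finset.sum_le_sum fun k hk => ?_)
      rw [abs_mul, one_mul, mul_comm]
      gcongr
      exact hK' _ k hk x hx01
    have h2 : |∑ p ∈ Sc, δ p ω * W.ψ.fn p.1 p.2 x| ≤ K * ∑ p ∈ Sc, √(2 ^ p.1) * |δ p ω| := by
      rw [Finset.mul_sum]
      refine (Finset.abs_sum_le_sum_abs _ _).trans (Finset.sum_le_sum fun p hp => ?_)
      rw [abs_mul, mul_comm, ← mul_assoc]
      gcongr
      exact hK _ _ (mem_index_of_mem_nearIndex le_rfl hp).2 x hx01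
    have h3 : |W.coarse f x + ∑ i ∈ Finset.range (level n - W.j₀), W.detail f (W.j₀ + i) x - f x| ≤
        t := by
      refine (hT f hf x hx01 _).trans ?_
      rw [ht]
      refine mul_le_mul_of_nonneg_left (Real.rpow_le_rpow_of_nonpos hn' ?_ (neg_nonpos.2 hα.le))
        hT0.le
      exact le_two_pow_of_level_le (by omega)
    have h1' := pow_le_pow_left₀ (abs_nonneg _) h1 2
    have h2' := pow_le_pow_left₀ (abs_nonneg _) h2 2
    have h3' := pow_le_pow_left₀ (abs_nonneg _) h3 2
    rw [sq_abs] at h1' h2' h3'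
    have h4 : (1 / √(n : ℝ) * (K' * √N * ∑ k ∈ Finset.Icc 1 (2 ^ W.j₀), 1 * |z k ω|)) ^ 2 =
        (K' * √N) ^ 2 / n * X ω := by
      rw [mul_pow, mul_pow, div_pow, Real.sq_sqrt hn'.le, hX]
      ring
    have h5 : (K * ∑ p ∈ Sc, √(2 ^ p.1) * |δ p ω|) ^ 2 = K ^ 2 * Y ω := by rw [mul_pow]
    rw [h4] at h1'
    rw [h5] at h2'
    have h6 : ∀ a b v d : ℝ, (a + b + v + d) ^ 2 ≤ 4 * (a ^ 2 + b ^ 2 + v ^ 2 + d ^ 2) :=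
      fun a b v d => by
        nlinarith [sq_nonneg (a - b), sq_nonneg (a - v), sq_nonneg (a - d), sq_nonneg (b - v),
          sq_nonneg (b - d), sq_nonneg (v - d)]
    refine (h6 _ _ _ _).trans ?_
    simp only [hQ, hV]
    have h7 : 4 * (K' * √N) ^ 2 / n * X ω = 4 * ((K' * √N) ^ 2 / n * X ω) := by ring
    rw [h7]
    linarith
  have hEX : ∫⁻ ω, ENNReal.ofReal (X ω) ∂P ≤ ENNReal.ofReal (N ^ 2) := by
    refine (lintegral_sum_mul_abs_sq_le (s := fun _ => 1) _ (fun _ _ => zero_le_one)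
      (fun _ _ => zero_lt_one) hzm fun k hk => ?_).trans (le_of_eq ?_)
    · rw [(stdNormalMoments_coarseNoise hB hn hfc).lintegral_sq hk]
      simp
    · congr 2
      simp [hN]
  have hEY : ∫⁻ ω, ENNReal.ofReal (Y ω) ∂P ≤ ENNReal.ofReal
      (D ^ 2 * (∑ j ∈ Finset.Ico W.j₀ (min q (level n)), √(2 ^ j) * s j) ^ 2) := by
    refine (lintegral_sum_mul_abs_sq_le (s := fun p => s p.1) _ (fun _ _ => by positivity)
      (fun p _ => hs0 _) hδm hs).trans (ENNReal.ofReal_le_ofReal ?_)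
    rw [← mul_pow]
    refine pow_le_pow_left₀ (Finset.sum_nonneg fun p _ => mul_nonneg (by positivity) (hs0 _).le) ?_ 2
    rw [sum_nearIndex, Finset.mul_sum]
    refine Finset.sum_le_sum fun j hj => ?_
    dsimp only
    rw [Finset.sum_const, nsmul_eq_mul]
    refine mul_le_mul_of_nonneg_right ?_ (mul_nonneg (by positivity) (hs0 _).le)
    -- Below q one has c 2^j ≤ 1, so at most D wavelets of each level meet the neighborhood.
    refine (W.ψ_fits.card_near_le x₀ hc j).trans ?_
    rw [Finset.mem_Ico] at hj
    have := hcq j (Finset.mem_Ico.2 ⟨hj.1, hj.2.trans_le (min_le_left _ _)⟩)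
    rw [hD]
    linarith
  have hEQ : ∫⁻ ω, ENNReal.ofReal (Q ω) ∂P ≤ ENNReal.ofReal
      (4 * ((K' * √N) ^ 2 * N ^ 2 + (K * D) ^ 2 + T ^ 2) * (1 / n +
        (∑ j ∈ Finset.Ico W.j₀ (min q (level n)), √(2 ^ j) * s j) ^ 2 + ((n : ℝ) ^ (-α)) ^ 2)) := by
    set A := (∑ j ∈ Finset.Ico W.j₀ (min q (level n)), √(2 ^ j) * s j) ^ 2 with hA
    have hA0 : 0 ≤ A := sq_nonneg _
    have h1 : ∀ ω, ENNReal.ofReal (Q ω) =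
        ENNReal.ofReal (4 * (K' * √N) ^ 2 / n) * ENNReal.ofReal (X ω) +
          ENNReal.ofReal (4 * K ^ 2) * ENNReal.ofReal (Y ω) + ENNReal.ofReal (4 * t ^ 2) := by
      intro ω
      have := hX0 ω
      have := hY0 ω
      rw [← ENNReal.ofReal_mul (by positivity), ← ENNReal.ofReal_mul (by positivity),
        ← ENNReal.ofReal_add (by positivity) (by positivity),
        ← ENNReal.ofReal_add (by positivity) (by positivity)]
    simp_rw [h1]
    rw [lintegral_add_right _ measurable_const, lintegral_add_left (by fun_prop),
      lintegral_const_mul' _ _ ENNReal.ofReal_ne_top, lintegral_const_mul' _ _ ENNReal.ofReal_ne_top,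
      lintegral_const, measure_univ, mul_one]
    calc _ ≤ ENNReal.ofReal (4 * (K' * √N) ^ 2 / n) * ENNReal.ofReal (N ^ 2) +
          ENNReal.ofReal (4 * K ^ 2) * ENNReal.ofReal (D ^ 2 * A) + ENNReal.ofReal (4 * t ^ 2) := by
          gcongr
      _ = ENNReal.ofReal (4 * (K' * √N) ^ 2 / n * N ^ 2 + 4 * K ^ 2 * (D ^ 2 * A) + 4 * t ^ 2) := by
          rw [← ENNReal.ofReal_mul (by positivity), ← ENNReal.ofReal_mul (by positivity),
            ← ENNReal.ofReal_add (by positivity) (by positivity),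
            ← ENNReal.ofReal_add (by positivity) (by positivity)]
      _ ≤ _ := by
          refine ENNReal.ofReal_le_ofReal ?_
          have e1 : 4 * (K' * √N) ^ 2 / (n : ℝ) * N ^ 2 + 4 * K ^ 2 * (D ^ 2 * A) + 4 * t ^ 2 =
              4 * ((K' * √N) ^ 2 * N ^ 2) * (1 / n) + 4 * (K * D) ^ 2 * A +
                4 * T ^ 2 * ((n : ℝ) ^ (-α)) ^ 2 := by
            rw [ht]
            ring
          rw [e1]
          exact four_mul_add_le (mul_nonneg (sq_nonneg _) (sq_nonneg _)) (sq_nonneg _)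
            (sq_nonneg _) (one_div_nonneg.2 hn'.le) hA0 (sq_nonneg _)
  -- For c = 0 the hypothesis on q empties the set of fine levels, and 2/c is 0 by convention, so
  -- the same bound covers the pointwise risk.
  rcases hc.eq_or_lt with rfl | hc
  · have hSf0 : Sf = ∅ := by
      rw [hSf, nearIndex, Finset.Ico_eq_empty_of_le (hc0 rfl)]
      rfl
    refine (risk_le_of_zero fun ω => (hpt ω x₀ (by simp)).trans (le_of_eq ?_)).trans
      (hEQ.trans (le_of_eq ?_))
    · simp [hV, hSf0]
    · simp
  · refine (risk_le_of_pos hc hQm hQ0 hpt (R := fun ω => ∑ p ∈ Sf, δ p ω ^ 2) fun ω =>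
      W.lintegral_sum_sq_le Sf (fun p hp => mem_index_of_mem_nearIndex hq hp) (fun p => δ p ω)
        hI).trans ?_
    rw [ENNReal.ofReal_add (by positivity) (by positivity),
      ENNReal.ofReal_mul (p := 2 / c) (by positivity)]
    gcongr

end

section

variable {Ω : Type*} [MeasurableSpace Ω] {P : Measure Ω} {B : ℝ≥0 → Ω → ℝ}
variable {r : ℕ} {W : WaveletBasis r}

/-! ### Mean square errors of the coefficients -/

/-- The exponent `2α / (1 + 2α)` of the minimax rate. -/
def rate (α : ℝ) : ℝ := 2 * α / (1 + 2 * α)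

lemma rate_pos {α : ℝ} (hα : 0 < α) : 0 < rate α := by unfold rate; positivity

lemma rate_lt_one {α : ℝ} (hα : 0 < α) : rate α < 1 := by
  unfold rate
  rw [div_lt_one (by positivity)]
  linarith

/-- The bound on the root mean square error of a coefficient at level `j`, for the noise
level `τ`. -/
def levelError (α : ℝ) (n : ℕ) (τ : ℝ) (j : ℕ) : ℝ :=
  min τ (((2 : ℝ) ^ j) ^ (-(α + 1 / 2))) + (n : ℝ) ^ (-((1 + rate α) / 2))

lemma levelError_pos {α : ℝ} {n : ℕ} (hn : 0 < n) {τ : ℝ} (hτ : 0 ≤ τ) (j : ℕ) :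
    0 < levelError α n τ j := by
  have : (0 : ℝ) < n := by exact_mod_cast hn
  exact add_pos_of_nonneg_of_pos (le_min hτ (by positivity)) (by positivity)

/-- The indices of the block of `(j, k)`. -/
def blockIndex (L j k : ℕ) : Finset (Σ _ : ℕ, ℕ) :=
  (blockOf L j k).map (Function.Embedding.sigmaMk (β := fun _ : ℕ => ℕ) j)

lemma mem_blockIndex {L j k : ℕ} {p : Σ _ : ℕ, ℕ} :
    p ∈ blockIndex L j k ↔ p.1 = j ∧ p.2 ∈ blockOf L j k := by
  obtain ⟨i, l⟩ := p
  simp only [blockIndex, Finset.mem_map, Function.Embedding.sigmaMk_apply]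
  constructor
  · rintro ⟨a, ha, h⟩
    obtain ⟨rfl, h2⟩ := Sigma.mk.inj_iff.1 h
    obtain rfl := eq_of_heq h2
    exact ⟨rfl, ha⟩
  · rintro ⟨rfl, h⟩
    exact ⟨l, h, rfl⟩

lemma self_mem_blockOf {L j k : ℕ} (hk : k ∈ Finset.Icc 1 (2 ^ j)) : k ∈ blockOf L j k :=
  Finset.mem_filter.2 ⟨hk, rfl⟩

lemma blockOf_eq {L j k k' : ℕ} (hk' : k' ∈ blockOf L j k) : blockOf L j k' = blockOf L j k := by
  unfold blockOf
  rw [(Finset.mem_filter.1 hk').2]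

lemma card_blockIndex_le {L : ℕ} (hL : 1 ≤ L) (j k : ℕ) : (blockIndex L j k).card ≤ L := by
  rw [blockIndex, Finset.card_map]
  set b := (k - 1) / L with hb
  have : blockOf L j k ⊆ Finset.Ico (b * L + 1) (b * L + L + 1) := by
    intro k' hk'
    obtain ⟨h1, h2⟩ := Finset.mem_filter.1 hk'
    rw [← hb] at h2
    have h3 := (Finset.mem_Icc.1 h1).1
    have h4 := Nat.div_mul_le_self (k' - 1) L
    have h5 := Nat.lt_div_mul_add (a := k' - 1) (b := L) hL
    rw [h2] at h4 h5
    rw [Finset.mem_Ico]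
    omega
  refine (Finset.card_le_card this).trans ?_
  rw [Nat.card_Ico]
  omega

lemma blockIndex_subset_index {L j : ℕ} (hj : W.j₀ ≤ j) (k : ℕ) :
    (blockIndex L j k : Set (Σ _ : ℕ, ℕ)) ⊆ W.index := by
  rintro ⟨i, l⟩ hp
  obtain ⟨h1, h2⟩ := mem_blockIndex.1 hp
  dsimp only at h1 h2
  subst h1
  exact ⟨hj, (Finset.mem_filter.1 h2).1⟩

lemma blockShrink_empCoeff {n : ℕ} (hn : 0 < n) (f : ℝ → ℝ) (L : ℕ) (lam : ℝ) (p : Σ _ : ℕ, ℕ)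
    (ω : Ω) : blockShrink n L lam (fun j k => empCoeff P W B n f j k ω) p.1 p.2 =
      jsFactor n lam L (∑ q ∈ blockIndex L p.1 p.2,
        (W.coeff f q.1 q.2 + 1 / √(n : ℝ) * noise P W B n f q ω) ^ 2) *
        (W.coeff f p.1 p.2 + 1 / √(n : ℝ) * noise P W B n f p ω) := by
  rw [blockIndex, Finset.sum_map, add_noise hn]
  simp only [Function.Embedding.sigmaMk_apply, add_noise hn, blockShrink]

lemma coeffError_of_soft {n : ℕ} (hn : 0 < n) (f : ℝ → ℝ) {x₀ c : ℝ} (L : ℕ) (lam : ℝ)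
    {p : Σ _ : ℕ, ℕ} (hp : p.1 < level n) (hc : Real.log n / n < c)
    (hpv : p ∉ verticalBlock W x₀ c n) (hps : p.1 < level (c⁻¹ * Real.log n)) (ω : Ω) :
    coeffError P W B n f x₀ c L lam p ω =
      softThreshold n (W.coeff f p.1 p.2 + 1 / √(n : ℝ) * noise P W B n f p ω) -
        W.coeff f p.1 p.2 := by
  rw [coeffError, adaptiveCoeff, if_pos hc, hybridCoeff, if_neg (not_le.2 hp), if_neg hpv,
    if_pos hps, add_noise hn]

lemma fst_lt_of_mem_verticalBlock {x₀ c : ℝ} {n : ℕ} {p : Σ _ : ℕ, ℕ}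
    (hp : p ∈ verticalBlock W x₀ c n) : p.1 < level (c⁻¹ * Real.log n) := by
  classical
  exact (Finset.mem_Ico.1 (Finset.mem_sigma.1 (Finset.mem_filter.1 hp).1).1).2

lemma coeffError_of_block {n : ℕ} (hn : 0 < n) (f : ℝ → ℝ) {x₀ c : ℝ} (L : ℕ) (lam : ℝ)
    {p : Σ _ : ℕ, ℕ} (hp : p.1 < level n)
    (hc : Real.log n / n < c → level (c⁻¹ * Real.log n) ≤ p.1) (ω : Ω) :
    coeffError P W B n f x₀ c L lam p ω =
      jsFactor n lam L (∑ q ∈ blockIndex L p.1 p.2,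
        (W.coeff f q.1 q.2 + 1 / √(n : ℝ) * noise P W B n f q ω) ^ 2) *
        (W.coeff f p.1 p.2 + 1 / √(n : ℝ) * noise P W B n f p ω) - W.coeff f p.1 p.2 := by
  rw [coeffError, adaptiveCoeff, ← blockShrink_empCoeff hn]
  split_ifs with h
  · rw [hybridCoeff, if_neg (not_le.2 hp),
      if_neg fun h' => not_lt.2 (hc h) (fst_lt_of_mem_verticalBlock h'), if_neg (not_lt.2 (hc h))]
  · rw [blockJSCoeff, if_pos hp]

lemma coeffError_of_mem_verticalBlock {n : ℕ} (hn : 0 < n) (f : ℝ → ℝ) {x₀ c : ℝ} (L : ℕ)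
    (lam : ℝ) {p : Σ _ : ℕ, ℕ} (hp : p.1 < level n) (hc : Real.log n / n < c)
    (hpv : p ∈ verticalBlock W x₀ c n) (ω : Ω) :
    coeffError P W B n f x₀ c L lam p ω =
      jsFactor n lam (verticalBlock W x₀ c n).card (∑ q ∈ verticalBlock W x₀ c n,
        (W.coeff f q.1 q.2 + 1 / √(n : ℝ) * noise P W B n f q ω) ^ 2) *
        (W.coeff f p.1 p.2 + 1 / √(n : ℝ) * noise P W B n f p ω) - W.coeff f p.1 p.2 := by
  simp only [add_noise hn]
  rw [coeffError, adaptiveCoeff, if_pos hc, hybridCoeff, if_neg (not_le.2 hp), if_pos hpv]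

/-! ### Numerical bounds -/

/-- The second term of `levelError` is the root of the exponential price exp(-κ₀ m)/n at κ₀ = `rate
α` and m = log n. -/
lemma sq_rpow_neg_rate {n : ℕ} (hn : 0 < n) (α : ℝ) :
    ((n : ℝ) ^ (-((1 + rate α) / 2))) ^ 2 = Real.exp (-(rate α * Real.log n)) / n := by
  have hn' : (0 : ℝ) < n := by exact_mod_cast hn
  rw [← Real.rpow_natCast, ← Real.rpow_mul hn'.le, eq_div_iff hn'.ne', Real.rpow_def_of_pos hn',
    ← Real.exp_log hn', Real.log_exp, ← Real.exp_add]
  congr 1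
  push_cast
  ring

lemma min_le_mul_min_sq {a b t A τ : ℝ} (ha : a ≤ A ^ 2 * b ^ 2) (ht : t ≤ A ^ 2 * τ ^ 2) :
    min a t ≤ A ^ 2 * min τ b ^ 2 := by
  rcases le_total τ b with h | h
  · rw [min_eq_left h]
    exact (min_le_right _ _).trans ht
  · rw [min_eq_right h]
    exact (min_le_left _ _).trans ha

lemma mul_add_le_sq {C A x y : ℝ} (hC : 0 ≤ C) (hA : 0 ≤ A) (hx : 0 ≤ x) (hy : 0 ≤ y) :
    C * (A ^ 2 * x ^ 2 + 3 * y ^ 2) ≤ ((C + 1) * (A + 2) * (x + y)) ^ 2 := by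
  have h1 : C ≤ (C + 1) ^ 2 := by nlinarith
  have h2 : A ^ 2 * x ^ 2 + 3 * y ^ 2 ≤ (A + 2) ^ 2 * (x + y) ^ 2 := by
    have h3 : A ^ 2 * x ^ 2 ≤ (A + 2) ^ 2 * x ^ 2 := by gcongr; linarith
    have h4 : 3 * y ^ 2 ≤ (A + 2) ^ 2 * y ^ 2 := by gcongr; nlinarith
    have h5 : (A + 2) ^ 2 * (x ^ 2 + y ^ 2) ≤ (A + 2) ^ 2 * (x + y) ^ 2 := by
      gcongr
      nlinarith [mul_nonneg hx hy]
    linarith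
  calc _ ≤ (C + 1) ^ 2 * ((A + 2) ^ 2 * (x + y) ^ 2) := by gcongr
    _ = _ := by ring

/-- A block shorter than log n by at most a constant D loses only the factor e^D, so rounding the
block length is harmless. -/
lemma exp_neg_mul_le {κ₀ x y : ℝ} (hκ : 0 ≤ κ₀) (hκ1 : κ₀ ≤ 1) {D : ℝ} (hD : 0 ≤ D)
    (h : y - D ≤ x) : Real.exp (-(κ₀ * x)) ≤ Real.exp D * Real.exp (-(κ₀ * y)) := by
  rw [← Real.exp_add, Real.exp_le_exp]
  nlinarith [mul_le_mul_of_nonneg_left h hκ, mul_le_mul_of_nonneg_right hκ1 hD]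

lemma blockLength_bounds {n L : ℕ} (hn : 1 ≤ Real.log n) (hL : |(L : ℝ) - Real.log n| < 1) :
    1 ≤ L ∧ (L : ℝ) ≤ 2 * Real.log n ∧ Real.log n - 1 ≤ L := by
  obtain ⟨h1, h2⟩ := abs_lt.1 hL
  refine ⟨?_, by linarith, by linarith⟩
  have : (0 : ℝ) < L := by linarith
  exact_mod_cast this

lemma pos_of_one_le_log {n : ℕ} (hn : 1 ≤ Real.log n) : 0 < n := by
  rcases Nat.eq_zero_or_pos n with rfl | h
  · norm_num at hn
  · exact h

/-- Soft thresholding and block thresholding have, up to a constant, the mean square error of an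
oracle for each coefficient. -/
lemma exists_lintegral_coeffError_sq_le [IsProbabilityMeasure P] (hB : IsPreBrownianReal B P)
    (W : WaveletBasis r) {α M : ℝ} (hα : 0 < α) (hαr : α < r) (hM : 0 < M) {lam : ℝ}
    (hlam_gt : 1 < lam) (hlam : lam - Real.log lam - 1 = 2) :
    ∃ C : ℝ, 0 < C ∧ ∀ f ∈ holderClass α M, ∀ {n : ℕ} (_ : 1 ≤ Real.log n) {L : ℕ}
      (_ : |(L : ℝ) - Real.log n| < 1) {x₀ c : ℝ} {p : Σ _ : ℕ, ℕ} (_ : p ∈ W.index)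
      (_ : p.1 < level n) (_ : Real.log n / n < c → p ∉ verticalBlock W x₀ c n),
      ∫⁻ ω, ENNReal.ofReal (coeffError P W B n f x₀ c L lam p ω ^ 2) ∂P ≤
        ENNReal.ofReal ((C * levelError α n √(Real.log n / n) p.1) ^ 2) := by
  obtain ⟨C₀, hC₀, hcoeff⟩ := W.exists_abs_coeff_le hα hαr hM
  obtain ⟨C₁, hC₁, hsoft⟩ := exists_lintegral_softThreshold_le (rate_pos hα) (rate_lt_one hα)
  obtain ⟨C₂, hC₂, hblock⟩ := exists_lintegral_jsFactor_le hlam_gt hlam (rate_lt_one hα)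
  set A := C₀ + 2 with hA
  have hA0 : 0 < A := by positivity
  refine ⟨(C₁ + C₂ + 1) * (A + 2), by positivity, ?_⟩
  intro f hf n hn L hL x₀ c p hp hpn hpv
  have hn0 := pos_of_one_le_log hn
  have hn' : (0 : ℝ) < n := by exact_mod_cast hn0
  have hz := stdNormalMoments_noise (W := W) hB hn0 (holderClass.continuousOn hf)
  obtain ⟨hL1, hL2, hL3⟩ := blockLength_bounds hn hL
  set τ := √(Real.log n / n) with hτ
  have hτsq : τ ^ 2 = Real.log n / n := Real.sq_sqrt (by positivity)
  set b := ((2 : ℝ) ^ p.1) ^ (-(α + 1 / 2)) with hb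
  have hb0 : 0 < b := by positivity
  set ν := (n : ℝ) ^ (-((1 + rate α) / 2)) with hν
  have hν0 : 0 < ν := by positivity
  have hνsq : ν ^ 2 = Real.exp (-(rate α * Real.log n)) / n := sq_rpow_neg_rate hn0 α
  have hcoeff_sq : ∀ q ∈ W.index, q.1 = p.1 → W.coeff f q.1 q.2 ^ 2 ≤ (C₀ * b) ^ 2 := by
    intro q hq h
    rw [← sq_abs, hb, ← h]
    exact pow_le_pow_left₀ (abs_nonneg _) (hcoeff f hf q.1 hq.1 q.2 hq.2) 2
  have hfirst : (C₀ * b) ^ 2 ≤ A ^ 2 * b ^ 2 := by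
    rw [← mul_pow]
    gcongr
    linarith
  have hmin0 : 0 ≤ min τ b := le_min (Real.sqrt_nonneg _) hb0.le
  -- Here m is L for a block and log n for soft thresholding, so both rules end in the same bound.
  have hfinal : ∀ {C : ℝ}, 0 ≤ C → C ≤ C₁ + C₂ → ∀ {m : ℝ}, m ≤ 2 * Real.log n →
      Real.log n - 1 ≤ m → C * (min ((C₀ * b) ^ 2) (m / n) + Real.exp (-(rate α * m)) / n) ≤
        ((C₁ + C₂ + 1) * (A + 2) * levelError α n τ p.1) ^ 2 := by
    intro C hC hC' m hm1 hm2
    have hm0 : 0 ≤ m := by linarith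
    have h1 : min ((C₀ * b) ^ 2) (m / n) ≤ A ^ 2 * min τ b ^ 2 := by
      refine min_le_mul_min_sq hfirst ?_
      have hA2 : 2 ≤ A ^ 2 := by nlinarith
      rw [hτsq, ← mul_div_assoc]
      exact div_le_div_of_nonneg_right (hm1.trans (by gcongr)) hn'.le
    have h2 : Real.exp (-(rate α * m)) / n ≤ 3 * ν ^ 2 := by
      rw [hνsq, ← mul_div_assoc]
      gcongr
      refine (exp_neg_mul_le (rate_pos hα).le (rate_lt_one hα).le zero_le_one hm2).trans ?_
      gcongr
      exact Real.exp_one_lt_d9.le.trans (by norm_num)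
    calc _ ≤ (C₁ + C₂) * (A ^ 2 * min τ b ^ 2 + 3 * ν ^ 2) := by gcongr
      _ ≤ _ := mul_add_le_sq (by positivity) hA0.le hmin0 hν0.le
  by_cases hcase : Real.log n / n < c → level (c⁻¹ * Real.log n) ≤ p.1
  · simp_rw [coeffError_of_block hn0 f L lam hpn hcase]
    refine (hblock hz hn0 hL1 (blockIndex_subset_index hp.1 p.2) (card_blockIndex_le hL1 _ _)
      (T := (C₀ * b) ^ 2) (fun q hq => ?_)
      (mem_blockIndex.2 ⟨rfl, self_mem_blockOf hp.2⟩)).trans (ENNReal.ofReal_le_ofReal ?_)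
    · exact hcoeff_sq q (blockIndex_subset_index hp.1 p.2 hq) (mem_blockIndex.1 hq).1
    · exact hfinal hC₂.le (by linarith) hL2 hL3
  · push Not at hcase
    simp_rw [coeffError_of_soft hn0 f L lam hpn hcase.1 (hpv hcase.1) hcase.2]
    refine (hsoft hz hn hp (T := (C₀ * b) ^ 2) (hcoeff_sq p hp rfl)).trans
      (ENNReal.ofReal_le_ofReal ?_)
    exact hfinal hC₁.le (by linarith) (by linarith) (by linarith)

/-- The mean square errors of the coefficients near `x₀` at a level with many blocks. -/
lemma exists_lintegral_sum_near_block_le [IsProbabilityMeasure P] (hB : IsPreBrownianReal B P)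
    (W : WaveletBasis r) {α M : ℝ} (hα : 0 < α) (hαr : α < r) (hM : 0 < M) {lam : ℝ}
    (hlam_gt : 1 < lam) (hlam : lam - Real.log lam - 1 = 2) :
    ∃ C : ℝ, 0 < C ∧ ∀ f ∈ holderClass α M, ∀ {n : ℕ} (_ : 1 ≤ Real.log n) {L : ℕ}
      (_ : |(L : ℝ) - Real.log n| < 1) {x₀ c : ℝ} (_ : 0 ≤ c) {j : ℕ} (_ : W.j₀ ≤ j)
      (_ : j < level n) (_ : level (c⁻¹ * Real.log n) ≤ j) (_ : Real.log n ≤ c * 2 ^ j),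
      ∫⁻ ω, ENNReal.ofReal (∑ k ∈ W.ψ.near x₀ c j,
        coeffError P W B n f x₀ c L lam ⟨j, k⟩ ω ^ 2) ∂P ≤
        ENNReal.ofReal (C * (c * 2 ^ j) * levelError α n √(1 / n) j ^ 2) := by
  classical
  obtain ⟨C₀, hC₀, hcoeff⟩ := W.exists_abs_coeff_le hα hαr hM
  obtain ⟨C₂, hC₂, hblock⟩ := exists_lintegral_sum_jsFactor_le hlam_gt hlam (rate_lt_one hα)
  set A := C₀ + 2 with hA
  have hA0 : 0 < A := by positivity
  set E : ℝ := 2 * W.ψ.edges + 3 with hE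
  refine ⟨(2 + 2 * E) * ((C₂ + 1) * (A + 2)) ^ 2, by positivity, ?_⟩
  intro f hf n hn L hL x₀ c hc j hj hjn hjl hcj
  have hn0 := pos_of_one_le_log hn
  have hn' : (0 : ℝ) < n := by exact_mod_cast hn0
  have hz := stdNormalMoments_noise (W := W) hB hn0 (holderClass.continuousOn hf)
  obtain ⟨hL1, hL2, hL3⟩ := blockLength_bounds hn hL
  have hL0 : (0 : ℝ) < L := by exact_mod_cast hL1
  set τ := √(1 / (n : ℝ)) with hτ
  have hτsq : τ ^ 2 = 1 / n := Real.sq_sqrt (by positivity)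
  set b := ((2 : ℝ) ^ j) ^ (-(α + 1 / 2)) with hb
  have hb0 : 0 < b := by positivity
  set ν := (n : ℝ) ^ (-((1 + rate α) / 2)) with hν
  have hν0 : 0 < ν := by positivity
  have hνsq : ν ^ 2 = Real.exp (-(rate α * Real.log n)) / n := sq_rpow_neg_rate hn0 α
  have hmin0 : 0 ≤ min τ b := le_min (Real.sqrt_nonneg _) hb0.le
  set δ := fun k => coeffError P W B n f x₀ c L lam ⟨j, k⟩ with hδ
  have hδm : ∀ k, Measurable (δ k) := fun k => measurable_coeffError n f x₀ c L lam _
  set G := W.ψ.near x₀ c j with hG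
  have hone : ∀ k₀, ∫⁻ ω, ENNReal.ofReal (∑ k ∈ blockOf L j k₀, δ k ω ^ 2) ∂P ≤
      ENNReal.ofReal (L * ((C₂ + 1) * (A + 2) * levelError α n τ j) ^ 2) := by
    intro k₀
    have h1 : ∀ ω, ∑ k ∈ blockOf L j k₀, δ k ω ^ 2 = ∑ p ∈ blockIndex L j k₀,
        (jsFactor n lam L (∑ q ∈ blockIndex L j k₀,
          (W.coeff f q.1 q.2 + 1 / √(n : ℝ) * noise P W B n f q ω) ^ 2) *
          (W.coeff f p.1 p.2 + 1 / √(n : ℝ) * noise P W B n f p ω) - W.coeff f p.1 p.2) ^ 2 := by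
      intro ω
      conv_rhs => rw [blockIndex, Finset.sum_map]
      refine Finset.sum_congr rfl fun k hk => ?_
      rw [hδ, Function.Embedding.sigmaMk_apply]
      dsimp only
      rw [coeffError_of_block hn0 f L lam hjn fun _ => hjl]
      dsimp only
      rw [← blockIndex, show blockIndex L j k = blockIndex L j k₀ by
        unfold blockIndex; rw [blockOf_eq hk]]
    simp_rw [h1]
    refine (hblock hz hn0 (blockIndex_subset_index hj k₀) (card_blockIndex_le hL1 j k₀)
      fun p => W.coeff f p.1 p.2).trans (ENNReal.ofReal_le_ofReal ?_)
    have h2 : ∑ p ∈ blockIndex L j k₀, W.coeff f p.1 p.2 ^ 2 ≤ L * (C₀ * b) ^ 2 := by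
      refine (Finset.sum_le_card_nsmul _ _ ((C₀ * b) ^ 2) fun q hq => ?_).trans ?_
      · have hq' := blockIndex_subset_index (W := W) hj k₀ hq
        rw [← sq_abs, hb, ← (mem_blockIndex.1 hq).1]
        exact pow_le_pow_left₀ (abs_nonneg _) (hcoeff f hf q.1 hq'.1 q.2 hq'.2) 2
      · rw [nsmul_eq_mul]
        gcongr
        exact card_blockIndex_le hL1 j k₀
    have h3 : min (∑ p ∈ blockIndex L j k₀, W.coeff f p.1 p.2 ^ 2) ((L : ℝ) / n) ≤
        L * (A ^ 2 * min τ b ^ 2) := by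
      have h4 : min ((C₀ * b) ^ 2) (1 / (n : ℝ)) ≤ A ^ 2 * min τ b ^ 2 := by
        refine min_le_mul_min_sq ?_ ?_
        · rw [← mul_pow]
          gcongr
          linarith
        · rw [hτsq]
          exact le_mul_of_one_le_left (by positivity) (by nlinarith)
      refine le_trans ?_ (mul_le_mul_of_nonneg_left h4 hL0.le)
      rw [mul_min_of_nonneg _ _ hL0.le, mul_one_div]
      exact min_le_min_right _ h2
    have h5 : (L : ℝ) / n * Real.exp (-(rate α * L)) ≤ L * (3 * ν ^ 2) := by
      rw [hνsq, div_mul_eq_mul_div, mul_div_assoc, ← mul_div_assoc 3]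
      gcongr
      refine (exp_neg_mul_le (rate_pos hα).le (rate_lt_one hα).le zero_le_one hL3).trans ?_
      gcongr
      exact Real.exp_one_lt_d9.le.trans (by norm_num)
    calc _ ≤ C₂ * (L * (A ^ 2 * min τ b ^ 2) + L * (3 * ν ^ 2)) := by gcongr
      _ = L * (C₂ * (A ^ 2 * min τ b ^ 2 + 3 * ν ^ 2)) := by ring
      _ ≤ _ := by
        gcongr
        exact mul_add_le_sq hC₂.le hA0.le hmin0 hν0.le
  -- The nearby indices are grouped by block, and each group is enlarged to its full block, to which
  -- the oracle inequality applies.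
  have hfib : ∀ ω, ∑ k ∈ G, δ k ω ^ 2 = ∑ b ∈ G.image fun k => (k - 1) / L,
      ∑ k ∈ G with (k - 1) / L = b, δ k ω ^ 2 := fun ω =>
    (Finset.sum_fiberwise_of_maps_to (fun k hk => Finset.mem_image_of_mem _ hk) _).symm
  calc ∫⁻ ω, ENNReal.ofReal (∑ k ∈ G, δ k ω ^ 2) ∂P
      = ∑ b ∈ G.image fun k => (k - 1) / L,
          ∫⁻ ω, ENNReal.ofReal (∑ k ∈ G with (k - 1) / L = b, δ k ω ^ 2) ∂P := by
        rw [← lintegral_finsetSum _ fun b _ =>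
          (Finset.measurable_sum _ fun k _ => (hδm k).pow_const 2).ennreal_ofReal]
        refine lintegral_congr fun ω => ?_
        rw [hfib, ENNReal.ofReal_sum_of_nonneg fun b _ => Finset.sum_nonneg fun k _ => sq_nonneg _]
    _ ≤ ∑ b ∈ G.image fun k => (k - 1) / L,
          ENNReal.ofReal (L * ((C₂ + 1) * (A + 2) * levelError α n τ j) ^ 2) := by
        refine Finset.sum_le_sum fun b hb => ?_
        obtain ⟨k₀, hk₀, rfl⟩ := Finset.mem_image.1 hb
        refine le_trans (lintegral_mono fun ω => ENNReal.ofReal_le_ofReal ?_) (hone k₀)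
        refine Finset.sum_le_sum_of_subset_of_nonneg (fun k hk => ?_) fun _ _ _ => sq_nonneg _
        rw [Finset.mem_filter] at hk
        exact Finset.mem_filter.2 ⟨EdgeFamily.near_subset _ _ _ _ hk.1, hk.2⟩
    _ = ENNReal.ofReal ((G.image fun k => (k - 1) / L).card *
          (L * ((C₂ + 1) * (A + 2) * levelError α n τ j) ^ 2)) := by
        rw [Finset.sum_const, nsmul_eq_mul,
          ENNReal.ofReal_mul (p := (Finset.card _ : ℝ)) (Nat.cast_nonneg _), ENNReal.ofReal_natCast]
    _ ≤ _ := by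
        refine ENNReal.ofReal_le_ofReal ?_
        have h1 := W.ψ_fits.card_image_near_le x₀ hc j (L := L) (by omega)
        -- Since L ≤ 2 log n ≤ 2c 2^j, the blocks that stick out of the neighborhood are absorbed:
        -- the total block length has order c 2^j and no logarithm is lost.
        have h2 : (2 * c * 2 ^ j / L + E) * L ≤ (2 + 2 * E) * (c * 2 ^ j) := by
          rw [add_mul, div_mul_cancel₀ _ hL0.ne']
          have : E * L ≤ E * (2 * (c * 2 ^ j)) := by gcongr; linarith
          linarith
        calc _ ≤ (2 * c * 2 ^ j / L + E) *
              (L * ((C₂ + 1) * (A + 2) * levelError α n τ j) ^ 2) := by gcongr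
          _ = (2 * c * 2 ^ j / L + E) * L * ((C₂ + 1) * (A + 2) * levelError α n τ j) ^ 2 := by
            ring
          _ ≤ (2 + 2 * E) * (c * 2 ^ j) * ((C₂ + 1) * (A + 2) * levelError α n τ j) ^ 2 := by
            gcongr
          _ = _ := by ring

end

section

variable {Ω : Type*} [MeasurableSpace Ω] {P : Measure Ω} {B : ℝ≥0 → Ω → ℝ}
variable {r : ℕ} {W : WaveletBasis r}

/-! ### Geometric sums over levels -/

lemma sum_range_two_pow_le (J : ℕ) : ∑ j ∈ Finset.range J, (2 : ℝ) ^ j ≤ 2 ^ J := by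
  rw [geom_sum_eq (by norm_num)]
  norm_num

lemma sum_range_sqrt_two_pow_le (J : ℕ) :
    ∑ j ∈ Finset.range J, √((2 : ℝ) ^ j) ≤ 4 * √(2 ^ J) := by
  induction J with
  | zero => simp
  | succ J ih =>
    -- This closes the induction: 4 + 1 ≤ 4√2.
    have h2 : (5 / 4 : ℝ) ≤ √2 := Real.le_sqrt_of_sq_le (by norm_num)
    rw [Finset.sum_range_succ, pow_succ, Real.sqrt_mul (by positivity)]
    nlinarith [Real.sqrt_nonneg ((2 : ℝ) ^ J)]

lemma sum_Ico_two_pow_rpow_neg_le {a : ℝ} (ha : 0 < a) (q J : ℕ) :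
    ∑ j ∈ Finset.Ico q J, ((2 : ℝ) ^ j) ^ (-a) ≤ (1 - (2 : ℝ) ^ (-a))⁻¹ * ((2 : ℝ) ^ q) ^ (-a) := by
  have h0 : (0 : ℝ) ≤ 2 ^ (-a) := by positivity
  rw [Finset.sum_Ico_eq_sum_range]
  simp_rw [two_pow_rpow_neg]
  rw [← Finset.mul_sum, mul_comm]
  gcongr
  rw [← tsum_geometric_of_lt_one h0 (two_rpow_neg_lt_one ha)]
  exact (summable_geometric_of_lt_one h0 (two_rpow_neg_lt_one ha)).sum_le_tsum _
    fun _ _ => by positivity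

lemma sqrt_two_pow_mul_rpow (α : ℝ) (j : ℕ) :
    √((2 : ℝ) ^ j) * ((2 : ℝ) ^ j) ^ (-(α + 1 / 2)) = ((2 : ℝ) ^ j) ^ (-α) := by
  rw [Real.sqrt_eq_rpow, ← Real.rpow_add (by positivity)]
  congr 1
  ring

/-- Below the crossover 2^j = τ^{-2/(1+2α)} the terms 2^{j/2}τ grow geometrically, above it the
terms 2^{-jα} decay. Both sums have the order of the value at the crossover, τ^{2α/(1+2α)}. -/
lemma exists_sum_sqrt_mul_min_le {α : ℝ} (hα : 0 < α) :
    ∃ C : ℝ, 0 < C ∧ ∀ {τ : ℝ} (_ : 0 < τ) (N : ℕ),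
      ∑ j ∈ Finset.range N, √((2 : ℝ) ^ j) * min τ (((2 : ℝ) ^ j) ^ (-(α + 1 / 2))) ≤
        C * τ ^ rate α := by
  have hq : 0 < 1 - (2 : ℝ) ^ (-α) := sub_pos.2 (two_rpow_neg_lt_one hα)
  refine ⟨8 + (1 - (2 : ℝ) ^ (-α))⁻¹, by positivity, fun {τ} hτ N => ?_⟩
  set x := τ ^ (-(2 / (1 + 2 * α))) with hx
  have hx0 : 0 < x := by positivity
  set q := level x with hqdef
  have hsplit : ∑ j ∈ Finset.range N, √((2 : ℝ) ^ j) * min τ (((2 : ℝ) ^ j) ^ (-(α + 1 / 2))) ≤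
      ∑ j ∈ Finset.range q, √((2 : ℝ) ^ j) * τ + ∑ j ∈ Finset.Ico q N, ((2 : ℝ) ^ j) ^ (-α) := by
    have hsub : Finset.range N ⊆ Finset.range q ∪ Finset.Ico q N := by
      intro j hj
      simp only [Finset.mem_union, Finset.mem_range, Finset.mem_Ico] at hj ⊢
      omega
    have hdisj : Disjoint (Finset.range q) (Finset.Ico q N) := by
      rw [Finset.disjoint_left]
      intro j h1 h2
      rw [Finset.mem_range] at h1
      rw [Finset.mem_Ico] at h2
      omega
    refine (Finset.sum_le_sum_of_subset_of_nonneg hsub fun j _ _ =>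
      mul_nonneg (Real.sqrt_nonneg _) (le_min hτ.le (by positivity))).trans ?_
    rw [Finset.sum_union hdisj]
    refine add_le_add (Finset.sum_le_sum fun j _ => ?_) (Finset.sum_le_sum fun j _ => ?_)
    · gcongr
      exact min_le_left _ _
    · rw [← sqrt_two_pow_mul_rpow α j]
      gcongr
      exact min_le_right _ _
  have h1 : ∑ j ∈ Finset.range q, √((2 : ℝ) ^ j) * τ ≤ 8 * τ ^ rate α := by
    rcases Nat.eq_zero_or_pos q with h | h
    · rw [h, Finset.sum_range_zero]
      positivity
    · rw [← Finset.sum_mul]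
      have h2 : (2 : ℝ) ^ q ≤ 2 * x := by
        have h3 := two_pow_lt_of_lt_level (x := x) (Nat.sub_lt h one_pos)
        have h3' : (2 : ℝ) ^ q = 2 * 2 ^ (q - 1) := by rw [← pow_succ', Nat.sub_add_cancel h]
        rw [← hqdef] at h3
        linarith
      have h4 : √((2 : ℝ) ^ q) ≤ 2 * √x := by
        rw [show (2 : ℝ) * √x = √(2 ^ 2 * x) by
          rw [Real.sqrt_mul (by norm_num), Real.sqrt_sq (by norm_num)]]
        exact Real.sqrt_le_sqrt (by linarith)
      have h5 : √x * τ = τ ^ rate α := by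
        rw [Real.sqrt_eq_rpow, hx, ← Real.rpow_mul hτ.le]
        nth_rewrite 2 [← Real.rpow_one τ]
        rw [← Real.rpow_add hτ]
        congr 1
        unfold rate
        field_simp
        ring
      calc _ ≤ 4 * √((2 : ℝ) ^ q) * τ := by gcongr; exact sum_range_sqrt_two_pow_le q
        _ ≤ 4 * (2 * √x) * τ := by gcongr
        _ = 8 * (√x * τ) := by ring
        _ = _ := by rw [h5]
  have h2 : ∑ j ∈ Finset.Ico q N, ((2 : ℝ) ^ j) ^ (-α) ≤ (1 - (2 : ℝ) ^ (-α))⁻¹ * τ ^ rate α := by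
    refine (sum_Ico_two_pow_rpow_neg_le hα q N).trans ?_
    gcongr
    refine (Real.rpow_le_rpow_of_nonpos hx0 (le_two_pow_level x) (neg_nonpos.2 hα.le)).trans ?_
    rw [hx, ← Real.rpow_mul hτ.le]
    refine le_of_eq ?_
    congr 1
    unfold rate
    ring
  rw [add_mul]
  linarith

/-- The additive part of `levelError` does not decay in j, but only levels with 2^j < n are summed.
It contributes √n · n^{-(1+rate)/2} = n^{-rate/2}, up to a constant, which is at most τ^{rate}. -/
lemma exists_sum_levelError_le {α : ℝ} (hα : 0 < α) :
    ∃ C : ℝ, 0 < C ∧ ∀ {n : ℕ} (_ : 0 < n) {τ : ℝ} (_ : √(1 / n) ≤ τ),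
      ∑ j ∈ Finset.range (level n), √((2 : ℝ) ^ j) * levelError α n τ j ≤ C * τ ^ rate α := by
  obtain ⟨C, hC, h⟩ := exists_sum_sqrt_mul_min_le hα
  refine ⟨C + 8, by positivity, fun {n} hn {τ} hτ => ?_⟩
  have hn' : (0 : ℝ) < n := by exact_mod_cast hn
  have hn1 : (1 : ℝ) ≤ n := by exact_mod_cast hn
  have hs0 : 0 < √(1 / (n : ℝ)) := Real.sqrt_pos.2 (by positivity)
  have hτ0 : 0 < τ := hs0.trans_le hτ
  simp only [levelError, mul_add, Finset.sum_add_distrib]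
  rw [add_mul]
  refine add_le_add (h hτ0 _) ?_
  rw [← Finset.sum_mul]
  have h4 : √((2 : ℝ) ^ level n) ≤ 2 * √n := by
    rw [show (2 : ℝ) * √n = √(2 ^ 2 * n) by
      rw [Real.sqrt_mul (by norm_num), Real.sqrt_sq (by norm_num)]]
    have := two_pow_level_le hn1
    exact Real.sqrt_le_sqrt (by linarith)
  have h5 : √(n : ℝ) * (n : ℝ) ^ (-((1 + rate α) / 2)) = √(1 / (n : ℝ)) ^ rate α := by
    rw [Real.sqrt_eq_rpow, ← Real.rpow_add hn', Real.sqrt_eq_rpow, ← Real.rpow_mul (by positivity),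
      one_div (n : ℝ), Real.inv_rpow hn'.le, ← Real.rpow_neg hn'.le]
    congr 1
    ring
  calc _ ≤ 4 * √((2 : ℝ) ^ level n) * (n : ℝ) ^ (-((1 + rate α) / 2)) := by
        gcongr
        exact sum_range_sqrt_two_pow_le _
    _ ≤ 4 * (2 * √n) * (n : ℝ) ^ (-((1 + rate α) / 2)) := by gcongr
    _ = 8 * (√n * (n : ℝ) ^ (-((1 + rate α) / 2))) := by ring
    _ = 8 * √(1 / (n : ℝ)) ^ rate α := by rw [h5]
    _ ≤ _ := by
      have := rate_pos hα
      gcongr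

/-! ### The vertical block -/

lemma verticalBlock_eq (x₀ c : ℝ) (n : ℕ) : verticalBlock W x₀ c n =
    nearIndex W x₀ c (max (level c⁻¹) W.j₀) (level (c⁻¹ * Real.log n)) := by
  classical
  ext p
  rw [mem_nearIndex, verticalBlock, EdgeFamily.near, Finset.mem_filter, Finset.mem_filter,
    Finset.mem_sigma, Finset.mem_Ico, and_assoc]

lemma card_near_le_of_level_le {x₀ c : ℝ} (hc : 0 < c) {j : ℕ} (hj : level c⁻¹ ≤ j) :
    ((W.ψ.near x₀ c j).card : ℝ) ≤ (2 * W.ψ.edges + 4) * c * 2 ^ j := by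
  refine (W.ψ_fits.card_near_le x₀ hc.le j).trans ?_
  have h1 : 1 ≤ c * 2 ^ j := by
    rw [← inv_mul_le_iff₀ hc, mul_one]
    exact le_two_pow_of_level_le hj
  have h2 : (0 : ℝ) ≤ W.ψ.edges := Nat.cast_nonneg _
  nlinarith

lemma card_nearIndex_le {x₀ c : ℝ} (hc : 0 < c) {a b : ℕ} (ha : level c⁻¹ ≤ a) :
    ((nearIndex W x₀ c a b).card : ℝ) ≤ (2 * W.ψ.edges + 4) * (c * 2 ^ b) := by
  rw [nearIndex, Finset.card_sigma]
  push_cast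
  calc _ ≤ ∑ j ∈ Finset.Ico a b, (2 * W.ψ.edges + 4) * c * (2 : ℝ) ^ j :=
        Finset.sum_le_sum fun j hj => card_near_le_of_level_le hc
          (ha.trans (Finset.mem_Ico.1 hj).1)
    _ = (2 * W.ψ.edges + 4) * c * ∑ j ∈ Finset.Ico a b, (2 : ℝ) ^ j := by rw [Finset.mul_sum]
    _ ≤ (2 * W.ψ.edges + 4) * c * 2 ^ b := by
      gcongr
      refine le_trans (Finset.sum_le_sum_of_subset_of_nonneg (fun j hj => ?_)
        fun _ _ _ => by positivity) (sum_range_two_pow_le b)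
      exact Finset.mem_range.2 (Finset.mem_Ico.1 hj).2
    _ = _ := by ring

/-- The risk in the vertical block. -/
lemma exists_lintegral_sum_verticalBlock_le [IsProbabilityMeasure P] (hB : IsPreBrownianReal B P)
    (W : WaveletBasis r) {α M : ℝ} (hα : 0 < α) (hαr : α < r) (hM : 0 < M) {lam : ℝ}
    (hlam_gt : 1 < lam) (hlam : lam - Real.log lam - 1 = 2) :
    ∃ C : ℝ, 0 < C ∧ ∀ f ∈ holderClass α M, ∀ {n : ℕ} (_ : 1 ≤ Real.log n) (L : ℕ) {x₀ c : ℝ}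
      (_ : Icc (x₀ - c) (x₀ + c) ⊆ Icc 0 1) (_ : 0 < c) (_ : c ≤ 1) (_ : Real.log n / n < c),
      ∫⁻ ω, ENNReal.ofReal (∑ p ∈ verticalBlock W x₀ c n,
        coeffError P W B n f x₀ c L lam p ω ^ 2) ∂P ≤
        ENNReal.ofReal (C * (min (c * c ^ (2 * α)) (Real.log n / n) +
          Real.log n / n * Real.exp (-(rate α * Real.log n)))) := by
  obtain ⟨C₀, hC₀, hcoeff⟩ := W.exists_abs_coeff_le hα hαr hM
  obtain ⟨C₂, hC₂, hblock⟩ := exists_lintegral_sum_jsFactor_le hlam_gt hlam (rate_lt_one hα)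
  set D : ℝ := 2 * W.ψ.edges + 4 with hD
  have hD0 : 4 ≤ D := by
    have : (0 : ℝ) ≤ W.ψ.edges := Nat.cast_nonneg _
    rw [hD]; linarith
  set A : ℝ := D * C₀ ^ 2 * (1 - (2 : ℝ) ^ (-(2 * α)))⁻¹ with hA
  have hA0 : 0 < A := by
    have : 0 < 1 - (2 : ℝ) ^ (-(2 * α)) := sub_pos.2 (two_rpow_neg_lt_one (by positivity))
    positivity
  refine ⟨C₂ * (A + 2 * D + 2 * D * Real.exp (D + 1)), by positivity, ?_⟩
  intro f hf n hn L x₀ c hI hc hc1 hnc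
  have hn0 := pos_of_one_le_log hn
  have hn' : (0 : ℝ) < n := by exact_mod_cast hn0
  have hz := stdNormalMoments_noise (W := W) hB hn0 (holderClass.continuousOn hf)
  set J := level (c⁻¹ * Real.log n) with hJ
  set q := max (level c⁻¹) W.j₀ with hq
  -- The condition c > log n/n puts the vertical block below the last estimated level.
  have hJn : J ≤ level n := by
    refine level_mono ?_
    rw [div_lt_iff₀ hn'] at hnc
    rw [inv_mul_le_iff₀ hc]
    exact hnc.le
  set H := verticalBlock W x₀ c n with hH
  have hHeq : H = nearIndex W x₀ c q J := verticalBlock_eq x₀ c n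
  have hHindex : (H : Set (Σ _ : ℕ, ℕ)) ⊆ W.index := fun p hp =>
    mem_index_of_mem_nearIndex (le_max_right _ _) (hHeq ▸ hp)
  have hcard : (H.card : ℝ) ≤ 2 * D * Real.log n := by
    rw [hHeq]
    refine (card_nearIndex_le hc (le_max_left _ _)).trans ?_
    have h1 : (2 : ℝ) ^ J ≤ 2 * (c⁻¹ * Real.log n) := by
      refine two_pow_level_le ?_
      have := (one_le_inv₀ hc).2 hc1
      nlinarith
    calc D * (c * 2 ^ J) ≤ D * (c * (2 * (c⁻¹ * Real.log n))) := by gcongr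
      _ = _ := by field_simp
  -- A level carries signal of order c 2^j · 2^{-j(2α+1)} = c 2^{-2jα}. The geometric sum is
  -- dominated by its coarsest level, where 2^j ≥ 1/c.
  have hsum : ∑ p ∈ H, W.coeff f p.1 p.2 ^ 2 ≤ A * (c * c ^ (2 * α)) := by
    rw [hHeq, sum_nearIndex]
    calc _ ≤ ∑ j ∈ Finset.Ico q J, D * c * C₀ ^ 2 * ((2 : ℝ) ^ j) ^ (-(2 * α)) := by
          refine Finset.sum_le_sum fun j hj => ?_
          have hj1 := (Finset.mem_Ico.1 hj).1
          have hpow : (2 : ℝ) ^ j * (C₀ * ((2 : ℝ) ^ j) ^ (-(α + 1 / 2))) ^ 2 =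
              C₀ ^ 2 * ((2 : ℝ) ^ j) ^ (-(2 * α)) := by
            have h1 : ((2 : ℝ) ^ j) ^ (-(2 * α)) = (((2 : ℝ) ^ j) ^ (-α)) ^ 2 := by
              rw [← Real.rpow_natCast _ 2, ← Real.rpow_mul (by positivity)]
              congr 1
              push_cast
              ring
            rw [h1, ← sqrt_two_pow_mul_rpow α j]
            generalize ((2 : ℝ) ^ j) ^ (-(α + 1 / 2)) = y
            rw [mul_pow, mul_pow, Real.sq_sqrt (by positivity)]
            ring
          refine (Finset.sum_le_card_nsmul _ _ ((C₀ * ((2 : ℝ) ^ j) ^ (-(α + 1 / 2))) ^ 2)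
            fun k hk => ?_).trans ?_
          · dsimp only
            rw [← sq_abs]
            exact pow_le_pow_left₀ (abs_nonneg _) (hcoeff f hf j ((le_max_right _ _).trans hj1) k
              (EdgeFamily.near_subset _ _ _ _ hk)) 2
          · rw [nsmul_eq_mul]
            calc _ ≤ D * c * 2 ^ j * (C₀ * ((2 : ℝ) ^ j) ^ (-(α + 1 / 2))) ^ 2 := by
                  gcongr
                  exact card_near_le_of_level_le hc ((le_max_left _ _).trans hj1)
              _ = D * c * (2 ^ j * (C₀ * ((2 : ℝ) ^ j) ^ (-(α + 1 / 2))) ^ 2) := by ring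
              _ = _ := by rw [hpow]; ring
      _ = D * c * C₀ ^ 2 * ∑ j ∈ Finset.Ico q J, ((2 : ℝ) ^ j) ^ (-(2 * α)) := by
          rw [Finset.mul_sum]
      _ ≤ D * c * C₀ ^ 2 * ((1 - (2 : ℝ) ^ (-(2 * α)))⁻¹ * c ^ (2 * α)) := by
          gcongr
          refine (sum_Ico_two_pow_rpow_neg_le (by positivity) q J).trans ?_
          have h2 : 0 ≤ 1 - (2 : ℝ) ^ (-(2 * α)) :=
            (sub_pos.2 (two_rpow_neg_lt_one (by positivity))).le
          gcongr
          refine (Real.rpow_le_rpow_of_nonpos (inv_pos.2 hc)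
            (le_two_pow_of_level_le (le_max_left _ _)) (by linarith)).trans (le_of_eq ?_)
          rw [Real.inv_rpow hc.le, Real.rpow_neg hc.le, inv_inv]
      _ = _ := by rw [hA]; ring
  have hexp : (H.card : ℝ) / n * Real.exp (-(rate α * H.card)) ≤
      2 * D * Real.exp (D + 1) * (Real.log n / n * Real.exp (-(rate α * Real.log n))) := by
    -- If J ≤ q the block is empty. Otherwise its finest level J - 1 alone holds, up to a constant,
    -- 2c 2^{J-1} ≥ log n indices.
    rcases le_or_gt J q with h | h
    · have : H.card = 0 := by
        rw [hHeq, nearIndex, Finset.Ico_eq_empty_of_le h]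
        rfl
      rw [this, Nat.cast_zero, zero_div, zero_mul]
      positivity
    · have hlow : Real.log n - (D + 1) ≤ H.card := by
        have h1 : q ≤ J - 1 := by omega
        have h2 := W.le_card_near hI hc.le ((le_max_right _ _).trans h1)
        have h3 : (W.ψ.near x₀ c (J - 1)).card ≤ H.card := by
          rw [hHeq, nearIndex, Finset.card_sigma]
          exact Finset.single_le_sum (f := fun j => (W.ψ.near x₀ c j).card)
            (fun _ _ => Nat.zero_le _) (Finset.mem_Ico.2 ⟨h1, by omega⟩)
        have h3' : ((W.ψ.near x₀ c (J - 1)).card : ℝ) ≤ H.card := by exact_mod_cast h3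
        have h4 : c⁻¹ * Real.log n ≤ 2 * 2 ^ (J - 1) := by
          rw [← pow_succ', Nat.sub_add_cancel (by omega : 1 ≤ J)]
          exact le_two_pow_level _
        rw [inv_mul_le_iff₀ hc] at h4
        rw [hD]
        linarith
      calc _ ≤ 2 * D * Real.log n / n * (Real.exp (D + 1) * Real.exp (-(rate α * Real.log n))) := by
            gcongr
            exact exp_neg_mul_le (rate_pos hα).le (rate_lt_one hα).le (by linarith) hlow
        _ = _ := by ring
  have herr : ∀ ω, ∑ p ∈ H, coeffError P W B n f x₀ c L lam p ω ^ 2 = ∑ p ∈ H,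
      (jsFactor n lam H.card (∑ q ∈ H,
        (W.coeff f q.1 q.2 + 1 / √(n : ℝ) * noise P W B n f q ω) ^ 2) *
        (W.coeff f p.1 p.2 + 1 / √(n : ℝ) * noise P W B n f p ω) - W.coeff f p.1 p.2) ^ 2 :=
    fun ω => Finset.sum_congr rfl fun p hp => by
      rw [coeffError_of_mem_verticalBlock hn0 f L lam
        ((fst_lt_of_mem_verticalBlock hp).trans_le hJn) hnc hp]
  simp_rw [herr]
  refine (hblock hz hn0 hHindex le_rfl fun p => W.coeff f p.1 p.2).trans
    (ENNReal.ofReal_le_ofReal ?_)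
  have hmin : min (∑ p ∈ H, W.coeff f p.1 p.2 ^ 2) ((H.card : ℝ) / n) ≤
      (A + 2 * D) * min (c * c ^ (2 * α)) (Real.log n / n) := by
    rw [mul_min_of_nonneg _ _ (by positivity)]
    refine min_le_min (hsum.trans ?_) ?_
    · gcongr
      linarith
    · rw [← mul_div_assoc]
      gcongr
      refine hcard.trans ?_
      gcongr
      linarith
  have hmin0 : 0 ≤ min (c * c ^ (2 * α)) (Real.log n / n) := le_min (by positivity) (by positivity)
  set u := Real.log n / n * Real.exp (-(rate α * Real.log n)) with hu
  have hu0 : 0 ≤ u := by positivity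
  calc _ ≤ C₂ * ((A + 2 * D) * min (c * c ^ (2 * α)) (Real.log n / n) +
        2 * D * Real.exp (D + 1) * u) := by gcongr
    _ ≤ C₂ * ((A + 2 * D + 2 * D * Real.exp (D + 1)) * min (c * c ^ (2 * α)) (Real.log n / n) +
        (A + 2 * D + 2 * D * Real.exp (D + 1)) * u) := by
        have : 0 ≤ 2 * D * Real.exp (D + 1) := by positivity
        refine mul_le_mul_of_nonneg_left (add_le_add (mul_le_mul_of_nonneg_right ?_ hmin0)
          (mul_le_mul_of_nonneg_right ?_ hu0)) hC₂.le
        · linarith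
        · linarith
    _ = _ := by ring

end

section

variable {Ω : Type*} [MeasurableSpace Ω] {P : Measure Ω} {B : ℝ≥0 → Ω → ℝ}
variable {r : ℕ} {W : WaveletBasis r}

/-! ### Risk bounds for the adaptive estimator -/

lemma le_one_of_Icc_subset {x₀ c : ℝ} (hc : 0 ≤ c) (hI : Icc (x₀ - c) (x₀ + c) ⊆ Icc 0 1) :
    c ≤ 1 := by
  have h1 := (hI ⟨le_rfl, by linarith⟩ : x₀ - c ∈ Icc (0 : ℝ) 1).1
  have h2 := (hI ⟨by linarith, le_rfl⟩ : x₀ + c ∈ Icc (0 : ℝ) 1).2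
  linarith

/-- Up to the factor Kc, the fine levels contribute the sum of the squares of 2^{j/2} `levelError`,
at most the square of the sum. One estimate thus serves coarse and fine levels alike. -/
lemma lintegral_sum_nearIndex_le {α K C : ℝ} {n : ℕ} {f : ℝ → ℝ} {x₀ c : ℝ} (hc : 0 ≤ c)
    (hK : 0 ≤ K) {L : ℕ} {lam τ : ℝ} (hn : 0 < n) (hτ : 0 ≤ τ)
    (hC : ∑ j ∈ Finset.range (level n), √((2 : ℝ) ^ j) * levelError α n τ j ≤ C * τ ^ rate α)
    {a : ℕ} (h : ∀ j ∈ Finset.Ico a (level n), ∫⁻ ω, ENNReal.ofReal (∑ k ∈ W.ψ.near x₀ c j,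
      coeffError P W B n f x₀ c L lam ⟨j, k⟩ ω ^ 2) ∂P ≤
        ENNReal.ofReal (K * (c * 2 ^ j) * levelError α n τ j ^ 2)) :
    ∫⁻ ω, ENNReal.ofReal (∑ p ∈ nearIndex W x₀ c a (level n),
      coeffError P W B n f x₀ c L lam p ω ^ 2) ∂P ≤
        ENNReal.ofReal (K * c * (C * τ ^ rate α) ^ 2) := by
  have hm : ∀ p, Measurable (coeffError P W B n f x₀ c L lam p) :=
    measurable_coeffError n f x₀ c L lam
  have hpos : ∀ j, 0 ≤ √((2 : ℝ) ^ j) * levelError α n τ j := fun j =>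
    mul_nonneg (Real.sqrt_nonneg _) (levelError_pos hn hτ j).le
  calc _ = ∑ j ∈ Finset.Ico a (level n), ∫⁻ ω, ENNReal.ofReal (∑ k ∈ W.ψ.near x₀ c j,
        coeffError P W B n f x₀ c L lam ⟨j, k⟩ ω ^ 2) ∂P := by
        rw [← lintegral_finsetSum _ fun j _ =>
          (Finset.measurable_sum _ fun k _ => (hm ⟨j, k⟩).pow_const 2).ennreal_ofReal]
        refine lintegral_congr fun ω => ?_
        rw [sum_nearIndex,
          ENNReal.ofReal_sum_of_nonneg fun j _ => Finset.sum_nonneg fun k _ => sq_nonneg _]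
    _ ≤ ∑ j ∈ Finset.Ico a (level n),
          ENNReal.ofReal (K * (c * 2 ^ j) * levelError α n τ j ^ 2) := Finset.sum_le_sum h
    _ = ENNReal.ofReal (∑ j ∈ Finset.Ico a (level n),
          K * (c * 2 ^ j) * levelError α n τ j ^ 2) :=
        (ENNReal.ofReal_sum_of_nonneg fun j _ => by positivity).symm
    _ ≤ _ := by
        refine ENNReal.ofReal_le_ofReal ?_
        have h1 : ∀ j, K * (c * 2 ^ j) * levelError α n τ j ^ 2 =
            K * c * (√((2 : ℝ) ^ j) * levelError α n τ j) ^ 2 := fun j => by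
          rw [mul_pow, Real.sq_sqrt (by positivity)]
          ring
        simp_rw [h1]
        rw [← Finset.mul_sum]
        gcongr
        calc _ ≤ ∑ j ∈ Finset.range (level n), (√((2 : ℝ) ^ j) * levelError α n τ j) ^ 2 :=
              Finset.sum_le_sum_of_subset_of_nonneg
                (fun j hj => Finset.mem_range.2 (Finset.mem_Ico.1 hj).2) fun _ _ _ => sq_nonneg _
          _ ≤ (∑ j ∈ Finset.range (level n), √((2 : ℝ) ^ j) * levelError α n τ j) ^ 2 :=
              Finset.sum_sq_le_sq_sum_of_nonneg fun j _ => hpos j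
          _ ≤ _ := pow_le_pow_left₀ (Finset.sum_nonneg fun j _ => hpos j) hC 2

lemma one_div_le_rpow_neg_rate {α : ℝ} (hα : 0 < α) {n : ℕ} (hn : 0 < n) :
    1 / (n : ℝ) ≤ (n : ℝ) ^ (-rate α) := by
  have hn1 : (1 : ℝ) ≤ n := by exact_mod_cast hn
  rw [one_div, ← Real.rpow_neg_one]
  exact Real.rpow_le_rpow_of_exponent_le hn1 (by linarith [rate_lt_one hα])

lemma rpow_neg_sq_le {α : ℝ} (hα : 0 < α) {n : ℕ} (hn : 0 < n) :
    ((n : ℝ) ^ (-α)) ^ 2 ≤ (n : ℝ) ^ (-rate α) := by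
  have hn1 : (1 : ℝ) ≤ n := by exact_mod_cast hn
  rw [← Real.rpow_natCast, ← Real.rpow_mul (by positivity)]
  refine Real.rpow_le_rpow_of_exponent_le hn1 ?_
  have : rate α ≤ 2 * α := div_le_self (by positivity) (by linarith)
  push_cast
  linarith

lemma sqrt_rpow_sq {x : ℝ} (hx : 0 ≤ x) (a : ℝ) : (√x ^ a) ^ 2 = x ^ a := by
  rw [← Real.rpow_natCast, ← Real.rpow_mul (Real.sqrt_nonneg _), mul_comm, Real.rpow_mul
    (Real.sqrt_nonneg _), Real.rpow_natCast, Real.sq_sqrt hx]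

lemma sqrt_one_div_le {n : ℕ} (hn : 1 ≤ Real.log n) : √(1 / (n : ℝ)) ≤ √(Real.log n / n) := by
  gcongr

/-- The risk of the hybrid estimator. -/
lemma exists_risk_le_of_hybrid [IsProbabilityMeasure P] (hB : IsPreBrownianReal B P)
    (W : WaveletBasis r) {α M : ℝ} (hα : 0 < α) (hαr : α < r) (hM : 0 < M) {lam : ℝ}
    (hlam_gt : 1 < lam) (hlam : lam - Real.log lam - 1 = 2) :
    ∃ C : ℝ, 0 < C ∧ ∀ f ∈ holderClass α M, ∀ {n : ℕ} (_ : 1 ≤ Real.log n) {L : ℕ}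
      (_ : |(L : ℝ) - Real.log n| < 1) {x₀ c : ℝ} (_ : Icc (x₀ - c) (x₀ + c) ⊆ Icc 0 1)
      (_ : Real.log n / n < c),
      risk P (adaptiveEstimator P W x₀ c n L lam (observation B n f)) f x₀ c ≤
        ENNReal.ofReal (C * ((∑ j ∈ Finset.Ico W.j₀ (min (max (level c⁻¹) W.j₀) (level n)),
          √(2 ^ j) * levelError α n √(Real.log n / n) j) ^ 2 + (n : ℝ) ^ (-rate α) +
          1 / c * (min (c * c ^ (2 * α)) (Real.log n / n) +
            Real.log n / n * (n : ℝ) ^ (-rate α)))) := by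
  obtain ⟨C₁, hC₁, hrisk⟩ := exists_risk_le hB W hα hαr hM
  obtain ⟨C₂, hC₂, hcoeff⟩ := exists_lintegral_coeffError_sq_le hB W hα hαr hM hlam_gt hlam
  obtain ⟨C₃, hC₃, hblock⟩ := exists_lintegral_sum_near_block_le hB W hα hαr hM hlam_gt hlam
  obtain ⟨C₄, hC₄, hvert⟩ := exists_lintegral_sum_verticalBlock_le hB W hα hαr hM hlam_gt hlam
  obtain ⟨C₅, hC₅, hlev⟩ := exists_sum_levelError_le hα
  refine ⟨C₁ * (2 + C₂ ^ 2) + 2 * C₄ + 2 * (C₃ * C₅ ^ 2), by positivity, ?_⟩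
  intro f hf n hn L hL x₀ c hI hnc
  have hn0 := pos_of_one_le_log hn
  have hn' : (0 : ℝ) < n := by exact_mod_cast hn0
  have hc : 0 < c := lt_of_le_of_lt (by positivity) hnc
  have hc1 := le_one_of_Icc_subset hc.le hI
  set q := max (level c⁻¹) W.j₀ with hq
  set J := level (c⁻¹ * Real.log n) with hJ
  set τ := √(Real.log n / n) with hτ
  set N := (n : ℝ) ^ (-rate α) with hN
  have hN0 : 0 < N := by positivity
  set δ := coeffError P W B n f x₀ c L lam with hδ
  have hδm : ∀ p, Measurable (δ p) := measurable_coeffError n f x₀ c L lam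
  have hHeq : verticalBlock W x₀ c n = nearIndex W x₀ c q J := verticalBlock_eq x₀ c n
  set v := min (c * c ^ (2 * α)) (Real.log n / n) + Real.log n / n * N with hv
  have hv0 : 0 ≤ v := add_nonneg (le_min (by positivity) (by positivity)) (by positivity)
  have hexp : Real.exp (-(rate α * Real.log n)) = N := by
    rw [hN, Real.rpow_def_of_pos hn']
    congr 1
    ring
  have hV := hvert f hf hn L hI hc hc1 hnc
  rw [hexp] at hV
  -- The fine blocks start at `max q J` because j₀ may exceed J. Here whole blocks are compared with
  -- the oracle, so the noise level is √(1/n) without a logarithm.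
  have hF := lintegral_sum_nearIndex_le (W := W) (P := P) (B := B) (f := f) (x₀ := x₀) (L := L)
    (lam := lam) hc.le hC₃.le hn0 (Real.sqrt_nonneg _) (hlev hn0 le_rfl) (a := max q J)
    fun j hj => by
      rw [Finset.mem_Ico] at hj
      have hjJ := (le_max_right q J).trans hj.1
      refine hblock f hf hn hL hc.le ((le_max_right _ _).trans ((le_max_left q J).trans hj.1)) hj.2
        hjJ ?_
      rw [← inv_mul_le_iff₀ hc]
      exact le_two_pow_of_level_le hjJ
  have hs : (√(1 / (n : ℝ)) ^ rate α) ^ 2 = N := by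
    rw [sqrt_rpow_sq (by positivity), one_div, Real.inv_rpow hn'.le, ← Real.rpow_neg hn'.le]
  rw [mul_pow, hs] at hF
  have hfine : ∫⁻ ω, ENNReal.ofReal (∑ p ∈ nearIndex W x₀ c q (level n), δ p ω ^ 2) ∂P ≤
      ENNReal.ofReal (C₄ * v + C₃ * c * (C₅ ^ 2 * N)) := by
    rw [ENNReal.ofReal_add (by positivity) (by positivity)]
    refine le_trans ?_ (add_le_add hV hF)
    rw [← lintegral_add_left
      (Finset.measurable_sum _ fun p _ => (hδm p).pow_const 2).ennreal_ofReal]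
    refine lintegral_mono fun ω => ?_
    rw [← ENNReal.ofReal_add (Finset.sum_nonneg fun _ _ => sq_nonneg _)
      (Finset.sum_nonneg fun _ _ => sq_nonneg _)]
    refine ENNReal.ofReal_le_ofReal ?_
    rw [← Finset.sum_union_inter]
    refine le_trans ?_ (le_add_of_nonneg_right (Finset.sum_nonneg fun _ _ => sq_nonneg _))
    refine Finset.sum_le_sum_of_subset_of_nonneg (fun p hp => ?_) fun _ _ _ => sq_nonneg _
    obtain ⟨⟨h1, h2⟩, h3⟩ := mem_nearIndex.1 hp
    rw [Finset.mem_union, hHeq, mem_nearIndex, mem_nearIndex]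
    rcases lt_or_ge p.1 J with h | h
    · exact Or.inl ⟨⟨h1, h⟩, h3⟩
    · exact Or.inr ⟨⟨max_le h1 h, h2⟩, h3⟩
  refine (hrisk f hf hn0 hc.le hI (le_max_right _ _) (fun h => absurd h hc.ne') (fun j hj => ?_)
    (s := fun j => C₂ * levelError α n τ j)
    (fun j => mul_pos hC₂ (levelError_pos hn0 (Real.sqrt_nonneg _) j)) (fun p hp => ?_)
    (by positivity) hfine).trans (ENNReal.ofReal_le_ofReal ?_)
  · rw [Finset.mem_Ico, lt_max_iff] at hj
    have : (2 : ℝ) ^ j < c⁻¹ := two_pow_lt_of_lt_level (hj.2.resolve_right (not_lt.2 hj.1))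
    rw [← le_inv_mul_iff₀ hc, mul_one]
    exact this.le
  · have hp1 := (mem_nearIndex.1 hp).1.2
    refine hcoeff f hf hn hL (mem_index_of_mem_nearIndex le_rfl hp)
      (hp1.trans_le (min_le_right _ _)) fun _ hpv => ?_
    have h2 := (mem_nearIndex.1 (hHeq ▸ hpv)).1.1
    exact absurd (hp1.trans_le (min_le_left _ _)) (not_lt.2 h2)
  · have hS : ∑ j ∈ Finset.Ico W.j₀ (min q (level n)), √((2 : ℝ) ^ j) * (C₂ * levelError α n τ j) =
        C₂ * ∑ j ∈ Finset.Ico W.j₀ (min q (level n)), √((2 : ℝ) ^ j) * levelError α n τ j := by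
      rw [Finset.mul_sum]
      exact Finset.sum_congr rfl fun _ _ => by ring
    rw [hS, mul_pow]
    set X := (∑ j ∈ Finset.Ico W.j₀ (min q (level n)), √((2 : ℝ) ^ j) * levelError α n τ j) ^ 2
    have hX : 0 ≤ X := sq_nonneg _
    have h1 := one_div_le_rpow_neg_rate hα hn0
    have h2 := rpow_neg_sq_le hα hn0
    have h3 : 2 / c * (C₄ * v + C₃ * c * (C₅ ^ 2 * N)) =
        2 * C₄ * (1 / c * v) + 2 * (C₃ * C₅ ^ 2) * N := by
      field_simp
    have hw : 0 ≤ 1 / c * v := by positivity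
    rw [h3]
    calc _ ≤ C₁ * (N + C₂ ^ 2 * X + N) + (2 * C₄ * (1 / c * v) + 2 * (C₃ * C₅ ^ 2) * N) := by
          gcongr
      _ = C₁ * C₂ ^ 2 * X + (C₁ * 2 + 2 * (C₃ * C₅ ^ 2)) * N + 2 * C₄ * (1 / c * v) := by ring
      _ ≤ (C₁ * (2 + C₂ ^ 2) + 2 * C₄ + 2 * (C₃ * C₅ ^ 2)) * X +
          (C₁ * (2 + C₂ ^ 2) + 2 * C₄ + 2 * (C₃ * C₅ ^ 2)) * N +
          (C₁ * (2 + C₂ ^ 2) + 2 * C₄ + 2 * (C₃ * C₅ ^ 2)) * (1 / c * v) := by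
          have : 0 ≤ C₁ * C₂ ^ 2 := by positivity
          have : 0 ≤ C₃ * C₅ ^ 2 := by positivity
          refine add_le_add (add_le_add ?_ ?_) ?_ <;>
          · refine mul_le_mul_of_nonneg_right ?_ (by first | assumption | exact hN0.le)
            linarith
      _ = _ := by ring

/-- The risk of the BlockJS estimator. -/
lemma exists_risk_le_of_blockJS [IsProbabilityMeasure P] (hB : IsPreBrownianReal B P)
    (W : WaveletBasis r) {α M : ℝ} (hα : 0 < α) (hαr : α < r) (hM : 0 < M) {lam : ℝ}
    (hlam_gt : 1 < lam) (hlam : lam - Real.log lam - 1 = 2) :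
    ∃ C : ℝ, 0 < C ∧ ∀ f ∈ holderClass α M, ∀ {n : ℕ} (_ : 1 ≤ Real.log n) {L : ℕ}
      (_ : |(L : ℝ) - Real.log n| < 1) {x₀ c : ℝ} (_ : Icc (x₀ - c) (x₀ + c) ⊆ Icc 0 1)
      (_ : 0 ≤ c) (_ : c ≤ Real.log n / n),
      risk P (adaptiveEstimator P W x₀ c n L lam (observation B n f)) f x₀ c ≤
        ENNReal.ofReal (C * (Real.log n / n) ^ rate α) := by
  obtain ⟨C₁, hC₁, hrisk⟩ := exists_risk_le hB W hα hαr hM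
  obtain ⟨C₂, hC₂, hcoeff⟩ := exists_lintegral_coeffError_sq_le hB W hα hαr hM hlam_gt hlam
  obtain ⟨C₅, hC₅, hlev⟩ := exists_sum_levelError_le hα
  set D : ℝ := 2 * W.ψ.edges + 4 with hD
  have hD0 : 0 < D := by positivity
  refine ⟨C₁ * (2 + C₂ ^ 2 * C₅ ^ 2) + 2 * (D * C₂ ^ 2 * C₅ ^ 2), by positivity, ?_⟩
  intro f hf n hn L hL x₀ c hI hc hcn
  have hn0 := pos_of_one_le_log hn
  have hn' : (0 : ℝ) < n := by exact_mod_cast hn0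
  set τ := √(Real.log n / n) with hτ
  set δ := coeffError P W B n f x₀ c L lam with hδ
  have hδm : ∀ p, Measurable (δ p) := measurable_coeffError n f x₀ c L lam
  have hone : ∀ p ∈ W.index, p.1 < level n → ∫⁻ ω, ENNReal.ofReal (δ p ω ^ 2) ∂P ≤
      ENNReal.ofReal ((C₂ * levelError α n τ p.1) ^ 2) := fun p hp hpn =>
    hcoeff f hf hn hL hp hpn fun h => absurd h (not_lt.2 hcn)
  have hX : ∑ j ∈ Finset.range (level n), √((2 : ℝ) ^ j) * levelError α n τ j ≤
      C₅ * τ ^ rate α := hlev hn0 (sqrt_one_div_le hn)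
  -- For c > 0 the split is the first level from j₀ on with 2^q ≥ 1/c; for c = 0 it is placed at or
  -- beyond the last level, so that every level is treated pointwise.
  obtain ⟨q, hq1, hq2, hq3, hq4⟩ : ∃ q, W.j₀ ≤ q ∧ (c = 0 → level n ≤ q) ∧
      (∀ j ∈ Finset.Ico W.j₀ q, c * 2 ^ j ≤ 1) ∧ (0 < c → level c⁻¹ ≤ q) := by
    rcases hc.eq_or_lt with rfl | hc
    · exact ⟨max (level n) W.j₀, le_max_right _ _, fun _ => le_max_left _ _, fun _ _ => by simp,
        fun h => absurd h (lt_irrefl _)⟩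
    · refine ⟨max (level c⁻¹) W.j₀, le_max_right _ _, fun h => absurd h hc.ne', fun j hj => ?_,
        fun _ => le_max_left _ _⟩
      rw [Finset.mem_Ico, lt_max_iff] at hj
      have : (2 : ℝ) ^ j < c⁻¹ := two_pow_lt_of_lt_level (hj.2.resolve_right (not_lt.2 hj.1))
      rw [← le_inv_mul_iff₀ hc, mul_one]
      exact this.le
  have hfine : ∫⁻ ω, ENNReal.ofReal (∑ p ∈ nearIndex W x₀ c q (level n), δ p ω ^ 2) ∂P ≤
      ENNReal.ofReal (D * C₂ ^ 2 * c * (C₅ * τ ^ rate α) ^ 2) := by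
    rcases hc.eq_or_lt with rfl | hc
    · have h0 : nearIndex W x₀ 0 q (level n) = ∅ := by
        rw [nearIndex, Finset.Ico_eq_empty_of_le (hq2 rfl)]
        rfl
      rw [h0]
      simp
    -- The bound for a single coefficient is summed over the nearby ones; the logarithm lost in this
    -- way is allowed by the rate (log n/n)^{rate}.
    refine lintegral_sum_nearIndex_le hc.le (by positivity) hn0 (Real.sqrt_nonneg _) hX fun j hj => ?_
    rw [Finset.mem_Ico] at hj
    simp_rw [ENNReal.ofReal_sum_of_nonneg fun k _ => sq_nonneg _]
    rw [lintegral_finsetSum _ fun k _ => ((hδm ⟨j, k⟩).pow_const 2).ennreal_ofReal]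
    refine (Finset.sum_le_card_nsmul _ _
      (ENNReal.ofReal ((C₂ * levelError α n τ j) ^ 2)) fun k hk => hone ⟨j, k⟩
      ⟨hq1.trans hj.1, EdgeFamily.near_subset _ _ _ _ hk⟩ hj.2).trans ?_
    rw [nsmul_eq_mul, ← ENNReal.ofReal_natCast, ← ENNReal.ofReal_mul (Nat.cast_nonneg _)]
    refine ENNReal.ofReal_le_ofReal ?_
    calc _ ≤ D * c * 2 ^ j * (C₂ * levelError α n τ j) ^ 2 := by
          gcongr
          exact card_near_le_of_level_le hc ((hq4 hc).trans hj.1)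
      _ = _ := by ring
  refine (hrisk f hf hn0 hc hI hq1 hq2 hq3
    (s := fun j => C₂ * levelError α n τ j)
    (fun j => mul_pos hC₂ (levelError_pos hn0 (Real.sqrt_nonneg _) j)) (fun p hp => ?_)
    (by positivity) hfine).trans (ENNReal.ofReal_le_ofReal ?_)
  · exact hone p (mem_index_of_mem_nearIndex le_rfl hp)
      ((mem_nearIndex.1 hp).1.2.trans_le (min_le_right _ _))
  · set R := (Real.log n / n) ^ rate α with hR
    have hR0 : 0 ≤ R := by positivity
    have hτR : (τ ^ rate α) ^ 2 = R := sqrt_rpow_sq (by positivity) _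
    have hNR : (n : ℝ) ^ (-rate α) ≤ R := by
      rw [Real.rpow_neg hn'.le, ← Real.inv_rpow hn'.le, ← one_div]
      have := rate_pos hα
      rw [hR]
      gcongr
    have hS : ∑ j ∈ Finset.Ico W.j₀ (min q (level n)), √((2 : ℝ) ^ j) * (C₂ * levelError α n τ j) ≤
        C₂ * (C₅ * τ ^ rate α) := by
      refine le_trans ?_ (mul_le_mul_of_nonneg_left hX hC₂.le)
      rw [Finset.mul_sum]
      have hpos : ∀ j, 0 ≤ √((2 : ℝ) ^ j) * (C₂ * levelError α n τ j) := fun j =>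
        mul_nonneg (Real.sqrt_nonneg _)
          (mul_nonneg hC₂.le (levelError_pos hn0 (Real.sqrt_nonneg _) j).le)
      refine (Finset.sum_le_sum_of_subset_of_nonneg (fun j hj => Finset.mem_range.2
        ((Finset.mem_Ico.1 hj).2.trans_le (min_le_right _ _))) fun j _ _ => hpos j).trans
        (le_of_eq (Finset.sum_congr rfl fun _ _ => by ring))
    have hS2 : (∑ j ∈ Finset.Ico W.j₀ (min q (level n)),
        √((2 : ℝ) ^ j) * (C₂ * levelError α n τ j)) ^ 2 ≤ C₂ ^ 2 * C₅ ^ 2 * R := by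
      refine (pow_le_pow_left₀ (Finset.sum_nonneg fun j _ => mul_nonneg (Real.sqrt_nonneg _)
        (mul_nonneg hC₂.le (levelError_pos hn0 (Real.sqrt_nonneg _) j).le)) hS 2).trans
        (le_of_eq ?_)
      rw [mul_pow, mul_pow, hτR]
      ring
    have h1 := (one_div_le_rpow_neg_rate hα hn0).trans hNR
    have h2 := (rpow_neg_sq_le hα hn0).trans hNR
    have h3 : 2 / c * (D * C₂ ^ 2 * c * (C₅ * τ ^ rate α) ^ 2) ≤ 2 * (D * C₂ ^ 2 * C₅ ^ 2) * R := by
      rw [mul_pow, hτR]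
      rcases hc.eq_or_lt with rfl | hc
      · rw [div_zero, zero_mul]
        positivity
      · refine le_of_eq ?_
        field_simp
    calc _ ≤ C₁ * (R + C₂ ^ 2 * C₅ ^ 2 * R + R) + 2 * (D * C₂ ^ 2 * C₅ ^ 2) * R := by gcongr
      _ = _ := by ring

/-- The risk for neighborhoods of length at most a multiple of `(log n / n) ^ (1 / (1 + 2α))`. -/
lemma exists_risk_le_of_small [IsProbabilityMeasure P] (hB : IsPreBrownianReal B P)
    (W : WaveletBasis r) {α M : ℝ} (hα : 0 < α) (hαr : α < r) (hM : 0 < M) {lam : ℝ}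
    (hlam_gt : 1 < lam) (hlam : lam - Real.log lam - 1 = 2) {K : ℝ} (hK : 0 ≤ K) :
    ∃ C : ℝ, 0 < C ∧ ∀ f ∈ holderClass α M, ∀ {n : ℕ} (_ : 1 ≤ Real.log n) {L : ℕ}
      (_ : |(L : ℝ) - Real.log n| < 1) {x₀ c : ℝ} (_ : Icc (x₀ - c) (x₀ + c) ⊆ Icc 0 1)
      (_ : 0 ≤ c) (_ : c ≤ K * (Real.log n / n) ^ (1 / (1 + 2 * α))),
      risk P (adaptiveEstimator P W x₀ c n L lam (observation B n f)) f x₀ c ≤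
        ENNReal.ofReal (C * (Real.log n / n) ^ rate α) := by
  obtain ⟨C₁, hC₁, hhyb⟩ := exists_risk_le_of_hybrid hB W hα hαr hM hlam_gt hlam
  obtain ⟨C₂, hC₂, hblock⟩ := exists_risk_le_of_blockJS hB W hα hαr hM hlam_gt hlam
  obtain ⟨C₅, hC₅, hlev⟩ := exists_sum_levelError_le hα
  refine ⟨C₂ + C₁ * (C₅ ^ 2 + 2 + K ^ (2 * α)), by positivity, ?_⟩
  intro f hf n hn L hL x₀ c hI hc hcK
  have hn0 := pos_of_one_le_log hn
  have hn' : (0 : ℝ) < n := by exact_mod_cast hn0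
  set R := (Real.log n / n) ^ rate α with hR
  have hR0 : 0 ≤ R := by positivity
  rcases le_or_gt c (Real.log n / n) with hcn | hcn
  · refine (hblock f hf hn hL hI hc hcn).trans (ENNReal.ofReal_le_ofReal ?_)
    gcongr
    exact le_add_of_nonneg_right (by positivity)
  · have hc' : 0 < c := lt_of_le_of_lt (by positivity) hcn
    refine (hhyb f hf hn hL hI hcn).trans (ENNReal.ofReal_le_ofReal ?_)
    set τ := √(Real.log n / n) with hτ
    have hτR : (τ ^ rate α) ^ 2 = R := sqrt_rpow_sq (by positivity) _
    have hNR : (n : ℝ) ^ (-rate α) ≤ R := by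
      rw [Real.rpow_neg hn'.le, ← Real.inv_rpow hn'.le, ← one_div]
      have := rate_pos hα
      rw [hR]
      gcongr
    have hpos : ∀ j, 0 ≤ √((2 : ℝ) ^ j) * levelError α n τ j := fun j =>
      mul_nonneg (Real.sqrt_nonneg _) (levelError_pos hn0 (Real.sqrt_nonneg _) j).le
    have hS : (∑ j ∈ Finset.Ico W.j₀ (min (max (level c⁻¹) W.j₀) (level n)),
        √((2 : ℝ) ^ j) * levelError α n τ j) ^ 2 ≤ C₅ ^ 2 * R := by
      rw [← hτR, ← mul_pow]
      refine pow_le_pow_left₀ (Finset.sum_nonneg fun j _ => hpos j) ?_ 2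
      refine le_trans ?_ (hlev hn0 (sqrt_one_div_le hn))
      exact Finset.sum_le_sum_of_subset_of_nonneg (fun j hj => Finset.mem_range.2
        ((Finset.mem_Ico.1 hj).2.trans_le (min_le_right _ _))) fun j _ _ => hpos j
    have hcR : c ^ (2 * α) ≤ K ^ (2 * α) * R := by
      refine (Real.rpow_le_rpow hc hcK (by positivity)).trans (le_of_eq ?_)
      rw [Real.mul_rpow hK (by positivity), ← Real.rpow_mul (by positivity), hR]
      congr 2
      unfold rate
      ring
    have hv : 1 / c * (min (c * c ^ (2 * α)) (Real.log n / n) +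
        Real.log n / n * (n : ℝ) ^ (-rate α)) ≤ K ^ (2 * α) * R + R := by
      -- For small c the vertical block is charged its signal, and log n/n < c bounds its
      -- exponential term.
      calc _ ≤ 1 / c * (c * c ^ (2 * α) + c * (n : ℝ) ^ (-rate α)) := by
            gcongr
            exact min_le_left _ _
        _ = c ^ (2 * α) + (n : ℝ) ^ (-rate α) := by field_simp
        _ ≤ _ := add_le_add hcR hNR
    calc _ ≤ C₁ * (C₅ ^ 2 * R + R + (K ^ (2 * α) * R + R)) := by gcongr
      _ = C₁ * (C₅ ^ 2 + 2 + K ^ (2 * α)) * R := by ring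
      _ ≤ _ := by
        gcongr
        exact le_add_of_nonneg_left hC₂.le

/-- The risk for neighborhoods of length at least `log n / n`. -/
lemma exists_risk_le_of_large [IsProbabilityMeasure P] (hB : IsPreBrownianReal B P)
    (W : WaveletBasis r) {α M : ℝ} (hα : 0 < α) (hαr : α < r) (hM : 0 < M) {lam : ℝ}
    (hlam_gt : 1 < lam) (hlam : lam - Real.log lam - 1 = 2) :
    ∃ C : ℝ, 0 < C ∧ ∀ f ∈ holderClass α M, ∀ {n : ℕ} (_ : 1 ≤ Real.log n) {L : ℕ}
      (_ : |(L : ℝ) - Real.log n| < 1) {x₀ c : ℝ} (_ : Icc (x₀ - c) (x₀ + c) ⊆ Icc 0 1)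
      (_ : Real.log n / n < c),
      risk P (adaptiveEstimator P W x₀ c n L lam (observation B n f)) f x₀ c ≤
        ENNReal.ofReal (C * (Real.log n / n / c + (n : ℝ) ^ (-rate α))) := by
  obtain ⟨C₁, hC₁, hhyb⟩ := exists_risk_le_of_hybrid hB W hα hαr hM hlam_gt hlam
  -- 130 = 128 + 2: the coarse levels give 128 and the vertical block gives 2.
  refine ⟨C₁ * 130, by positivity, ?_⟩
  intro f hf n hn L hL x₀ c hI hcn
  have hn0 := pos_of_one_le_log hn
  have hn' : (0 : ℝ) < n := by exact_mod_cast hn0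
  have hn1 : (1 : ℝ) ≤ n := by exact_mod_cast hn0
  have hc : 0 < c := lt_of_le_of_lt (by positivity) hcn
  have hc1 := le_one_of_Icc_subset hc.le hI
  refine (hhyb f hf hn hL hI hcn).trans (ENNReal.ofReal_le_ofReal ?_)
  set τ := √(Real.log n / n) with hτ
  have hτsq : τ ^ 2 = Real.log n / n := Real.sq_sqrt (by positivity)
  set N := (n : ℝ) ^ (-rate α) with hN
  have hN0 : 0 < N := by positivity
  have hN1 : N ≤ 1 := Real.rpow_le_one_of_one_le_of_nonpos hn1 (neg_nonpos.2 (rate_pos hα).le)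
  -- Smoothness is not needed at the coarse levels: summing 2^{j/2}τ up to 2^j ≈ 1/c gives order
  -- τ/√c, whose square is log n/(nc).
  have hlev : ∀ j, levelError α n τ j ≤ 2 * τ := by
    intro j
    have h1 : (n : ℝ) ^ (-((1 + rate α) / 2)) ≤ τ := by
      refine le_trans ?_ (sqrt_one_div_le hn)
      rw [Real.sqrt_eq_rpow, one_div, Real.inv_rpow hn'.le, ← Real.rpow_neg hn'.le]
      exact Real.rpow_le_rpow_of_exponent_le hn1 (by linarith [rate_pos hα])
    have h2 := min_le_left τ (((2 : ℝ) ^ j) ^ (-(α + 1 / 2)))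
    unfold levelError
    linarith
  have hpos : ∀ j, 0 ≤ √((2 : ℝ) ^ j) * levelError α n τ j := fun j =>
    mul_nonneg (Real.sqrt_nonneg _) (levelError_pos hn0 (Real.sqrt_nonneg _) j).le
  have hS : (∑ j ∈ Finset.Ico W.j₀ (min (max (level c⁻¹) W.j₀) (level n)),
      √((2 : ℝ) ^ j) * levelError α n τ j) ^ 2 ≤ 128 * (Real.log n / n / c) := by
    have h1 : ∑ j ∈ Finset.Ico W.j₀ (min (max (level c⁻¹) W.j₀) (level n)),
        √((2 : ℝ) ^ j) * levelError α n τ j ≤ 4 * √(2 ^ level c⁻¹) * (2 * τ) := by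
      calc _ ≤ ∑ j ∈ Finset.range (level c⁻¹), √((2 : ℝ) ^ j) * levelError α n τ j := by
            refine Finset.sum_le_sum_of_subset_of_nonneg (fun j hj => ?_) fun j _ _ => hpos j
            rw [Finset.mem_Ico] at hj
            have := hj.2.trans_le (min_le_left _ _)
            rw [lt_max_iff] at this
            exact Finset.mem_range.2 (this.resolve_right (not_lt.2 hj.1))
        _ ≤ ∑ j ∈ Finset.range (level c⁻¹), √((2 : ℝ) ^ j) * (2 * τ) :=
            Finset.sum_le_sum fun j _ => mul_le_mul_of_nonneg_left (hlev j) (Real.sqrt_nonneg _)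
        _ ≤ _ := by
            rw [← Finset.sum_mul]
            gcongr
            exact sum_range_sqrt_two_pow_le _
    refine (pow_le_pow_left₀ (Finset.sum_nonneg fun j _ => hpos j) h1 2).trans ?_
    rw [mul_pow, mul_pow, mul_pow, hτsq, Real.sq_sqrt (by positivity)]
    have h2 := two_pow_level_le ((one_le_inv₀ hc).2 hc1)
    calc _ ≤ 4 ^ 2 * (2 * c⁻¹) * (2 ^ 2 * (Real.log n / n)) := by gcongr
      _ = _ := by ring
  -- For large c the vertical block is charged its noise log n/n instead of its signal.
  have hv : 1 / c * (min (c * c ^ (2 * α)) (Real.log n / n) + Real.log n / n * N) ≤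
      2 * (Real.log n / n / c) := by
    calc _ ≤ 1 / c * (Real.log n / n + Real.log n / n * 1) := by
          gcongr
          exact min_le_right _ _
      _ = _ := by ring
  have hw : 0 ≤ Real.log n / n / c := by positivity
  calc _ ≤ C₁ * (128 * (Real.log n / n / c) + N + 2 * (Real.log n / n / c)) := by gcongr
    _ ≤ C₁ * (130 * (Real.log n / n / c + N)) := by
      gcongr
      linarith
    _ = _ := by ring

end

/-! ### Asymptotics -/

lemma eventually_le_log (a : ℝ) : ∀ᶠ n : ℕ in atTop, a ≤ Real.log n :=
  (Real.tendsto_log_atTop.comp tendsto_natCast_atTop_atTop).eventually_ge_atTop a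

lemma limsup_mul_iSup_lt_top {S : Set (ℝ → ℝ)} {A b : ℕ → ℝ} {R : ℕ → (ℝ → ℝ) → ℝ≥0∞} {C : ℝ}
    (hR : ∀ᶠ n in atTop, ∀ f ∈ S, R n f ≤ ENNReal.ofReal (b n))
    (hA : ∀ᶠ n in atTop, 0 ≤ A n ∧ A n * b n ≤ C) :
    limsup (fun n => ENNReal.ofReal (A n) * ⨆ f ∈ S, R n f) atTop < ⊤ := by
  refine lt_of_le_of_lt (limsup_le_of_le (a := ENNReal.ofReal C) (h := ?_)) ENNReal.ofReal_lt_top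
  filter_upwards [hR, hA] with n h1 h2
  calc _ ≤ ENNReal.ofReal (A n) * ENNReal.ofReal (b n) := by
        gcongr
        exact iSup₂_le h1
    _ = ENNReal.ofReal (A n * b n) := (ENNReal.ofReal_mul h2.1).symm
    _ ≤ _ := ENNReal.ofReal_le_ofReal h2.2

/-- Since n · n^{-1/(1+2α)} = n^{rate}, the vertical block costs log n/d times the minimax rate;
hence the role of d/log n in the last two regimes. -/
lemma log_div_div_eq {α : ℝ} (hα : 0 < α) {n : ℕ} (hn : 0 < n) {d c : ℝ}
    (hc : c = d * (n : ℝ) ^ (-1 / (1 + 2 * α))) :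
    Real.log n / n / c = Real.log n / d * (n : ℝ) ^ (-rate α) := by
  have hn' : (0 : ℝ) < n := by exact_mod_cast hn
  have h : (n : ℝ) * (n : ℝ) ^ (-1 / (1 + 2 * α)) = (n : ℝ) ^ rate α := by
    nth_rewrite 1 [← Real.rpow_one (n : ℝ)]
    rw [← Real.rpow_add hn']
    congr 1
    unfold rate
    field_simp
    ring
  rw [hc, Real.rpow_neg hn'.le, ← h]
  field_simp

lemma log_div_le_one {n : ℕ} (hn : 0 < n) : Real.log n / n ≤ 1 := by
  have hn' : (0 : ℝ) < n := by exact_mod_cast hn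
  rw [div_le_one hn']
  exact (Real.log_le_sub_one_of_pos hn').trans (by linarith)

lemma log_rpow_mul {α : ℝ} {n : ℕ} (hn : 1 ≤ Real.log n) :
    Real.log n ^ (1 / (1 + 2 * α)) * (n : ℝ) ^ (-1 / (1 + 2 * α)) =
      (Real.log n / n) ^ (1 / (1 + 2 * α)) := by
  have hn' : (0 : ℝ) < n := by exact_mod_cast pos_of_one_le_log hn
  rw [Real.div_rpow (by linarith) hn'.le, neg_div, Real.rpow_neg hn'.le, ← div_eq_mul_inv]

end ShrinkNbhd

end

/-! ### The three regimes of the neighborhood size -/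

theorem theorem3 {Ω : Type*} [MeasurableSpace Ω] (P : Measure Ω) [IsProbabilityMeasure P]
    (B : ℝ≥0 → Ω → ℝ) (hB : IsBrownianReal B P)
    (r : ℕ) (W : ShrinkNbhd.WaveletBasis r)
    (lam : ℝ) (hlam_gt : 1 < lam) (hlam : lam - Real.log lam - 1 = 2)
    (L : ℕ → ℕ) (hL : ∀ n, |(L n : ℝ) - Real.log n| < 1)
    (α M : ℝ) (hα : 0 < α) (hαr : α < r) (hM : 0 < M)
    (x₀ : ℝ) (hx₀ : 0 < x₀) (hx₁ : x₀ < 1)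
    (c d : ℕ → ℝ) (hd : ∀ n, 0 ≤ d n)
    (hcd : ∀ n ≥ 1, c n = d n * (n : ℝ) ^ (-1 / (1 + 2 * α)))
    (hc : ∀ᶠ n in atTop, Icc (x₀ - c n) (x₀ + c n) ⊆ Icc 0 1) :
    (limsup (fun n : ℕ => ((d n * Real.log n ^ (-1 / (1 + 2 * α)) : ℝ) : EReal)) atTop < ⊤ →
      limsup (fun n : ℕ =>
        ENNReal.ofReal (((n : ℝ) / Real.log n) ^ (2 * α / (1 + 2 * α))) *
          ⨆ f ∈ ShrinkNbhd.holderClass α M,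
            ShrinkNbhd.risk P
              (ShrinkNbhd.adaptiveEstimator P W x₀ (c n) n (L n) lam
                (ShrinkNbhd.observation B n f)) f x₀ (c n)) atTop < ⊤) ∧
    (liminf (fun n : ℕ => ((d n * Real.log n ^ (-1 / (1 + 2 * α)) : ℝ) : EReal)) atTop = ⊤ →
      limsup (fun n : ℕ => ((d n * (Real.log n)⁻¹ : ℝ) : EReal)) atTop = 0 →
      limsup (fun n : ℕ =>
        ENNReal.ofReal ((n : ℝ) ^ (2 * α / (1 + 2 * α)) * (d n / Real.log n)) *
          ⨆ f ∈ ShrinkNbhd.holderClass α M,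
            ShrinkNbhd.risk P
              (ShrinkNbhd.adaptiveEstimator P W x₀ (c n) n (L n) lam
                (ShrinkNbhd.observation B n f)) f x₀ (c n)) atTop < ⊤) ∧
    (0 < liminf (fun n : ℕ => ((d n * (Real.log n)⁻¹ : ℝ) : EReal)) atTop →
      limsup (fun n : ℕ =>
        ENNReal.ofReal ((n : ℝ) ^ (2 * α / (1 + 2 * α))) *
          ⨆ f ∈ ShrinkNbhd.holderClass α M,
            ShrinkNbhd.risk P
              (ShrinkNbhd.adaptiveEstimator P W x₀ (c n) n (L n) lam
                (ShrinkNbhd.observation B n f)) f x₀ (c n)) atTop < ⊤) := by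
  have hα1 : 0 < 1 + 2 * α := by positivity
  have hBpre := hB.toIsPreBrownianReal
  have hlog1 := ShrinkNbhd.eventually_le_log 1
  have hlog_rpow : ∀ {n : ℕ}, 1 ≤ Real.log n → ∀ {x y : ℝ},
      (x * Real.log n ^ (-1 / (1 + 2 * α)) ≤ y ↔ x ≤ y * Real.log n ^ (1 / (1 + 2 * α))) := by
    intro n hn x y
    have : 0 < Real.log n ^ (1 / (1 + 2 * α)) := by positivity
    rw [neg_div, Real.rpow_neg (by linarith), ← div_eq_mul_inv, div_le_iff₀ this]
  refine ⟨fun hlim => ?_, fun hlim hlim' => ?_, fun hlim => ?_⟩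
  · obtain ⟨K, hK, -⟩ := EReal.lt_iff_exists_real_btwn.1 hlim
    obtain ⟨C, hC, hrisk⟩ := ShrinkNbhd.exists_risk_le_of_small hBpre W hα hαr hM hlam_gt hlam
      (le_max_right K 0)
    refine ShrinkNbhd.limsup_mul_iSup_lt_top (C := C)
      (b := fun n => C * (Real.log n / n) ^ ShrinkNbhd.rate α) ?_ ?_
    · filter_upwards [eventually_lt_of_limsup_lt hK, hlog1, hc] with n h1 hn hI f hf
      have hn0 := ShrinkNbhd.pos_of_one_le_log hn
      have h2 : d n ≤ max K 0 * Real.log n ^ (1 / (1 + 2 * α)) :=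
        (hlog_rpow hn).1 ((EReal.coe_lt_coe_iff.1 h1).le.trans (le_max_left _ _))
      refine hrisk f hf hn (hL n) hI ?_ ?_
      · rw [hcd n hn0]
        exact mul_nonneg (hd n) (by positivity)
      · rw [hcd n hn0, ← ShrinkNbhd.log_rpow_mul hn, ← mul_assoc]
        gcongr
    · filter_upwards [hlog1] with n hn
      have hn' : (0 : ℝ) < n := by exact_mod_cast ShrinkNbhd.pos_of_one_le_log hn
      refine ⟨by positivity, le_of_eq ?_⟩
      rw [mul_left_comm, ShrinkNbhd.rate, ← Real.mul_rpow (by positivity) (by positivity),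
        div_mul_div_cancel₀ (by positivity), div_self hn'.ne', Real.one_rpow, mul_one]
  · obtain ⟨C, hC, hrisk⟩ := ShrinkNbhd.exists_risk_le_of_large hBpre W hα hαr hM hlam_gt hlam
    -- Eventually c exceeds (log n/n)^{1/(1+2α)} ≥ log n/n, so the estimator is the hybrid one.
    have hev : ∀ᶠ n : ℕ in atTop, 1 ≤ Real.log n ∧ 0 < d n ∧ Real.log n / n < c n := by
      have h : ∀ᶠ n : ℕ in atTop,
          ((1 : ℝ) : EReal) < ((d n * Real.log n ^ (-1 / (1 + 2 * α)) : ℝ) : EReal) :=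
        eventually_lt_of_lt_liminf (hlim ▸ EReal.coe_lt_top 1)
      filter_upwards [h, hlog1] with n h1 hn
      have hn0 := ShrinkNbhd.pos_of_one_le_log hn
      have hn' : (0 : ℝ) < n := by exact_mod_cast hn0
      have h2 : Real.log n ^ (1 / (1 + 2 * α)) < d n := by
        rw [EReal.coe_lt_coe_iff, ← not_le, hlog_rpow hn, one_mul, not_le] at h1
        exact h1
      refine ⟨hn, lt_trans (by positivity) h2, ?_⟩
      calc Real.log n / n = (Real.log n / n) ^ (1 : ℝ) := (Real.rpow_one _).symm
        _ ≤ (Real.log n / n) ^ (1 / (1 + 2 * α)) :=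
          Real.rpow_le_rpow_of_exponent_ge (by positivity) (ShrinkNbhd.log_div_le_one hn0)
            ((div_le_one hα1).2 (by linarith))
        _ < c n := by
          rw [hcd n hn0, ← ShrinkNbhd.log_rpow_mul hn]
          gcongr
    refine ShrinkNbhd.limsup_mul_iSup_lt_top (C := 2 * C)
      (b := fun n => C * (Real.log n / n / c n + (n : ℝ) ^ (-ShrinkNbhd.rate α))) ?_ ?_
    · filter_upwards [hev, hc] with n h hI f hf
      exact hrisk f hf h.1 (hL n) hI h.2.2
    · have h0 : ∀ᶠ n : ℕ in atTop, ((d n * (Real.log n)⁻¹ : ℝ) : EReal) < ((1 : ℝ) : EReal) :=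
        eventually_lt_of_limsup_lt (by rw [hlim']; exact EReal.coe_pos.2 one_pos)
      filter_upwards [hev, h0] with n ⟨hn, hdn, _⟩ h1
      have hn0 := ShrinkNbhd.pos_of_one_le_log hn
      have hn' : (0 : ℝ) < n := by exact_mod_cast hn0
      rw [EReal.coe_lt_coe_iff, ← div_eq_mul_inv] at h1
      refine ⟨by positivity, ?_⟩
      rw [ShrinkNbhd.log_div_div_eq hα hn0 (hcd n hn0), Real.rpow_neg hn'.le]
      change (n : ℝ) ^ ShrinkNbhd.rate α * (d n / Real.log n) * _ ≤ _
      have hN : 0 < (n : ℝ) ^ ShrinkNbhd.rate α := by positivity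
      calc _ = C * (1 + d n / Real.log n) := by field_simp
        _ ≤ C * (1 + 1) := by gcongr
        _ = _ := by ring
  · obtain ⟨C, hC, hrisk⟩ := ShrinkNbhd.exists_risk_le_of_large hBpre W hα hαr hM hlam_gt hlam
    obtain ⟨ε, hε, hεlim⟩ := EReal.lt_iff_exists_real_btwn.1 hlim
    have hε0 : 0 < ε := EReal.coe_pos.1 hε
    -- Here log n/(nc) = (log n/d) n^{-rate} < ε⁻¹ n^{-rate}, so the hybrid estimator is in force
    -- once n^{rate} ≥ ε⁻¹.
    have hpow : ∀ᶠ n : ℕ in atTop, ε⁻¹ ≤ (n : ℝ) ^ ShrinkNbhd.rate α :=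
      ((tendsto_rpow_atTop (ShrinkNbhd.rate_pos hα)).comp
        tendsto_natCast_atTop_atTop).eventually_ge_atTop _
    have hev : ∀ᶠ n : ℕ in atTop,
        1 ≤ Real.log n ∧ ε * Real.log n < d n ∧ Real.log n / n < c n := by
      filter_upwards [eventually_lt_of_lt_liminf hεlim, hlog1, hpow] with n h1 hn h2
      have hn0 := ShrinkNbhd.pos_of_one_le_log hn
      have hn' : (0 : ℝ) < n := by exact_mod_cast hn0
      have hlog0 : 0 < Real.log n := by linarith
      rw [EReal.coe_lt_coe_iff, ← div_eq_mul_inv, lt_div_iff₀ hlog0] at h1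
      have hdn : 0 < d n := lt_trans (by positivity) h1
      have hcn : 0 < c n := by rw [hcd n hn0]; positivity
      refine ⟨hn, h1, ?_⟩
      rw [← div_lt_one hcn, ShrinkNbhd.log_div_div_eq hα hn0 (hcd n hn0), Real.rpow_neg hn'.le,
        ← div_eq_mul_inv, div_lt_one (by positivity)]
      refine lt_of_lt_of_le ?_ h2
      rw [div_lt_iff₀ hdn, inv_mul_eq_div, lt_div_iff₀ hε0, mul_comm]
      exact h1
    refine ShrinkNbhd.limsup_mul_iSup_lt_top (C := C * (ε⁻¹ + 1))
      (b := fun n => C * (Real.log n / n / c n + (n : ℝ) ^ (-ShrinkNbhd.rate α))) ?_ ?_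
    · filter_upwards [hev, hc] with n h hI f hf
      exact hrisk f hf h.1 (hL n) hI h.2.2
    · filter_upwards [hev] with n ⟨hn, h1, _⟩
      have hn0 := ShrinkNbhd.pos_of_one_le_log hn
      have hn' : (0 : ℝ) < n := by exact_mod_cast hn0
      have hdn : 0 < d n := lt_trans (by positivity) h1
      refine ⟨by positivity, ?_⟩
      rw [ShrinkNbhd.log_div_div_eq hα hn0 (hcd n hn0), Real.rpow_neg hn'.le]
      change (n : ℝ) ^ ShrinkNbhd.rate α * _ ≤ _
      have hN : 0 < (n : ℝ) ^ ShrinkNbhd.rate α := by positivity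
      calc _ = C * (Real.log n / d n + 1) := by field_simp
        _ ≤ _ := by
          gcongr
          rw [div_le_iff₀ hdn, inv_mul_eq_div, le_div_iff₀ hε0, mul_comm]
          exact h1.le
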